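/- A mixed-state quantum circuit is given by a sequence of gates from the following set, applied to an initial register of qubits: the unitary gates Pauli $X$, Pauli $Z$, Hadamard, $\pi/8$ gate $T=\mathrm{diag}(1,e^{i\pi/4})$, two-qubit swap and controlled-not, and the non-unitary gates measurement in the computational basis, introduction of an ancillary qubit in state $|0\rangle$, partial trace over a qubit, completely depolarizing channel and completely dephasing channel (on a qubit). A circuit with $k$ input and $l$ output qubits is identified with the channel $L(\mathbb{C}^{2^k})\to L(\mathbb{C}^{2^l})$ that it implements. Circuits are described by strings over a finite alphabet, of length polynomial in the number of gates and qubits. For a linear map $\Phi\colon L(\mathcal H)\to L(\mathcal K)$, the diamond norm is $$\|\Phi\|_\diamond=\max_{0\ne X\in L(\mathcal H\otimes\mathcal H)}\frac{\|(\Phi\otimes \mathrm{id}_{L(\mathcal H)})(X)\|_{\mathrm{tr}}}{\|X\|_{\mathrm{tr}}},\qquad \|X\|_{\mathrm{tr}}=\operatorname{tr}\sqrt{X^*X}.$$ **Theorem.** Let $a,b\in(0,2)$ be constants with $2b<a^2$. There exists a deterministic polynomial-time procedure that, on input $(Q_1,Q_2,1^n)$, where $n\ge 0$ and $Q_1,Q_2$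 are (descriptions of) mixed-state quantum circuits with the same number of input qubits and the same number of output qubits, outputs (descriptions of) two mixed-state quantum circuits $(C_1,C_2)$, again with equal numbers of input qubits and equal numbers of output qubits, such that $$\|Q_1-Q_2\|_\diamond\le b\implies \|C_1-C_2\|_\diamond<2^{-n},$$ $$\|Q_1-Q_2\|_\diamond\ge a\implies \|C_1-C_2\|_\diamond>2-2^{-n}.$$ The running time is bounded by a polynomial (which may depend on $a,b$) in the length of the input $(Q_1,Q_2,1^n)$. -/

import Mathlib

namespace QCircuit

noncomputable section

/-! ### Mixed-state quantum circuits -/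

/-- `Gate n m`: a gate of the mixed-state circuit model placed in a circuit, where `n` wires
(qubits) are present before and `m` wires after the gate. The wires present at any moment are
numbered from `0`; an `ancilla` gate inserts a new wire at the given position and a `traceOut`
gate removes the wire at the given position. -/
inductive Gate : ℕ → ℕ → Type
  /-- Pauli `X` gate -/
  | pauliX {n : ℕ} (i : Fin n) : Gate n n
  /-- Pauli `Z` gate -/
  | pauliZ {n : ℕ} (i : Fin n) : Gate n n
  /-- Hadamard gate -/
  | hadamard {n : ℕ} (i : Fin n) : Gate n n
  /-- `π/8` gate -/
  | phaseT {n : ℕ} (i : Fin n) : Gate n n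
  /-- two-qubit swap gate -/
  | swap {n : ℕ} (i j : Fin n) (hij : i ≠ j) : Gate n n
  /-- controlled-not gate with control `i` and target `j` -/
  | cnot {n : ℕ} (i j : Fin n) (hij : i ≠ j) : Gate n n
  /-- measurement in the computational basis -/
  | measure {n : ℕ} (i : Fin n) : Gate n n
  /-- completely dephasing channel -/
  | dephase {n : ℕ} (i : Fin n) : Gate n n
  /-- completely depolarizing channel -/
  | depolarize {n : ℕ} (i : Fin n) : Gate n n
  /-- introduction of an ancillary qubit in the state `|0⟩` -/
  | ancilla {n : ℕ} (i : Fin (n + 1)) : Gate n (n + 1)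
  /-- partial trace over a qubit -/
  | traceOut {n : ℕ} (i : Fin (n + 1)) : Gate (n + 1) n

/-- A mixed-state quantum circuit with `k` input qubits and `l` output qubits: a sequence of
gates, each acting on the wires left by the previous one. -/
inductive Circuit : ℕ → ℕ → Type
  | nil {k : ℕ} : Circuit k k
  | cons {k m l : ℕ} (g : Gate k m) (C : Circuit m l) : Circuit k l

/-! ### The channel implemented by a circuit -/

/-- Linear operators on the space of `n` qubits, as matrices in the computational basis. -/
abbrev QOp (n : ℕ) : Type := Matrix (Fin n → Fin 2) (Fin n → Fin 2) ℂ

/-- The operator acting as `U` on qubit `i` and as the identity on the other qubits. -/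
def onQubit {n : ℕ} (U : Matrix (Fin 2) (Fin 2) ℂ) (i : Fin n) : QOp n :=
  Matrix.of fun x y => if ∀ m, m ≠ i → x m = y m then U (x i) (y i) else 0

/-- The operator acting as `U` on the qubits `i`, `j` (in this order) and as the identity on the
other qubits. -/
def onQubits {n : ℕ} (U : Matrix (Fin 2 × Fin 2) (Fin 2 × Fin 2) ℂ) (i j : Fin n) : QOp n :=
  Matrix.of fun x y =>
    if ∀ m, m ≠ i → m ≠ j → x m = y m then U (x i, x j) (y i, y j) else 0

def matX : Matrix (Fin 2) (Fin 2) ℂ := !![0, 1; 1, 0]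

def matZ : Matrix (Fin 2) (Fin 2) ℂ := !![1, 0; 0, -1]

def matH : Matrix (Fin 2) (Fin 2) ℂ := ((Real.sqrt 2 : ℝ) : ℂ)⁻¹ • !![1, 1; 1, -1]

def matT : Matrix (Fin 2) (Fin 2) ℂ :=
  !![1, 0; 0, Complex.exp (Complex.I * (Real.pi : ℂ) / 4)]

/-- `|a⟩|b⟩ ↦ |b⟩|a⟩` -/
def matSwap : Matrix (Fin 2 × Fin 2) (Fin 2 × Fin 2) ℂ :=
  Matrix.of fun p q => if p = (q.2, q.1) then 1 else 0

/-- `|a⟩|b⟩ ↦ |a⟩|a + b⟩` -/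
def matCNOT : Matrix (Fin 2 × Fin 2) (Fin 2 × Fin 2) ℂ :=
  Matrix.of fun p q => if p = (q.1, q.1 + q.2) then 1 else 0

/-- The map `ρ ↦ U ρ U*`. -/
def conjBy {n : ℕ} (U : QOp n) : QOp n →ₗ[ℂ] QOp n where
  toFun ρ := U * ρ * U.conjTranspose
  map_add' ρ σ := by simp [Matrix.mul_add, Matrix.add_mul]
  map_smul' c ρ := by simp

/-- The dephasing channel `|a⟩⟨b| ↦ δ_{ab} |a⟩⟨b|` on qubit `i`. -/
def dephaseAt {n : ℕ} (i : Fin n) : QOp n →ₗ[ℂ] QOp n where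
  toFun ρ := Matrix.of fun x y => if x i = y i then ρ x y else 0
  map_add' ρ σ := by
    ext x y
    by_cases h : x i = y i <;> simp [h]
  map_smul' c ρ := by
    ext x y
    by_cases h : x i = y i <;> simp [h]

/-- The depolarizing channel on qubit `i`: that qubit is replaced by one in the state `1/2`. -/
def depolarizeAt {n : ℕ} (i : Fin n) : QOp n →ₗ[ℂ] QOp n where
  toFun ρ := Matrix.of fun x y =>
    if x i = y i then
      (1 / 2 : ℂ) * ∑ c : Fin 2, ρ (Function.update x i c) (Function.update y i c)
    else 0
  map_add' ρ σ := by
    ext x y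
    by_cases h : x i = y i
    · simp [h]
      ring
    · simp [h]
  map_smul' c ρ := by
    ext x y
    by_cases h : x i = y i
    · simp [h]
      ring
    · simp [h]

/-- Tensoring with `|0⟩⟨0|`, the new qubit being qubit `i` of the result. -/
def ancillaAt {n : ℕ} (i : Fin (n + 1)) : QOp n →ₗ[ℂ] QOp (n + 1) where
  toFun ρ := Matrix.of fun x y =>
    if x i = 0 ∧ y i = 0 then ρ (i.removeNth x) (i.removeNth y) else 0
  map_add' ρ σ := by
    ext x y
    by_cases h : x i = 0 ∧ y i = 0 <;> simp [h]
  map_smul' c ρ := by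
    ext x y
    by_cases h : x i = 0 ∧ y i = 0 <;> simp [h]

/-- The partial trace over qubit `i`. -/
def traceAt {n : ℕ} (i : Fin (n + 1)) : QOp (n + 1) →ₗ[ℂ] QOp n where
  toFun ρ := Matrix.of fun x y =>
    ∑ c : Fin 2, ρ (i.insertNth (α := fun _ => Fin 2) c x) (i.insertNth (α := fun _ => Fin 2) c y)
  map_add' ρ σ := by
    ext x y
    simp [Finset.sum_add_distrib]
  map_smul' c ρ := by
    ext x y
    simp [mul_add]

/-- The quantum channel applied by a gate. -/
def Gate.channel : {n m : ℕ} → Gate n m → (QOp n →ₗ[ℂ] QOp m)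
  | _, _, .pauliX i => conjBy (onQubit matX i)
  | _, _, .pauliZ i => conjBy (onQubit matZ i)
  | _, _, .hadamard i => conjBy (onQubit matH i)
  | _, _, .phaseT i => conjBy (onQubit matT i)
  | _, _, .swap i j _ => conjBy (onQubits matSwap i j)
  | _, _, .cnot i j _ => conjBy (onQubits matCNOT i j)
  | _, _, .measure i => dephaseAt i
  | _, _, .dephase i => dephaseAt i
  | _, _, .depolarize i => depolarizeAt i
  | _, _, .ancilla i => ancillaAt i
  | _, _, .traceOut i => traceAt i

/-- The quantum channel implemented by a circuit. -/
def Circuit.channel : {k l : ℕ} → Circuit k l → (QOp k →ₗ[ℂ] QOp l)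
  | _, _, .nil => LinearMap.id
  | _, _, .cons g C => C.channel ∘ₗ g.channel

/-! ### The diamond norm -/

/-- The trace norm `tr √(X* X)`: the sum of the singular values of `X`, i.e. of the square roots
of the eigenvalues of `X* X`. -/
def traceNorm {ι : Type*} [Fintype ι] [DecidableEq ι] (X : Matrix ι ι ℂ) : ℝ :=
  ∑ i, Real.sqrt ((Matrix.isHermitian_conjTranspose_mul_self X).eigenvalues i)

/-- `(Φ ⊗ id)(X)`, where the identity acts on operators on a space with basis `κ`. -/
def tensorId {ι ι' : Type*} (κ : Type*)
    (Φ : Matrix ι ι ℂ →ₗ[ℂ] Matrix ι' ι' ℂ) (X : Matrix (ι × κ) (ι × κ) ℂ) :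
    Matrix (ι' × κ) (ι' × κ) ℂ :=
  Matrix.of fun p q => Φ (Matrix.of fun i j => X (i, p.2) (j, q.2)) p.1 q.1

/-- The diamond norm of a linear map `Φ : L(H) → L(K)`: the maximum of
`‖(Φ ⊗ id_{L(H)})(X)‖_tr / ‖X‖_tr` over all nonzero `X ∈ L(H ⊗ H)`. -/
def diamondNorm {ι ι' : Type*} [Fintype ι] [DecidableEq ι] [Fintype ι'] [DecidableEq ι']
    (Φ : Matrix ι ι ℂ →ₗ[ℂ] Matrix ι' ι' ℂ) : ℝ :=
  sSup {r : ℝ | ∃ X : Matrix (ι × ι) (ι × ι) ℂ,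
    X ≠ 0 ∧ r = traceNorm (tensorId ι Φ X) / traceNorm X}

/-! ### Descriptions of circuits as strings over a finite alphabet -/

/-- The alphabet used to describe circuits and inputs. -/
inductive Sym : Type
  | tick | sep | endMark
  | pauliX | pauliZ | hadamard | phaseT | swap | cnot
  | measure | dephase | depolarize | ancilla | traceOut
  deriving DecidableEq

instance : Fintype Sym where
  elems := {.tick, .sep, .endMark, .pauliX, .pauliZ, .hadamard, .phaseT, .swap, .cnot,
    .measure, .dephase, .depolarize, .ancilla, .traceOut}
  complete s := by cases s <;> decide

/-- The number `i` in unary, followed by a separator. -/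
def unary (i : ℕ) : List Sym := List.replicate i Sym.tick ++ [Sym.sep]

/-- The description of a gate: its type followed by the numbers of the wires it acts on. -/
def Gate.encode : {n m : ℕ} → Gate n m → List Sym
  | _, _, .pauliX i => .pauliX :: unary i
  | _, _, .pauliZ i => .pauliZ :: unary i
  | _, _, .hadamard i => .hadamard :: unary i
  | _, _, .phaseT i => .phaseT :: unary i
  | _, _, .swap i j _ => .swap :: (unary i ++ unary j)
  | _, _, .cnot i j _ => .cnot :: (unary i ++ unary j)
  | _, _, .measure i => .measure :: unary i
  | _, _, .dephase i => .dephase :: unary i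
  | _, _, .depolarize i => .depolarize :: unary i
  | _, _, .ancilla i => .ancilla :: unary i
  | _, _, .traceOut i => .traceOut :: unary i

/-- The descriptions of the gates of a circuit in order, followed by an end mark. -/
def Circuit.encodeGates : {k l : ℕ} → Circuit k l → List Sym
  | _, _, .nil => [Sym.endMark]
  | _, _, .cons g C => g.encode ++ C.encodeGates

/-- The description of a circuit: the number of its input qubits in unary, then its gates. -/
def Circuit.encode {k l : ℕ} (C : Circuit k l) : List Sym := unary k ++ C.encodeGates

/-- A pair of circuits of the same type (same number of input qubits, same number of output
qubits). -/
structure CircuitPair where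
  /-- number of input qubits -/
  inputs : ℕ
  /-- number of output qubits -/
  outputs : ℕ
  fst : Circuit inputs outputs
  snd : Circuit inputs outputs

/-- The diamond norm of the difference of the channels implemented by the two circuits. -/
def CircuitPair.dist (P : CircuitPair) : ℝ := diamondNorm (P.fst.channel - P.snd.channel)

/-- The description of a pair of circuits. -/
def CircuitPair.encode (P : CircuitPair) : List Sym := P.fst.encode ++ P.snd.encode

/-- The string `(Q₁, Q₂, 1ⁿ)`. -/
def encodeInput (I : CircuitPair × ℕ) : List Sym :=
  I.1.encode ++ List.replicate I.2 Sym.tick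

/-! The descriptions determine the objects they describe. -/

theorem unary_inj {i j : ℕ} {s t : List Sym} (h : unary i ++ s = unary j ++ t) : i = j ∧ s = t := by
  induction i generalizing j with
  | zero => cases j <;> simp_all [unary, List.replicate_succ]
  | succ i ih =>
    cases j with
    | zero => simp_all [unary, List.replicate_succ]
    | succ j =>
      have := @ih j (by simpa [unary, List.replicate_succ] using h)
      exact ⟨by rw [this.1], this.2⟩

theorem gate_inj {n m m' : ℕ} (g : Gate n m) (g' : Gate n m') {s t : List Sym}
    (h : g.encode ++ s = g'.encode ++ t) : m = m' ∧ HEq g g' ∧ s = t := by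
  cases g <;> cases g' <;> simp only [Gate.encode, List.cons_append, List.append_assoc, List.cons.injEq, reduceCtorEq, false_and, true_and] at h <;>
  first
  | (obtain ⟨h1, h2⟩ := unary_inj h
     obtain ⟨h3, h4⟩ := unary_inj h2
     have := Fin.ext h1; have := Fin.ext h3; subst_vars; exact ⟨rfl, HEq.rfl, rfl⟩)
  | (obtain ⟨h1, h2⟩ := unary_inj h
     have := Fin.ext h1; subst_vars; exact ⟨rfl, HEq.rfl, rfl⟩)

theorem gates_inj {n m m' : ℕ} (g : Circuit n m) (g' : Circuit n m') {s t : List Sym}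
    (h : g.encodeGates ++ s = g'.encodeGates ++ t) : m = m' ∧ HEq g g' ∧ s = t := by
  induction g generalizing s with
  | nil => 
    cases g' with
    | nil => simpa [Circuit.encodeGates] using h
    | cons g C => cases g <;> simp [Circuit.encodeGates, Gate.encode] at h
  | cons g C ih =>
    cases g' with
    | nil => cases g <;> simp [Circuit.encodeGates, Gate.encode] at h
    | cons g' C' =>
      simp only [Circuit.encodeGates, List.append_assoc] at h
      obtain ⟨rfl, h1, h2⟩ := gate_inj g g' h
      obtain ⟨rfl, h3, h4⟩ := ih C' h2
      subst h4; cases h1; cases h3; simp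

theorem encodeInput_inj : Function.Injective encodeInput := by
  rintro ⟨⟨k, l, C, D⟩, n⟩ ⟨⟨k', l', C', D'⟩, n'⟩ h
  simp only [encodeInput, CircuitPair.encode, Circuit.encode, List.append_assoc] at h
  obtain ⟨rfl, h⟩ := unary_inj h
  obtain ⟨rfl, h1, h⟩ := gates_inj _ _ h
  obtain ⟨_, h⟩ := unary_inj h
  obtain ⟨_, h2, h⟩ := gates_inj _ _ h
  have := congrArg List.length h
  simp at this; subst this; cases h1; cases h2; rfl

theorem pair_inj : Function.Injective CircuitPair.encode := by
  intro P Q h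
  have := @encodeInput_inj (P, 0) (Q, 0) (by simpa [encodeInput] using h)
  simpa using this

/-- `F` is computed by a deterministic Turing machine (with finitely many stacks) in time
polynomial in the length of the input string `(Q₁, Q₂, 1ⁿ)`. -/
def IsPolyTime (F : CircuitPair × ℕ → CircuitPair) : Prop :=
  Nonempty (Turing.TM2ComputableInPolyTime encodeInput CircuitPair.encode F)

end

end QCircuit

/-! Let `d` be the diamond norm of the difference of the two given channels `Φ 0`, `Φ 1`. The proof
polarizes `d` by alternating two operations on pairs of channels, as in the Sahai–Vadhan argument
for statistical distance.

Parity: for a bit `b`, run `r` channels `Φ y` in parallel with independent uniform bits `y`, and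
also output `b` plus the sum of these bits. Up to a power of `1/2`, the difference of the two
resulting channels is the tensor product of `r` copies of `Φ 0 - Φ 1` and of the difference of two
orthogonal bit preparations. Since the diamond norm is multiplicative (`diamondNorm_tensE`), the new
distance is exactly `2 * (d / 2) ^ r` (`diamondNorm_parityPair_sub`).

Repetition: run `K` copies of the same `Φ c`. A hybrid argument bounds the new distance by `K * d`
(`dBound_powerPair_sub`). For a lower bound, a distance above `d` yields an input state and a
two-outcome measurement whose outcome distributions have Bhattacharyya coefficient at most `√(1 -
(d/2)²)` (`distinguishable_of_lt`). This coefficient is multiplicative over independent copies, and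
a coefficient `β` forces distance at least `2 - 2β` (`Distinguishable.le_diamondNorm`), so
repetition gives at least `2 - 2 (1 - (d/2)²)^(K/2)`.

The hypothesis `2 * b < a ^ 2` says `b / 2 < (a / 2) ^ 2`. Hence for large `r` there is room for a
`K` with `K * (b/2)^r` small and `K * α^(2r)` large, where `α` is slightly below `a / 2`. With `r`
logarithmic in `n`, parity followed by repetition makes the near pair at most `1/2` apart and the
far pair exponentially close to `2`; a last parity over `n + 1` copies makes the near distance
exponentially small and hardly hurts the far one (`exists_polarization_parameters`).

Both operations are realized by circuits that read the selecting bit from a control wire. Running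
one of two circuits according to a control bit is done by sending the input to one of two registers
with controlled swaps, running each circuit on its register, and swapping the wanted output back
(`isSelector_selectGates`). The unwanted circuit acts on zeros and is traced out, which contributes
a factor `1`.

Finally, the circuit descriptions are produced by a program in a small structured language for stack
machines, which is compiled to a Turing machine with a polynomial time bound (`Prog.reaches_code`,
`Prog.isPolyTime_of_runs`). -/

namespace QCircuit

noncomputable section

set_option linter.unusedSectionVars false

section

open Matrix
open scoped ComplexOrder

/-! ### Euclidean norms and contractions -/

/-- The Euclidean norm of a complex vector. -/
def vnorm {ι : Type*} [Fintype ι] (a : ι → ℂ) : ℝ := ‖(WithLp.toLp 2 a : EuclideanSpace ℂ ι)‖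

section Vnorm

variable {ι κ μ : Type*} [Fintype ι] [Fintype κ] [Fintype μ]

theorem vnorm_nonneg (a : ι → ℂ) : 0 ≤ vnorm a := norm_nonneg _

theorem vnorm_sq (a : ι → ℂ) : vnorm a ^ 2 = ∑ i, ‖a i‖ ^ 2 := by
  simp [vnorm, EuclideanSpace.norm_sq_eq]

theorem vnorm_sq_dot (a : ι → ℂ) : ((vnorm a ^ 2 : ℝ) : ℂ) = star a ⬝ᵥ a := by
  rw [vnorm_sq]
  simp only [dotProduct, Pi.star_apply, Complex.ofReal_sum]
  refine Finset.sum_congr rfl fun i _ => ?_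
  rw [← Complex.normSq_eq_norm_sq, Complex.normSq_eq_conj_mul_self]
  rfl

theorem norm_star_dotProduct_le (a b : ι → ℂ) : ‖star a ⬝ᵥ b‖ ≤ vnorm a * vnorm b := by
  have := norm_inner_le_norm (𝕜 := ℂ) (WithLp.toLp 2 a : EuclideanSpace ℂ ι) (WithLp.toLp 2 b)
  rw [EuclideanSpace.inner_eq_star_dotProduct, dotProduct_comm] at this
  exact this

theorem vnorm_smul (c : ℂ) (a : ι → ℂ) : vnorm (c • a) = ‖c‖ * vnorm a := by
  simp [vnorm, norm_smul]

theorem vnorm_eq_zero {a : ι → ℂ} : vnorm a = 0 ↔ a = 0 := by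
  simp [vnorm]

theorem norm_apply_le_vnorm (a : ι → ℂ) (i : ι) : ‖a i‖ ≤ vnorm a := by
  refine le_of_sq_le_sq ?_ (vnorm_nonneg a)
  rw [vnorm_sq]
  exact Finset.single_le_sum (f := fun i => ‖a i‖ ^ 2) (fun _ _ => by positivity)
    (Finset.mem_univ i)

/-- Linear maps that do not increase the Euclidean norm. -/
def Contr (W : Matrix ι κ ℂ) : Prop := ∀ a, vnorm (W *ᵥ a) ≤ vnorm a

theorem Contr.mul {W : Matrix ι κ ℂ} {V : Matrix κ μ ℂ} (hW : Contr W) (hV : Contr V) :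
    Contr (W * V) := fun a => by
  rw [← mulVec_mulVec]
  exact (hW _).trans (hV a)

/-- By Cauchy–Schwarz, `‖W* a‖² = ⟨a, W W* a⟩ ≤ ‖a‖ ‖W* a‖`; cancel one factor. -/
theorem Contr.conjTranspose {W : Matrix ι κ ℂ} (hW : Contr W) : Contr Wᴴ := fun a => by
  have h : ((vnorm (Wᴴ *ᵥ a) ^ 2 : ℝ) : ℂ) = star a ⬝ᵥ (W *ᵥ (Wᴴ *ᵥ a)) := by
    rw [vnorm_sq_dot, star_mulVec, conjTranspose_conjTranspose, ← dotProduct_mulVec]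
  have h2 : vnorm (Wᴴ *ᵥ a) ^ 2 ≤ vnorm a * vnorm (Wᴴ *ᵥ a) := by
    have := norm_star_dotProduct_le a (W *ᵥ (Wᴴ *ᵥ a))
    rw [← h, Complex.norm_real, Real.norm_of_nonneg (by positivity)] at this
    exact this.trans (mul_le_mul_of_nonneg_left (hW _) (vnorm_nonneg a))
  nlinarith [vnorm_nonneg a, vnorm_nonneg (Wᴴ *ᵥ a)]

theorem contr_of_isometry [DecidableEq κ] {W : Matrix ι κ ℂ} (h : Wᴴ * W = 1) : Contr W :=
  fun a => by
  have : ((vnorm (W *ᵥ a) ^ 2 : ℝ) : ℂ) = ((vnorm a ^ 2 : ℝ) : ℂ) := by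
    rw [vnorm_sq_dot, vnorm_sq_dot, star_mulVec, dotProduct_mulVec, vecMul_vecMul, h, vecMul_one]
  have := Complex.ofReal_injective this
  exact le_of_sq_le_sq this.le (vnorm_nonneg a)

theorem Contr.vnorm_col_le [DecidableEq κ] {W : Matrix ι κ ℂ} (hW : Contr W) (j : κ) :
    vnorm (fun i => W i j) ≤ 1 := by
  have h := hW (Pi.single j 1)
  have e : W *ᵥ Pi.single j 1 = fun i => W i j := by
    ext i; simp
  have e2 : vnorm (Pi.single j (1 : ℂ)) = 1 := by
    simp [vnorm]
  rwa [e, e2] at h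

theorem Contr.norm_entry_le [DecidableEq κ] {W : Matrix ι κ ℂ} (hW : Contr W) (i : ι) (j : κ) :
    ‖W i j‖ ≤ 1 :=
  (norm_apply_le_vnorm (fun i => W i j) i).trans (hW.vnorm_col_le j)

end Vnorm

/-! ### Singular value decomposition and the trace norm -/

section Svd

variable {ι κ : Type*} [Fintype ι] [Fintype κ] [DecidableEq ι]

/-- Diagonalize `A* A` by a unitary `V`. The columns of `A V` are orthogonal with the singular
values as lengths, and `W` is obtained by normalizing the nonzero ones. The last identity is the
polar form, from which trace norms and Schmidt decompositions are read off. -/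
theorem exists_svd (A : Matrix κ ι ℂ) : ∃ (W : Matrix κ ι ℂ) (V : Matrix ι ι ℂ),
    Contr W ∧ Vᴴ * V = 1 ∧ V * Vᴴ = 1 ∧
    A = W * diagonal (fun i => ((Real.sqrt
      ((isHermitian_conjTranspose_mul_self A).eigenvalues i) : ℝ) : ℂ)) * Vᴴ ∧
    Wᴴ * A = diagonal (fun i => ((Real.sqrt
      ((isHermitian_conjTranspose_mul_self A).eigenvalues i) : ℝ) : ℂ)) * Vᴴ := by
  set h := isHermitian_conjTranspose_mul_self A
  set lam := h.eigenvalues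
  have hpos : ∀ i, 0 ≤ lam i := (posSemidef_conjTranspose_mul_self A).eigenvalues_nonneg
  set V : Matrix ι ι ℂ := (h.eigenvectorUnitary : Matrix ι ι ℂ)
  have hV1 : Vᴴ * V = 1 := by
    simpa [star_eq_conjTranspose] using Unitary.coe_star_mul_self h.eigenvectorUnitary
  have hV2 : V * Vᴴ = 1 := by
    simpa [star_eq_conjTranspose] using Unitary.coe_mul_star_self h.eigenvectorUnitary
  have hspec : Aᴴ * A = V * diagonal (fun i => (lam i : ℂ)) * Vᴴ := by
    have := h.spectral_theorem
    rw [Unitary.conjStarAlgAut_apply] at this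
    simpa [star_eq_conjTranspose, Function.comp_def] using this
  set Y := A * V with hY
  have hYY : Yᴴ * Y = diagonal (fun i => (lam i : ℂ)) := by
    rw [hY, conjTranspose_mul, Matrix.mul_assoc, ← Matrix.mul_assoc Aᴴ, hspec]
    simp only [Matrix.mul_assoc, hV1, Matrix.mul_one]
    rw [← Matrix.mul_assoc, hV1, Matrix.one_mul]
  -- Since `0⁻¹ = 0`, columns with singular value zero are sent to zero, so that `W` is only a
  -- contraction and not an isometry.
  set g : ι → ℂ := fun i => (((Real.sqrt (lam i))⁻¹ : ℝ) : ℂ)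
  set s : ι → ℂ := fun i => ((Real.sqrt (lam i) : ℝ) : ℂ)
  have hgs : ∀ i, g i * (lam i : ℂ) = s i := fun i => by
    simp only [g, s, ← Complex.ofReal_mul]
    congr 1
    by_cases hz : Real.sqrt (lam i) = 0
    · have : lam i = 0 := by
        have := Real.sq_sqrt (hpos i); rw [hz] at this; simpa using this.symm
      simp [this]
    · nth_rewrite 2 [← Real.mul_self_sqrt (hpos i)]
      field_simp
  have hYW : Y * diagonal g * diagonal s = Y := by
    ext i j
    rw [Matrix.mul_assoc, diagonal_mul_diagonal, mul_diagonal]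
    -- A column of `Y` with eigenvalue zero vanishes, because its squared length is the diagonal
    -- entry of `Y* Y`.
    by_cases hz : lam j = 0
    · have h0 : (Yᴴ * Y) j j = 0 := by rw [hYY]; simp [hz]
      have : vnorm (fun i => Y i j) ^ 2 = 0 := by
        apply Complex.ofReal_injective
        rw [vnorm_sq_dot, Complex.ofReal_zero, ← h0]
        simp [Matrix.mul_apply, dotProduct]
      have h1 : (fun i => Y i j) = 0 := vnorm_eq_zero.1 (by simpa using this)
      have h2 : Y i j = 0 := congrFun h1 i
      simp [h2]
    · have : Real.sqrt (lam j) ≠ 0 := fun h0 => hz (by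
        have := Real.sq_sqrt (hpos j); rw [h0] at this; simpa using this.symm)
      simp only [g, s, ← Complex.ofReal_mul, inv_mul_cancel₀ this]
      simp
  have hA : A = Y * Vᴴ := by rw [hY, Matrix.mul_assoc, hV2, Matrix.mul_one]
  refine ⟨Y * diagonal g, V, ?_, hV1, hV2, ?_, ?_⟩
  · intro a
    refine le_of_sq_le_sq ?_ (vnorm_nonneg a)
    have e : ((vnorm ((Y * diagonal g) *ᵥ a) ^ 2 : ℝ) : ℂ) =
        ((∑ i, (Real.sqrt (lam i))⁻¹ ^ 2 * lam i * ‖a i‖ ^ 2 : ℝ) : ℂ) := by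
      rw [vnorm_sq_dot, star_mulVec, dotProduct_mulVec, vecMul_vecMul, conjTranspose_mul,
        Matrix.mul_assoc, ← Matrix.mul_assoc Yᴴ, hYY, ← dotProduct_mulVec,
        diagonal_mul_diagonal, diagonal_conjTranspose, diagonal_mul_diagonal]
      simp only [dotProduct, mulVec_diagonal, Complex.ofReal_sum]
      refine Finset.sum_congr rfl fun i _ => ?_
      have : ((‖a i‖ ^ 2 : ℝ) : ℂ) = star (a i) * a i := by
        rw [← Complex.normSq_eq_norm_sq, Complex.normSq_eq_conj_mul_self]; rfl
      rw [Complex.ofReal_mul, this]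
      simp [g]
      ring
    rw [Complex.ofReal_injective e, vnorm_sq]
    refine Finset.sum_le_sum fun i _ => ?_
    have h1 : (Real.sqrt (lam i))⁻¹ ^ 2 * lam i ≤ 1 := by
      rw [inv_pow, Real.sq_sqrt (hpos i)]
      exact inv_mul_le_one
    nlinarith [sq_nonneg ‖a i‖]
  · rw [hYW, ← hA]
  · rw [hA, conjTranspose_mul, Matrix.mul_assoc, ← Matrix.mul_assoc Yᴴ, hYY, ← Matrix.mul_assoc,
      diagonal_conjTranspose, diagonal_mul_diagonal]
    congr 2
    ext i
    rw [← hgs]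
    simp [g]

end Svd

/-! ### The trace norm as the dual of the operator norm -/

section TraceNorm

variable {ι κ : Type*} [Fintype ι] [Fintype κ] [DecidableEq ι] [DecidableEq κ]

theorem traceNorm_nonneg (X : Matrix ι ι ℂ) : 0 ≤ traceNorm X :=
  Finset.sum_nonneg fun _ _ => Real.sqrt_nonneg _

/-- By cyclicity the trace is a combination of the singular values with the diagonal entries of a
contraction as coefficients. Together with `exists_trace_mul_eq` this is the duality from which the
norm properties follow. -/
theorem norm_trace_mul_le {W : Matrix ι ι ℂ} (hW : Contr W) (X : Matrix ι ι ℂ) :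
    ‖(W * X).trace‖ ≤ traceNorm X := by
  obtain ⟨U, V, hU, hV1, hV2, hX, -⟩ := exists_svd X
  set s : ι → ℝ := fun i => Real.sqrt ((isHermitian_conjTranspose_mul_self X).eigenvalues i) with hs
  have e : (W * X).trace = ∑ i, (Vᴴ * W * U) i i * (s i : ℂ) := by
    conv_lhs => rw [hX]
    rw [← Matrix.mul_assoc, trace_mul_comm, ← Matrix.mul_assoc, ← Matrix.mul_assoc,
      Matrix.trace]
    simp [s]
  have hC : Contr (Vᴴ * W * U) := ((contr_of_isometry (by simpa using hV2)).mul hW).mul hU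
  rw [e]
  refine (norm_sum_le _ _).trans (Finset.sum_le_sum fun i _ => ?_)
  rw [norm_mul, Complex.norm_real, Real.norm_of_nonneg (Real.sqrt_nonneg _)]
  nlinarith [hC.norm_entry_le i i, Real.sqrt_nonneg
    ((isHermitian_conjTranspose_mul_self X).eigenvalues i)]

/-- The optimal contraction is the adjoint of the polar part of `X`. -/
theorem exists_trace_mul_eq (X : Matrix ι ι ℂ) :
    ∃ W : Matrix ι ι ℂ, Contr W ∧ (W * X).trace = (traceNorm X : ℂ) := by
  obtain ⟨U, V, hU, hV1, hV2, -, hX⟩ := exists_svd X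
  refine ⟨V * Uᴴ, (contr_of_isometry hV1).mul hU.conjTranspose, ?_⟩
  rw [Matrix.mul_assoc, hX, ← Matrix.mul_assoc, trace_mul_comm, ← Matrix.mul_assoc, hV1]
  simp [traceNorm]

/-- The columns of the singular value decomposition, with the singular values absorbed into `a`.
Suprema over the trace norm ball thereby reduce to rank-one operators. -/
theorem exists_sum_rankOne (X : Matrix ι ι ℂ) : ∃ a v : ι → ι → ℂ,
    X = ∑ j, vecMulVec (a j) (star (v j)) ∧ (∀ j, vnorm (v j) ≤ 1) ∧
    ∑ j, vnorm (a j) ≤ traceNorm X := by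
  obtain ⟨U, V, hU, hV1, hV2, hX, -⟩ := exists_svd X
  set s : ι → ℝ := fun i => Real.sqrt ((isHermitian_conjTranspose_mul_self X).eigenvalues i) with hs
  refine ⟨fun j => (s j : ℂ) • fun i => U i j, fun j i => V i j, ?_,
    (contr_of_isometry hV1).vnorm_col_le, ?_⟩
  · conv_lhs => rw [hX]
    ext i j
    rw [Matrix.mul_apply, Matrix.sum_apply]
    refine Finset.sum_congr rfl fun x _ => ?_
    simp [vecMulVec_apply, s]
    left; ring
  · refine Finset.sum_le_sum fun j _ => ?_
    rw [vnorm_smul, Complex.norm_real, Real.norm_of_nonneg (Real.sqrt_nonneg _)]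
    nlinarith [hU.vnorm_col_le j, Real.sqrt_nonneg
      ((isHermitian_conjTranspose_mul_self X).eigenvalues j)]

theorem traceNorm_le_of_forall {X : Matrix ι ι ℂ} {c : ℝ}
    (h : ∀ W : Matrix ι ι ℂ, Contr W → ‖(W * X).trace‖ ≤ c) : traceNorm X ≤ c := by
  obtain ⟨W, hW, e⟩ := exists_trace_mul_eq X
  have := h W hW
  rwa [e, Complex.norm_real, Real.norm_of_nonneg (traceNorm_nonneg X)] at this

theorem traceNorm_add_le (X Y : Matrix ι ι ℂ) : traceNorm (X + Y) ≤ traceNorm X + traceNorm Y :=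
  traceNorm_le_of_forall fun W hW => by
    rw [Matrix.mul_add, trace_add]
    exact (norm_add_le _ _).trans (add_le_add (norm_trace_mul_le hW _) (norm_trace_mul_le hW _))

theorem traceNorm_smul_le (c : ℂ) (X : Matrix ι ι ℂ) : traceNorm (c • X) ≤ ‖c‖ * traceNorm X :=
  traceNorm_le_of_forall fun W hW => by
    rw [Matrix.mul_smul, trace_smul, smul_eq_mul, norm_mul]
    exact mul_le_mul_of_nonneg_left (norm_trace_mul_le hW _) (norm_nonneg _)

theorem traceNorm_smul (c : ℂ) (X : Matrix ι ι ℂ) : traceNorm (c • X) = ‖c‖ * traceNorm X := by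
  refine le_antisymm (traceNorm_smul_le c X) ?_
  by_cases hc : c = 0
  · simpa [hc] using traceNorm_nonneg _
  · have h := traceNorm_smul_le c⁻¹ (c • X)
    rw [smul_smul, inv_mul_cancel₀ hc, one_smul, norm_inv] at h
    rwa [← le_inv_mul_iff₀ (norm_pos_iff.2 hc)]

theorem traceNorm_zero : traceNorm (0 : Matrix ι ι ℂ) = 0 := by
  simpa using traceNorm_smul 0 (0 : Matrix ι ι ℂ)

theorem traceNorm_sum_le {α : Type*} (s : Finset α) (X : α → Matrix ι ι ℂ) :
    traceNorm (∑ i ∈ s, X i) ≤ ∑ i ∈ s, traceNorm (X i) := by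
  classical
  induction s using Finset.induction_on with
  | empty => simp [traceNorm_zero]
  | insert a s ha ih =>
    rw [Finset.sum_insert ha, Finset.sum_insert ha]
    exact (traceNorm_add_le _ _).trans (add_le_add le_rfl ih)

theorem traceNorm_eq_zero {X : Matrix ι ι ℂ} (h : traceNorm X = 0) : X = 0 := by
  obtain ⟨a, v, hX, -, hs⟩ := exists_sum_rankOne X
  rw [h] at hs
  have h0 : ∀ j, a j = 0 := fun j => vnorm_eq_zero.1 (le_antisymm
    ((Finset.single_le_sum (fun j _ => vnorm_nonneg (a j)) (Finset.mem_univ j)).trans hs)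
    (vnorm_nonneg _))
  rw [hX]
  simp [h0]

theorem traceNorm_vecMulVec_le (a v : ι → ℂ) :
    traceNorm (vecMulVec a (star v)) ≤ vnorm a * vnorm v :=
  traceNorm_le_of_forall fun W hW => by
    have e : (W * vecMulVec a (star v)).trace = star v ⬝ᵥ (W *ᵥ a) := by
      rw [mul_vecMulVec, trace_vecMulVec, dotProduct_comm]
    rw [e, mul_comm]
    exact (norm_star_dotProduct_le _ _).trans
      (mul_le_mul_of_nonneg_left (hW a) (vnorm_nonneg v))

/-- By cyclicity, a test contraction `W` for `A X B` becomes the test contraction `B W A` for `X`.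
-/
theorem traceNorm_conj_le {A : Matrix κ ι ℂ} {B : Matrix ι κ ℂ} (hA : Contr A) (hB : Contr B)
    (X : Matrix ι ι ℂ) : traceNorm (A * X * B) ≤ traceNorm X :=
  traceNorm_le_of_forall fun W hW => by
    rw [← Matrix.mul_assoc, trace_mul_comm, ← Matrix.mul_assoc, ← Matrix.mul_assoc]
    exact norm_trace_mul_le ((hB.mul hW).mul hA) X

theorem traceNorm_submatrix_le (e : κ ≃ ι) (X : Matrix ι ι ℂ) :
    traceNorm (X.submatrix e e) ≤ traceNorm X := by
  have h : X.submatrix e e = (1 : Matrix ι ι ℂ).submatrix e id * X * (1 : Matrix ι ι ℂ).submatrix id e := by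
    ext i j
    simp [Matrix.mul_apply, Matrix.one_apply]
  rw [h]
  refine traceNorm_conj_le ?_ ?_ X
  · refine contr_of_isometry ?_
    rw [conjTranspose_submatrix, submatrix_mul_equiv]
    simp
  · have : (1 : Matrix ι ι ℂ).submatrix id e = ((1 : Matrix ι ι ℂ).submatrix e id)ᴴ := by
      rw [conjTranspose_submatrix]; simp
    rw [this]
    refine Contr.conjTranspose (contr_of_isometry ?_)
    rw [conjTranspose_submatrix, submatrix_mul_equiv]
    simp

theorem traceNorm_submatrix (e : κ ≃ ι) (X : Matrix ι ι ℂ) :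
    traceNorm (X.submatrix e e) = traceNorm X := by
  refine le_antisymm (traceNorm_submatrix_le e X) ?_
  simpa using traceNorm_submatrix_le e.symm (X.submatrix e e)

end TraceNorm

end

section

open Matrix
open scoped ComplexOrder Kronecker

/-! ### Stabilization of the diamond norm -/

section Stabilization

variable {ι ι' κ μ : Type} [Fintype ι] [DecidableEq ι] [Fintype ι'] [DecidableEq ι']
  [Fintype κ] [DecidableEq κ] [Fintype μ] [DecidableEq μ]

/-- `X ↦ (Φ ⊗ id)(X)` as a linear map. -/
def tensorIdₗ (κ : Type) (Φ : Matrix ι ι ℂ →ₗ[ℂ] Matrix ι' ι' ℂ) :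
    Matrix (ι × κ) (ι × κ) ℂ →ₗ[ℂ] Matrix (ι' × κ) (ι' × κ) ℂ where
  toFun := tensorId κ Φ
  map_add' X Y := by
    ext p q
    exact congrFun (congrFun (map_add Φ (Matrix.of fun i j => X (i, p.2) (j, q.2))
      (Matrix.of fun i j => Y (i, p.2) (j, q.2))) p.1) q.1
  map_smul' c X := by
    ext p q
    exact congrFun (congrFun (map_smul Φ c (Matrix.of fun i j => X (i, p.2) (j, q.2))) p.1) q.1

theorem tensorIdₗ_apply (Φ : Matrix ι ι ℂ →ₗ[ℂ] Matrix ι' ι' ℂ) (X : Matrix (ι × κ) (ι × κ) ℂ) :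
    tensorIdₗ κ Φ X = tensorId κ Φ X := rfl

theorem tensorId_sub (Φ Ψ : Matrix ι ι ℂ →ₗ[ℂ] Matrix ι' ι' ℂ) (X : Matrix (ι × κ) (ι × κ) ℂ) :
    tensorId κ (Φ - Ψ) X = tensorId κ Φ X - tensorId κ Ψ X := rfl

/-- `‖(Φ ⊗ id)(X)‖ ≤ c ‖X‖` for the trace norm and every finite reference system. -/
def DBound (Φ : Matrix ι ι ℂ →ₗ[ℂ] Matrix ι' ι' ℂ) (c : ℝ) : Prop :=
  ∀ (κ : Type) [Fintype κ] [DecidableEq κ] (X : Matrix (ι × κ) (ι × κ) ℂ),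
    traceNorm (tensorId κ Φ X) ≤ c * traceNorm X

theorem traceNorm_linearMap_le_of_rankOne {c : ℝ} (hc : 0 ≤ c)
    (T : Matrix ι ι ℂ →ₗ[ℂ] Matrix κ κ ℂ)
    (h : ∀ a v : ι → ℂ, traceNorm (T (vecMulVec a (star v))) ≤ c * (vnorm a * vnorm v))
    (X : Matrix ι ι ℂ) : traceNorm (T X) ≤ c * traceNorm X := by
  obtain ⟨a, v, hX, hv, hs⟩ := exists_sum_rankOne X
  have e : T X = ∑ j, T (vecMulVec (a j) (star (v j))) := by
    conv_lhs => rw [hX]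
    rw [map_sum]
  rw [e]
  refine (traceNorm_sum_le _ _).trans (le_trans ?_ (mul_le_mul_of_nonneg_left hs hc))
  rw [Finset.mul_sum]
  refine Finset.sum_le_sum fun j _ => (h _ _).trans (mul_le_mul_of_nonneg_left ?_ hc)
  nlinarith [vnorm_nonneg (a j), hv j]

/-- A crude bound through matrix units. It is needed only to know that the set in `diamondNorm` is
bounded above, so that its `sSup` is a true supremum. -/
theorem exists_traceNorm_bound (T : Matrix ι ι ℂ →ₗ[ℂ] Matrix κ κ ℂ) :
    ∃ C : ℝ, ∀ X, traceNorm (T X) ≤ C * traceNorm X := by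
  refine ⟨∑ i, ∑ j, traceNorm (T (single i j 1)), fun X => ?_⟩
  have hX : T X = ∑ i, ∑ j, X i j • T (single i j 1) := by
    conv_lhs => rw [matrix_eq_sum_single X]
    simp only [map_sum]
    refine Finset.sum_congr rfl fun i _ => Finset.sum_congr rfl fun j _ => ?_
    rw [← map_smul, smul_single, smul_eq_mul, mul_one]
  have hent : ∀ i j, ‖X i j‖ ≤ traceNorm X := fun i j => by
    have hC : Contr (single j i (1 : ℂ)) := fun a => by
      have e : single j i (1 : ℂ) *ᵥ a = a i • Pi.single j (1 : ℂ) := by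
        ext k
        by_cases hk : k = j
        · subst hk; simp [mulVec, dotProduct, single_apply]
        · simp [mulVec, dotProduct, hk, Ne.symm hk]
      rw [e, vnorm_smul]
      have : vnorm (Pi.single j (1 : ℂ)) = 1 := by simp [vnorm]
      rw [this, mul_one]
      exact norm_apply_le_vnorm a i
    have := norm_trace_mul_le hC X
    rwa [trace_single_mul, one_smul] at this
  rw [hX, Finset.sum_mul]
  refine (traceNorm_sum_le _ _).trans (Finset.sum_le_sum fun i _ => ?_)
  rw [Finset.sum_mul]
  refine (traceNorm_sum_le _ _).trans (Finset.sum_le_sum fun j _ => ?_)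
  rw [traceNorm_smul, mul_comm]
  exact mul_le_mul_of_nonneg_left (hent i j) (traceNorm_nonneg _)

theorem diamondNorm_nonneg (Φ : Matrix ι ι ℂ →ₗ[ℂ] Matrix ι' ι' ℂ) : 0 ≤ diamondNorm Φ := by
  refine Real.sSup_nonneg ?_
  rintro r ⟨X, -, rfl⟩
  exact div_nonneg (traceNorm_nonneg _) (traceNorm_nonneg _)

theorem diamondNorm_le_of_dBound {Φ : Matrix ι ι ℂ →ₗ[ℂ] Matrix ι' ι' ℂ} {c : ℝ} (hc : 0 ≤ c)
    (h : DBound Φ c) : diamondNorm Φ ≤ c := by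
  refine Real.sSup_le ?_ hc
  rintro r ⟨X, -, rfl⟩
  exact div_le_of_le_mul₀ (traceNorm_nonneg _) hc (h ι X)

theorem traceNorm_tensorId_self_le (Φ : Matrix ι ι ℂ →ₗ[ℂ] Matrix ι' ι' ℂ)
    (X : Matrix (ι × ι) (ι × ι) ℂ) :
    traceNorm (tensorId ι Φ X) ≤ diamondNorm Φ * traceNorm X := by
  by_cases hX : X = 0
  · subst hX
    rw [← tensorIdₗ_apply, map_zero, traceNorm_zero, traceNorm_zero, mul_zero]
  · have hpos : 0 < traceNorm X :=
      lt_of_le_of_ne (traceNorm_nonneg X) fun h => hX (traceNorm_eq_zero h.symm)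
    rw [← div_le_iff₀ hpos]
    refine le_csSup ?_ ⟨X, hX, rfl⟩
    obtain ⟨C, hC⟩ := exists_traceNorm_bound (tensorIdₗ ι Φ)
    refine ⟨C, ?_⟩
    rintro r ⟨Y, hY, rfl⟩
    have hpos : 0 < traceNorm Y :=
      lt_of_le_of_ne (traceNorm_nonneg Y) fun h => hY (traceNorm_eq_zero h.symm)
    rw [div_le_iff₀ hpos]
    exact hC Y

theorem contr_one_kronecker {W : Matrix κ μ ℂ} (hW : Contr W) :
    Contr ((1 : Matrix ι ι ℂ) ⊗ₖ W) := fun a => by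
  refine le_of_sq_le_sq ?_ (vnorm_nonneg a)
  have e : ∀ i k, (((1 : Matrix ι ι ℂ) ⊗ₖ W) *ᵥ a) (i, k) = (W *ᵥ fun j => a (i, j)) k := by
    intro i k
    simp [mulVec, dotProduct, Fintype.sum_prod_type, Matrix.one_apply]
  rw [vnorm_sq, vnorm_sq, Fintype.sum_prod_type, Fintype.sum_prod_type]
  refine Finset.sum_le_sum fun i _ => ?_
  simp only [e]
  have := hW fun j => a (i, j)
  have h2 := pow_le_pow_left₀ (vnorm_nonneg _) this 2
  rwa [vnorm_sq, vnorm_sq] at h2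

/-- Operators on the reference system commute with a map that acts on the other factor. -/
theorem tensorId_one_kronecker (Φ : Matrix ι ι ℂ →ₗ[ℂ] Matrix ι' ι' ℂ)
    (W : Matrix κ μ ℂ) (V : Matrix μ κ ℂ) (Y : Matrix (ι × μ) (ι × μ) ℂ) :
    tensorId κ Φ (((1 : Matrix ι ι ℂ) ⊗ₖ W) * Y * ((1 : Matrix ι ι ℂ) ⊗ₖ V)) =
      ((1 : Matrix ι' ι' ℂ) ⊗ₖ W) * tensorId μ Φ Y * ((1 : Matrix ι' ι' ℂ) ⊗ₖ V) := by
  have key : ∀ (ν : Type) [Fintype ν] [DecidableEq ν] (Z : Matrix (ν × μ) (ν × μ) ℂ) (p q : ν × κ),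
      (((1 : Matrix ν ν ℂ) ⊗ₖ W) * Z * ((1 : Matrix ν ν ℂ) ⊗ₖ V)) p q =
        ∑ k, ∑ l, (W p.2 k * V l q.2) * Z (p.1, k) (q.1, l) := by
    intro ν _ _ Z p q
    have e1 : ∀ r : ν × μ, (((1 : Matrix ν ν ℂ) ⊗ₖ W) * Z) p r = ∑ k, W p.2 k * Z (p.1, k) r := by
      intro r
      simp [Matrix.mul_apply, Fintype.sum_prod_type, Matrix.one_apply]
    rw [Matrix.mul_apply, Fintype.sum_prod_type]
    simp only [e1, kroneckerMap_apply, Matrix.one_apply]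
    rw [Finset.sum_comm]
    conv_rhs => rw [Finset.sum_comm]
    refine Finset.sum_congr rfl fun l _ => ?_
    simp only [ite_mul, one_mul, zero_mul, mul_ite, mul_zero, Finset.sum_ite_eq',
      Finset.mem_univ, if_true]
    rw [Finset.sum_mul]
    refine Finset.sum_congr rfl fun k _ => by ring
  ext p q
  rw [key]
  have e : (Matrix.of fun i j => (((1 : Matrix ι ι ℂ) ⊗ₖ W) * Y * ((1 : Matrix ι ι ℂ) ⊗ₖ V))
      (i, p.2) (j, q.2)) = ∑ k, ∑ l, (W p.2 k * V l q.2) • Matrix.of fun i j => Y (i, k) (j, l) := by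
    ext i j
    simp only [Matrix.of_apply, key, Matrix.sum_apply, Matrix.smul_apply, smul_eq_mul]
  simp only [tensorId, Matrix.of_apply, e, map_sum, map_smul, Matrix.sum_apply, Matrix.smul_apply,
    smul_eq_mul]

/-- Schmidt decomposition: reshaped as a matrix `A`, the vector factors as `A = W P` with `P` square
and `P* P = A* A`, so that the Frobenius norms agree. A reference system as large as the input
therefore suffices. -/
theorem exists_one_kronecker_mulVec (a : ι × κ → ℂ) :
    ∃ (W : Matrix κ ι ℂ) (p : ι × ι → ℂ), Contr W ∧ vnorm p = vnorm a ∧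
      a = ((1 : Matrix ι ι ℂ) ⊗ₖ W) *ᵥ p := by
  obtain ⟨W, V, hW, hV1, hV2, h1, h2⟩ := exists_svd (Matrix.of fun k i => a (i, k) : Matrix κ ι ℂ)
  set A : Matrix κ ι ℂ := Matrix.of fun k i => a (i, k) with hA
  set D := diagonal (fun i => ((Real.sqrt
      ((isHermitian_conjTranspose_mul_self A).eigenvalues i) : ℝ) : ℂ)) with hD
  set P := D * Vᴴ with hP
  have hPA : A = W * P := by rw [hP, ← Matrix.mul_assoc]; exact h1
  have hPP : Pᴴ * P = Aᴴ * A := by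
    have : Aᴴ = Pᴴ * Wᴴ := by conv_lhs => rw [hPA, conjTranspose_mul]
    rw [this, Matrix.mul_assoc, h2]
  refine ⟨W, fun q => P q.2 q.1, hW, ?_, ?_⟩
  · have hsum : ∀ {ν : Type} [Fintype ν] (B : Matrix ν ι ℂ) (b : ι × ν → ℂ),
        (∀ q, b q = B q.2 q.1) → ((vnorm b ^ 2 : ℝ) : ℂ) = (Bᴴ * B).trace := by
      intro ν _ B b hb
      rw [vnorm_sq_dot]
      simp [dotProduct, Fintype.sum_prod_type, Matrix.trace, Matrix.mul_apply, hb]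
    have e1 := hsum P (fun q => P q.2 q.1) fun _ => rfl
    have e2 := hsum A a fun _ => rfl
    rw [hPP, ← e2] at e1
    exact (pow_left_inj₀ (vnorm_nonneg _) (vnorm_nonneg _) two_ne_zero).1
      (Complex.ofReal_injective e1)
  · ext ⟨i, k⟩
    have : a (i, k) = A k i := rfl
    rw [this, hPA]
    simp [mulVec, dotProduct, Fintype.sum_prod_type, Matrix.one_apply, Matrix.mul_apply]

/-- Stabilization: by convexity only rank-one inputs matter. Their two vectors come from vectors
with reference `ι` by contractions of the reference, and these do not increase the trace norm of the
output. -/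
theorem dBound_diamondNorm (Φ : Matrix ι ι ℂ →ₗ[ℂ] Matrix ι' ι' ℂ) :
    DBound Φ (diamondNorm Φ) := fun κ _ _ X => by
  refine traceNorm_linearMap_le_of_rankOne (diamondNorm_nonneg Φ) (tensorIdₗ κ Φ) (fun a v => ?_) X
  obtain ⟨W, p, hW, hp, ha⟩ := exists_one_kronecker_mulVec a
  obtain ⟨V, q, hV, hq, hv⟩ := exists_one_kronecker_mulVec v
  have e : vecMulVec a (star v) = ((1 : Matrix ι ι ℂ) ⊗ₖ W) * vecMulVec p (star q) *
      ((1 : Matrix ι ι ℂ) ⊗ₖ Vᴴ) := by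
    rw [mul_vecMulVec, vecMulVec_mul, ← ha]
    congr 1
    conv_lhs => rw [hv]
    rw [star_mulVec, conjTranspose_kronecker, conjTranspose_one]
  rw [tensorIdₗ_apply, e, tensorId_one_kronecker]
  have hV' : Contr ((1 : Matrix ι' ι' ℂ) ⊗ₖ Vᴴ) := contr_one_kronecker hV.conjTranspose
  refine (traceNorm_conj_le (contr_one_kronecker hW) hV' _).trans
    ((traceNorm_tensorId_self_le Φ _).trans ?_)
  rw [← hp, ← hq]
  exact mul_le_mul_of_nonneg_left (traceNorm_vecMulVec_le p q) (diamondNorm_nonneg Φ)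

theorem diamondNorm_le_of_rankOne {Φ : Matrix ι ι ℂ →ₗ[ℂ] Matrix ι' ι' ℂ} {c : ℝ} (hc : 0 ≤ c)
    (h : ∀ (κ : Type) [Fintype κ] [DecidableEq κ] (a v : ι × κ → ℂ), vnorm a = 1 → vnorm v = 1 →
      traceNorm (tensorId κ Φ (vecMulVec a (star v))) ≤ c) : diamondNorm Φ ≤ c := by
  refine diamondNorm_le_of_dBound hc fun κ _ _ X => ?_
  refine traceNorm_linearMap_le_of_rankOne hc (tensorIdₗ κ Φ) (fun a v => ?_) X
  by_cases ha : a = 0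
  · rw [ha, zero_vecMulVec, map_zero, traceNorm_zero]
    exact mul_nonneg hc (mul_nonneg (vnorm_nonneg _) (vnorm_nonneg _))
  by_cases hv : v = 0
  · rw [hv, star_zero, vecMulVec_zero, map_zero, traceNorm_zero]
    exact mul_nonneg hc (mul_nonneg (vnorm_nonneg _) (vnorm_nonneg _))
  have ha0 : vnorm a ≠ 0 := fun h => ha (vnorm_eq_zero.1 h)
  have hv0 : vnorm v ≠ 0 := fun h => hv (vnorm_eq_zero.1 h)
  have hone : ∀ b : ι × κ → ℂ, vnorm b ≠ 0 → vnorm (((vnorm b)⁻¹ : ℂ) • b) = 1 := fun b hb => by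
    rw [vnorm_smul, norm_inv, Complex.norm_real, Real.norm_of_nonneg (vnorm_nonneg b),
      inv_mul_cancel₀ hb]
  have := h κ _ _ (hone a ha0) (hone v hv0)
  have e : vecMulVec a (star v) = ((vnorm a * vnorm v : ℝ) : ℂ) •
      vecMulVec (((vnorm a)⁻¹ : ℂ) • a) (star (((vnorm v)⁻¹ : ℂ) • v)) := by
    ext i j
    have h1 : (vnorm a : ℂ) ≠ 0 := by exact_mod_cast ha0
    have h2 : (vnorm v : ℂ) ≠ 0 := by exact_mod_cast hv0
    simp [vecMulVec_apply]
    field_simp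
  rw [e, map_smul, traceNorm_smul, Complex.norm_real, Real.norm_of_nonneg
    (mul_nonneg (vnorm_nonneg _) (vnorm_nonneg _)), mul_comm]
  exact mul_le_mul_of_nonneg_right this (mul_nonneg (vnorm_nonneg _) (vnorm_nonneg _))

end Stabilization

end

section

open Matrix
open scoped ComplexOrder Kronecker MatrixOrder

/-! ### Channels -/

section Positivity

variable {ι κ : Type*} [Fintype ι] [DecidableEq ι] [Fintype κ] [DecidableEq κ]

theorem trace_mul_nonneg {E P : Matrix ι ι ℂ} (hE : E.PosSemidef) (hP : P.PosSemidef) :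
    0 ≤ (E * P).trace := by
  obtain ⟨B, rfl⟩ := CStarAlgebra.nonneg_iff_eq_star_mul_self.1
    (Matrix.nonneg_iff_posSemidef.2 hP)
  rw [star_eq_conjTranspose, ← Matrix.mul_assoc, trace_mul_comm, ← Matrix.mul_assoc]
  exact (hE.mul_mul_conjTranspose_same B).trace_nonneg

theorem star_dotProduct_mulVec_eq_ofReal {H : Matrix ι ι ℂ} (hH : H.IsHermitian) (x : ι → ℂ) :
    star x ⬝ᵥ (H *ᵥ x) = ((star x ⬝ᵥ (H *ᵥ x)).re : ℂ) := by
  have := hH.im_star_dotProduct_mulVec_self x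
  exact Complex.ext (by simp) (by simpa using this)

theorem Contr.posSemidef_one_add {H : Matrix ι ι ℂ} (hH : H.IsHermitian) (hC : Contr H) :
    (1 + H).PosSemidef := by
  refine .of_dotProduct_mulVec_nonneg (isHermitian_one.add hH) fun x => ?_
  rw [add_mulVec, one_mulVec, dotProduct_add, ← vnorm_sq_dot,
    star_dotProduct_mulVec_eq_ofReal hH, ← Complex.ofReal_add]
  have h1 := norm_star_dotProduct_le x (H *ᵥ x)
  have h2 := (Complex.abs_re_le_norm _).trans h1
  have h3 := (abs_le.1 h2).1
  have h4 := hC x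
  have : (0 : ℝ) ≤ vnorm x ^ 2 + (star x ⬝ᵥ (H *ᵥ x)).re := by
    nlinarith [vnorm_nonneg x]
  exact_mod_cast this

theorem contr_neg {H : Matrix ι κ ℂ} (hC : Contr H) : Contr (-H) := fun a => by
  have : vnorm (-H *ᵥ a) = vnorm (H *ᵥ a) := by
    rw [neg_mulVec, ← neg_one_smul ℂ, vnorm_smul]; simp
  rw [this]; exact hC a

theorem Contr.posSemidef_one_sub {H : Matrix ι ι ℂ} (hH : H.IsHermitian) (hC : Contr H) :
    (1 - H).PosSemidef := by
  rw [sub_eq_add_neg]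
  exact (contr_neg hC).posSemidef_one_add hH.neg

/-- It is enough that `1 - C²` is positive semidefinite. -/
theorem contr_of_posSemidef {C : Matrix ι ι ℂ} (h1 : (1 + C).PosSemidef) (h2 : (1 - C).PosSemidef) :
    Contr C := by
  have hC : C.IsHermitian := by
    have := h1.isHermitian.sub isHermitian_one
    rwa [add_sub_cancel_left] at this
  have key : (1 - Cᴴ * C).PosSemidef := by
    -- Everything commutes, so the bracket is `(1 - C²)` times `(1 - C) + (1 + C) = 2`; its summands
    -- are congruences of positive operators.
    have e : 1 - Cᴴ * C = (1 / 2 : ℝ) • ((1 - C) * (1 + C) * (1 - C)ᴴ + (1 + C) * (1 - C) * (1 + C)ᴴ) := by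
      rw [h1.isHermitian.eq, h2.isHermitian.eq, hC.eq]
      have : (1 - C) * (1 + C) * (1 - C) + (1 + C) * (1 - C) * (1 + C) = (2 : ℝ) • (1 - C * C) := by
        rw [two_smul]; noncomm_ring
      rw [this, smul_smul]; norm_num
    rw [e]
    exact ((h1.mul_mul_conjTranspose_same _).add (h2.mul_mul_conjTranspose_same _)).smul
      (by norm_num)
  intro a
  refine le_of_sq_le_sq ?_ (vnorm_nonneg a)
  have h := key.dotProduct_mulVec_nonneg a
  rw [sub_mulVec, one_mulVec, dotProduct_sub, ← vnorm_sq_dot, ← mulVec_mulVec, dotProduct_mulVec,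
    ← star_mulVec, ← vnorm_sq_dot, ← Complex.ofReal_sub] at h
  have : (0 : ℝ) ≤ vnorm a ^ 2 - vnorm (C *ᵥ a) ^ 2 := by exact_mod_cast h
  linarith

/-- The hermitian operator with off-diagonal blocks `W` and `W*`. -/
def offDiag (W : Matrix (ι × κ) (ι × κ) ℂ) : Matrix (ι × (κ × Fin 2)) (ι × (κ × Fin 2)) ℂ :=
  Matrix.of fun p q =>
    if p.2.2 = 1 ∧ q.2.2 = 0 then W (p.1, p.2.1) (q.1, q.2.1)
    else if p.2.2 = 0 ∧ q.2.2 = 1 then star (W (q.1, q.2.1) (p.1, p.2.1)) else 0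

theorem offDiag_isHermitian (W : Matrix (ι × κ) (ι × κ) ℂ) : (offDiag W).IsHermitian := by
  ext ⟨i, k, c⟩ ⟨j, l, d⟩
  fin_cases c <;> fin_cases d <;> simp [offDiag]

theorem contr_offDiag {W : Matrix (ι × κ) (ι × κ) ℂ} (hW : Contr W) : Contr (offDiag W) :=
  fun a => by
  refine le_of_sq_le_sq ?_ (vnorm_nonneg a)
  have hsplit : ∀ b : ι × (κ × Fin 2) → ℂ, vnorm b ^ 2 =
      vnorm (fun q : ι × κ => b (q.1, (q.2, 0))) ^ 2 +
      vnorm (fun q : ι × κ => b (q.1, (q.2, 1))) ^ 2 := fun b => by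
    simp only [vnorm_sq, Fintype.sum_prod_type, Fin.sum_univ_two, Finset.sum_add_distrib]
  have e0 : (fun q : ι × κ => (offDiag W *ᵥ a) (q.1, (q.2, 0))) =
      Wᴴ *ᵥ fun q : ι × κ => a (q.1, (q.2, 1)) := by
    ext q
    simp [offDiag, mulVec, dotProduct, Fintype.sum_prod_type]
  have e1 : (fun q : ι × κ => (offDiag W *ᵥ a) (q.1, (q.2, 1))) =
      W *ᵥ fun q : ι × κ => a (q.1, (q.2, 0)) := by
    ext q
    simp [offDiag, mulVec, dotProduct, Fintype.sum_prod_type]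
  rw [hsplit, hsplit a, e0, e1]
  have h0 := pow_le_pow_left₀ (vnorm_nonneg _) (hW.conjTranspose fun q : ι × κ => a (q.1, (q.2, 1))) 2
  have h1 := pow_le_pow_left₀ (vnorm_nonneg _) (hW fun q : ι × κ => a (q.1, (q.2, 0))) 2
  linarith

/-- This turns the pairing of an arbitrary contraction with an off-diagonal block into the
expectation of a hermitian observable, at the price of one extra reference qubit. -/
theorem trace_offDiag_mul (W : Matrix (ι × κ) (ι × κ) ℂ)
    {Y : Matrix (ι × (κ × Fin 2)) (ι × (κ × Fin 2)) ℂ} (hY : Y.IsHermitian) :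
    (offDiag W * Y).trace = ((2 * (W * Matrix.of fun p q : ι × κ =>
      Y (p.1, (p.2, 0)) (q.1, (q.2, 1))).trace.re : ℝ) : ℂ) := by
  set Z : Matrix (ι × κ) (ι × κ) ℂ := Matrix.of fun p q : ι × κ =>
      Y (p.1, (p.2, 0)) (q.1, (q.2, 1))
  have e : (offDiag W * Y).trace = (W * Z).trace + (Wᴴ * Zᴴ).trace := by
    simp only [Matrix.trace, Matrix.diag_apply, Matrix.mul_apply, Fintype.sum_prod_type,
      Fin.sum_univ_two, offDiag, Matrix.of_apply, conjTranspose_apply, Z]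
    have hs : ∀ p q, star (Y p q) = Y q p := fun p q => hY.apply q p
    simp [hs, Finset.sum_add_distrib, add_comm]
  have e2 : (Wᴴ * Zᴴ).trace = star (W * Z).trace := by
    rw [← trace_conjTranspose, conjTranspose_mul, trace_mul_comm]
  rw [e, e2, Complex.ofReal_mul]
  have := Complex.add_conj (W * Z).trace
  simpa using this

end Positivity

/-! ### Quantum channels and measurements on their outputs -/

section Channels

variable {ι ι' ι'' κ : Type} [Fintype ι] [DecidableEq ι] [Fintype ι'] [DecidableEq ι']
  [Fintype ι''] [DecidableEq ι''] [Fintype κ] [DecidableEq κ]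

/-- Quantum channels: completely positive and trace preserving maps. -/
structure IsChan (Φ : Matrix ι ι ℂ →ₗ[ℂ] Matrix ι' ι' ℂ) : Prop where
  pos : ∀ (κ : Type) [Fintype κ] [DecidableEq κ] (X : Matrix (ι × κ) (ι × κ) ℂ),
    X.PosSemidef → (tensorId κ Φ X).PosSemidef
  tr : ∀ X, (Φ X).trace = X.trace

theorem IsChan.trace_tensorId {Φ : Matrix ι ι ℂ →ₗ[ℂ] Matrix ι' ι' ℂ} (hΦ : IsChan Φ)
    (X : Matrix (ι × κ) (ι × κ) ℂ) : (tensorId κ Φ X).trace = X.trace := by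
  simp only [Matrix.trace, Matrix.diag_apply, Fintype.sum_prod_type_right, tensorId,
    Matrix.of_apply]
  refine Finset.sum_congr rfl fun k _ => ?_
  exact hΦ.tr (Matrix.of fun i j => X (i, k) (j, k))

theorem IsChan.comp {Φ : Matrix ι ι ℂ →ₗ[ℂ] Matrix ι' ι' ℂ}
    {Ψ : Matrix ι' ι' ℂ →ₗ[ℂ] Matrix ι'' ι'' ℂ} (hΨ : IsChan Ψ) (hΦ : IsChan Φ) :
    IsChan (Ψ ∘ₗ Φ) where
  pos κ _ _ _ hX := hΨ.pos κ _ (hΦ.pos κ _ hX)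
  tr X := by rw [LinearMap.comp_apply, hΨ.tr, hΦ.tr]

theorem isChan_id : IsChan (LinearMap.id : Matrix ι ι ℂ →ₗ[ℂ] Matrix ι ι ℂ) where
  pos _ _ _ _ hX := hX
  tr _ := rfl

/-- The vector `(a ⊗ |0⟩ + v ⊗ |1⟩) / √2`. -/
def joinVec (a v : ι × κ → ℂ) : ι × (κ × Fin 2) → ℂ := fun q =>
  ((Real.sqrt 2)⁻¹ : ℂ) * if q.2.2 = 0 then a (q.1, q.2.1) else v (q.1, q.2.1)

theorem vnorm_joinVec {a v : ι × κ → ℂ} (ha : vnorm a = 1) (hv : vnorm v = 1) :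
    vnorm (joinVec a v) = 1 := by
  have h : vnorm (joinVec a v) ^ 2 = (vnorm a ^ 2 + vnorm v ^ 2) / 2 := by
    simp only [vnorm_sq, Fintype.sum_prod_type, Fin.sum_univ_two, Finset.sum_add_distrib, joinVec]
    simp only [norm_mul, mul_pow, ← Finset.mul_sum]
    have : ‖((Real.sqrt 2)⁻¹ : ℂ)‖ ^ 2 = 1 / 2 := by
      rw [norm_inv, Complex.norm_real, Real.norm_of_nonneg (Real.sqrt_nonneg _), inv_pow,
        Real.sq_sqrt (by norm_num)]
      norm_num
    rw [this]
    simp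
    ring
  rw [ha, hv] at h
  have h0 := vnorm_nonneg (joinVec a v)
  nlinarith

theorem trace_vecMulVec_self {a : ι → ℂ} (ha : vnorm a = 1) :
    (vecMulVec a (star a)).trace = 1 := by
  rw [trace_vecMulVec, dotProduct_comm, ← vnorm_sq_dot, ha]
  simp

/-- The operator `a v*` is the off-diagonal block, up to `1/2`, of the pure state of `joinVec a v`.
So rank-one operators with two different vectors are tested by genuine states; the `1/2` cancels the
`2` of `trace_offDiag_mul`. -/
theorem offDiag_tensorId_joinVec (Φ : Matrix ι ι ℂ →ₗ[ℂ] Matrix ι' ι' ℂ) (a v : ι × κ → ℂ) :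
    (Matrix.of fun p q : ι' × κ => tensorId (κ × Fin 2) Φ
      (vecMulVec (joinVec a v) (star (joinVec a v))) (p.1, (p.2, 0)) (q.1, (q.2, 1))) =
      (1 / 2 : ℂ) • tensorId κ Φ (vecMulVec a (star v)) := by
  ext p q
  have e : (Matrix.of fun i j => vecMulVec (joinVec a v) (star (joinVec a v))
      (i, (p.2, 0)) (j, (q.2, 1))) =
      (1 / 2 : ℂ) • Matrix.of fun i j => vecMulVec a (star v) (i, p.2) (j, q.2) := by
    ext i j
    have h2 : ((Real.sqrt 2 : ℝ) : ℂ) * ((Real.sqrt 2 : ℝ) : ℂ) = 2 := by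
      rw [← Complex.ofReal_mul, Real.mul_self_sqrt (by norm_num)]; norm_num
    have h3 : ((Real.sqrt 2)⁻¹ : ℂ) * ((Real.sqrt 2)⁻¹ : ℂ) = 1 / 2 := by
      rw [← mul_inv, h2]; norm_num
    simp only [vecMulVec_apply, joinVec, Matrix.of_apply, Matrix.smul_apply, smul_eq_mul,
      Pi.star_apply, star_mul', if_true]
    rw [← h3]
    simp
    ring
  simp only [tensorId, Matrix.of_apply, e, map_smul, Matrix.smul_apply]

theorem trace_offDiag_tensorId {Φ : Matrix ι ι ℂ →ₗ[ℂ] Matrix ι' ι' ℂ} (hΦ : IsChan Φ)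
    (W : Matrix (ι' × κ) (ι' × κ) ℂ) (a v : ι × κ → ℂ) :
    (offDiag W * tensorId (κ × Fin 2) Φ (vecMulVec (joinVec a v) (star (joinVec a v)))).trace =
      ((W * tensorId κ Φ (vecMulVec a (star v))).trace.re : ℂ) := by
  rw [trace_offDiag_mul W (hΦ.pos _ _ (posSemidef_vecMulVec_self_star _)).isHermitian,
    offDiag_tensorId_joinVec, Matrix.mul_smul, trace_smul]
  congr 1
  simp

/-- On the joined pure state the output is positive of trace one, and the hermitian contraction
`offDiag W` has expectation at most one there. With `W` optimal this expectation is the trace norm.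
-/
theorem IsChan.dBound {Φ : Matrix ι ι ℂ →ₗ[ℂ] Matrix ι' ι' ℂ} (hΦ : IsChan Φ) : DBound Φ 1 := by
  have h : diamondNorm Φ ≤ 1 := by
    refine diamondNorm_le_of_rankOne zero_le_one fun κ _ _ a v ha hv => ?_
    obtain ⟨W, hW, e⟩ := exists_trace_mul_eq (tensorId κ Φ (vecMulVec a (star v)))
    have h1 := trace_offDiag_tensorId hΦ W a v
    rw [e, Complex.ofReal_re] at h1
    have hY := hΦ.pos (κ × Fin 2) _ (posSemidef_vecMulVec_self_star (joinVec a v))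
    have h2 := trace_mul_nonneg ((contr_offDiag hW).posSemidef_one_sub (offDiag_isHermitian W)) hY
    rw [Matrix.sub_mul, Matrix.one_mul, trace_sub, hΦ.trace_tensorId,
      trace_vecMulVec_self (vnorm_joinVec ha hv), h1] at h2
    have : (0 : ℝ) ≤ 1 - traceNorm (tensorId κ Φ (vecMulVec a (star v))) := by exact_mod_cast h2
    linarith
  intro κ _ _ X
  exact (dBound_diamondNorm Φ κ X).trans
    (mul_le_mul_of_nonneg_right h (traceNorm_nonneg X))

/-! ### Distinguishing channels by a measurement -/

/-- There are an input state and a measurement whose outcome distributions for the two channels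
have Bhattacharyya coefficient at most `β`. -/
def Distinguishable (Φ : Fin 2 → (Matrix ι ι ℂ →ₗ[ℂ] Matrix ι' ι' ℂ)) (β : ℝ) : Prop :=
  ∃ (κ α : Type) (_ : Fintype κ) (_ : DecidableEq κ) (_ : Fintype α) (ψ : ι × κ → ℂ)
    (E : α → Matrix (ι' × κ) (ι' × κ) ℂ) (p : Fin 2 → α → ℝ),
    vnorm ψ = 1 ∧ (∀ x, (E x).PosSemidef) ∧ ∑ x, E x = 1 ∧
    (∀ c x, (E x * tensorId κ (Φ c) (vecMulVec ψ (star ψ))).trace = (p c x : ℂ)) ∧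
    (∀ c x, 0 ≤ p c x) ∧ (∀ c, ∑ x, p c x = 1) ∧ ∑ x, Real.sqrt (p 0 x * p 1 x) ≤ β

/-- After squaring, the arithmetic-geometric mean inequality for `p (1 - p)` and `q (1 - q)` bounds
the cross term, and the sum becomes exactly `1 - (p - q)²`. -/
theorem bhattacharyya_two_le {p q : ℝ} (hp : 0 ≤ p) (hp1 : p ≤ 1) (hq : 0 ≤ q) (hq1 : q ≤ 1) :
    Real.sqrt (p * q) + Real.sqrt ((1 - p) * (1 - q)) ≤ Real.sqrt (1 - (p - q) ^ 2) := by
  refine Real.le_sqrt_of_sq_le ?_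
  have h1 := Real.sq_sqrt (mul_nonneg hp hq)
  have h2 := Real.sq_sqrt (mul_nonneg (sub_nonneg.2 hp1) (sub_nonneg.2 hq1))
  have h3 : 2 * (Real.sqrt (p * q) * Real.sqrt ((1 - p) * (1 - q))) ≤ p * (1 - p) + q * (1 - q) := by
    rw [← Real.sqrt_mul (mul_nonneg hp hq)]
    have e : p * q * ((1 - p) * (1 - q)) = (p * (1 - p)) * (q * (1 - q)) := by ring
    have ha : 0 ≤ p * (1 - p) := mul_nonneg hp (sub_nonneg.2 hp1)
    have hb : 0 ≤ q * (1 - q) := mul_nonneg hq (sub_nonneg.2 hq1)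
    rw [e, Real.sqrt_mul ha]
    nlinarith [sq_nonneg (Real.sqrt (p * (1 - p)) - Real.sqrt (q * (1 - q))), Real.sq_sqrt ha,
      Real.sq_sqrt hb]
  nlinarith

/-- The strict inequality provides a rank-one input exceeding `d` without showing that the supremum
is attained. Joining its vectors gives the state, and `(1 ± offDiag W) / 2` is the two-outcome
measurement; the outcome probabilities differ by half the trace norm. -/
theorem distinguishable_of_lt {Φ : Fin 2 → (Matrix ι ι ℂ →ₗ[ℂ] Matrix ι' ι' ℂ)}
    (hΦ : ∀ c, IsChan (Φ c)) {d : ℝ} (hd : 0 ≤ d) (h : d < diamondNorm (Φ 0 - Φ 1)) :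
    Distinguishable Φ (Real.sqrt (1 - (d / 2) ^ 2)) := by
  by_contra hcon
  refine absurd h (not_lt.2 (diamondNorm_le_of_rankOne hd fun κ _ _ a v ha hv => ?_))
  by_contra hlt
  rw [not_le] at hlt
  refine hcon ?_
  obtain ⟨W, hW, e⟩ := exists_trace_mul_eq (tensorId κ (Φ 0 - Φ 1) (vecMulVec a (star v)))
  set ψ := joinVec a v
  -- The expectation of the observable on the output of channel `c`, so that the outcomes have
  -- probabilities `(1 ± t c) / 2`.
  set t : Fin 2 → ℝ := fun c => (W * tensorId κ (Φ c) (vecMulVec a (star v))).trace.re with ht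
  have htr : ∀ c, (offDiag W * tensorId (κ × Fin 2) (Φ c) (vecMulVec ψ (star ψ))).trace = (t c : ℂ) :=
    fun c => trace_offDiag_tensorId (hΦ c) W a v
  have hdiff : t 0 - t 1 = traceNorm (tensorId κ (Φ 0 - Φ 1) (vecMulVec a (star v))) := by
    rw [tensorId_sub, Matrix.mul_sub, trace_sub] at e
    have := congrArg Complex.re e
    rw [Complex.sub_re, Complex.ofReal_re] at this
    exact this
  have hp0 := (contr_offDiag hW).posSemidef_one_add (offDiag_isHermitian W)
  have hp1 := (contr_offDiag hW).posSemidef_one_sub (offDiag_isHermitian W)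
  have hY : ∀ c, (tensorId (κ × Fin 2) (Φ c) (vecMulVec ψ (star ψ))).PosSemidef :=
    fun c => (hΦ c).pos _ _ (posSemidef_vecMulVec_self_star ψ)
  have hone : ∀ c, (tensorId (κ × Fin 2) (Φ c) (vecMulVec ψ (star ψ))).trace = 1 := fun c => by
    rw [(hΦ c).trace_tensorId, trace_vecMulVec_self (vnorm_joinVec ha hv)]
  have hb1 : ∀ c, 0 ≤ 1 + t c := fun c => by
    have := trace_mul_nonneg hp0 (hY c)
    rw [Matrix.add_mul, Matrix.one_mul, trace_add, hone, htr] at this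
    exact_mod_cast this
  have hb2 : ∀ c, 0 ≤ 1 - t c := fun c => by
    have := trace_mul_nonneg hp1 (hY c)
    rw [Matrix.sub_mul, Matrix.one_mul, trace_sub, hone, htr] at this
    exact_mod_cast this
  refine ⟨κ × Fin 2, Fin 2, inferInstance, inferInstance, inferInstance, ψ,
    ![(1 / 2 : ℝ) • (1 + offDiag W), (1 / 2 : ℝ) • (1 - offDiag W)],
    fun c => ![(1 + t c) / 2, (1 - t c) / 2], vnorm_joinVec ha hv, ?_, ?_, ?_, ?_, ?_, ?_⟩
  · intro x
    fin_cases x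
    · exact hp0.smul (by norm_num)
    · exact hp1.smul (by norm_num)
  · rw [Fin.sum_univ_two]
    simp only [Matrix.cons_val_zero, Matrix.cons_val_one]
    rw [← smul_add, add_add_sub_cancel, ← two_smul ℝ, smul_smul]
    norm_num
  · intro c x
    fin_cases x
    · simp only [Fin.zero_eta, Matrix.cons_val_zero, Matrix.smul_mul, trace_smul, Matrix.add_mul,
        Matrix.one_mul, trace_add, hone, htr]
      rw [Complex.real_smul]
      push_cast; ring
    · simp only [Fin.mk_one, Matrix.cons_val_one, Matrix.cons_val_fin_one, Matrix.smul_mul, trace_smul,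
        Matrix.sub_mul, Matrix.one_mul, trace_sub, hone, htr]
      rw [Complex.real_smul]
      push_cast; ring
  · intro c x
    fin_cases x
    · exact div_nonneg (hb1 c) (by norm_num)
    · exact div_nonneg (hb2 c) (by norm_num)
  · intro c
    rw [Fin.sum_univ_two]
    simp only [Matrix.cons_val_zero, Matrix.cons_val_one]
    ring
  · rw [Fin.sum_univ_two]
    simp only [Matrix.cons_val_zero, Matrix.cons_val_one]
    have := bhattacharyya_two_le (p := (1 + t 0) / 2) (q := (1 + t 1) / 2)
      (by linarith [hb1 0]) (by linarith [hb2 0]) (by linarith [hb1 1]) (by linarith [hb2 1])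
    have e1 : 1 - (1 + t 0) / 2 = (1 - t 0) / 2 := by ring
    have e2 : 1 - (1 + t 1) / 2 = (1 - t 1) / 2 := by ring
    rw [e1, e2] at this
    refine this.trans (Real.sqrt_le_sqrt ?_)
    have e3 : (1 + t 0) / 2 - (1 + t 1) / 2 = (t 0 - t 1) / 2 := by ring
    rw [e3, hdiff]
    have : (d / 2) ^ 2 ≤ (traceNorm (tensorId κ (Φ 0 - Φ 1) (vecMulVec a (star v))) / 2) ^ 2 :=
      pow_le_pow_left₀ (by linarith) (by linarith) 2
    linarith

/-- The measurement operators, signed by which channel makes the outcome likelier, add up to a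
contraction whose pairing with the difference of the outputs is the `ℓ¹` distance of the outcome
distributions. -/
theorem Distinguishable.le_diamondNorm {Φ : Fin 2 → (Matrix ι ι ℂ →ₗ[ℂ] Matrix ι' ι' ℂ)} {β : ℝ}
    (h : Distinguishable Φ β) : 2 - 2 * β ≤ diamondNorm (Φ 0 - Φ 1) := by
  obtain ⟨κ, α, _, _, _, ψ, E, p, hψ, hE, hE1, hp, hp0, hp1, hβ⟩ := h
  set s : α → ℝ := fun x => if p 1 x ≤ p 0 x then 1 else -1 with hs
  set C := ∑ x, s x • E x with hC
  have hC1 : (1 + C).PosSemidef := by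
    rw [← hE1, hC, ← Finset.sum_add_distrib]
    refine posSemidef_sum _ fun x _ => ?_
    have : E x + s x • E x = (1 + s x) • E x := by rw [add_smul, one_smul]
    rw [this]
    refine (hE x).smul ?_
    simp only [hs]; split_ifs <;> norm_num
  have hC2 : (1 - C).PosSemidef := by
    rw [← hE1, hC, ← Finset.sum_sub_distrib]
    refine posSemidef_sum _ fun x _ => ?_
    have : E x - s x • E x = (1 - s x) • E x := by rw [sub_smul, one_smul]
    rw [this]
    refine (hE x).smul ?_
    simp only [hs]; split_ifs <;> norm_num
  have htr : (C * tensorId κ (Φ 0 - Φ 1) (vecMulVec ψ (star ψ))).trace =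
      ((∑ x, |p 0 x - p 1 x| : ℝ) : ℂ) := by
    rw [tensorId_sub, hC, Finset.sum_mul, trace_sum, Complex.ofReal_sum]
    refine Finset.sum_congr rfl fun x _ => ?_
    rw [Matrix.smul_mul, trace_smul, Matrix.mul_sub, trace_sub, hp, hp, Complex.real_smul,
      ← Complex.ofReal_sub, ← Complex.ofReal_mul]
    congr 1
    simp only [hs]
    split_ifs with hle
    · rw [abs_of_nonneg (by linarith), one_mul]
    · rw [abs_of_neg (by linarith)]; ring
  have h1 := norm_trace_mul_le (contr_of_posSemidef hC1 hC2)
    (tensorId κ (Φ 0 - Φ 1) (vecMulVec ψ (star ψ)))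
  rw [htr, Complex.norm_real, Real.norm_of_nonneg (Finset.sum_nonneg fun _ _ => abs_nonneg _)] at h1
  have h2 := dBound_diamondNorm (Φ 0 - Φ 1) κ (vecMulVec ψ (star ψ))
  have h3 := traceNorm_vecMulVec_le ψ ψ
  rw [hψ, mul_one] at h3
  -- Termwise `(√p - √q)² ≤ |p - q|`, since `|√p - √q| ≤ √p + √q`.
  have h4 : ∑ x, (p 0 x + p 1 x - 2 * Real.sqrt (p 0 x * p 1 x)) ≤ ∑ x, |p 0 x - p 1 x| := by
    refine Finset.sum_le_sum fun x _ => ?_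
    rw [Real.sqrt_mul (hp0 0 x)]
    set u := Real.sqrt (p 0 x)
    set w := Real.sqrt (p 1 x)
    have hu : u ^ 2 = p 0 x := Real.sq_sqrt (hp0 0 x)
    have hw : w ^ 2 = p 1 x := Real.sq_sqrt (hp0 1 x)
    have hu0 : 0 ≤ u := Real.sqrt_nonneg _
    have hw0 : 0 ≤ w := Real.sqrt_nonneg _
    rw [← hu, ← hw]
    rcases le_total u w with hle | hle
    · rw [abs_sub_comm, abs_of_nonneg (by nlinarith)]
      nlinarith
    · rw [abs_of_nonneg (by nlinarith)]
      nlinarith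
  rw [Finset.sum_sub_distrib, Finset.sum_add_distrib, hp1, hp1, ← Finset.mul_sum] at h4
  have h5 := mul_le_mul_of_nonneg_left h3 (diamondNorm_nonneg (Φ 0 - Φ 1))
  linarith

end Channels

end

section

open Matrix
open scoped ComplexOrder Kronecker MatrixOrder

/-! ### Tensor products of maps -/

section DBound

variable {ι ι' κ : Type} [Fintype ι] [DecidableEq ι] [Fintype ι'] [DecidableEq ι']
  [Fintype κ] [DecidableEq κ]

theorem DBound.add {Φ Ψ : Matrix ι ι ℂ →ₗ[ℂ] Matrix ι' ι' ℂ} {c d : ℝ} (hΦ : DBound Φ c)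
    (hΨ : DBound Ψ d) : DBound (Φ + Ψ) (c + d) := fun κ _ _ X => by
  have e : tensorId κ (Φ + Ψ) X = tensorId κ Φ X + tensorId κ Ψ X := rfl
  rw [e, add_mul]
  exact (traceNorm_add_le _ _).trans (add_le_add (hΦ κ X) (hΨ κ X))

theorem DBound.mono {Φ : Matrix ι ι ℂ →ₗ[ℂ] Matrix ι' ι' ℂ} {c d : ℝ} (hΦ : DBound Φ c)
    (h : c ≤ d) : DBound Φ d := fun κ _ _ X =>
  (hΦ κ X).trans (mul_le_mul_of_nonneg_right h (traceNorm_nonneg X))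

theorem tensorId_smul (c : ℂ) (Φ : Matrix ι ι ℂ →ₗ[ℂ] Matrix ι' ι' ℂ)
    (X : Matrix (ι × κ) (ι × κ) ℂ) : tensorId κ (c • Φ) X = c • tensorId κ Φ X := rfl

theorem diamondNorm_smul_le (c : ℂ) (Φ : Matrix ι ι ℂ →ₗ[ℂ] Matrix ι' ι' ℂ) :
    diamondNorm (c • Φ) ≤ ‖c‖ * diamondNorm Φ :=
  diamondNorm_le_of_dBound (mul_nonneg (norm_nonneg _) (diamondNorm_nonneg Φ)) fun κ _ _ X => by
    rw [tensorId_smul, traceNorm_smul, mul_assoc]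
    exact mul_le_mul_of_nonneg_left (dBound_diamondNorm Φ κ X) (norm_nonneg _)

theorem diamondNorm_smul (c : ℂ) (Φ : Matrix ι ι ℂ →ₗ[ℂ] Matrix ι' ι' ℂ) :
    diamondNorm (c • Φ) = ‖c‖ * diamondNorm Φ := by
  refine le_antisymm (diamondNorm_smul_le c Φ) ?_
  by_cases hc : c = 0
  · simpa [hc] using diamondNorm_nonneg _
  · have h := diamondNorm_smul_le c⁻¹ (c • Φ)
    rw [smul_smul, inv_mul_cancel₀ hc, one_smul, norm_inv] at h
    rwa [← le_inv_mul_iff₀ (norm_pos_iff.2 hc)]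

end DBound

section Tens

variable {ι ι' ι₁ ι₁' ι₂ ι₂' : Type} [Fintype ι] [DecidableEq ι] [Fintype ι'] [DecidableEq ι']
  [Fintype ι₁] [DecidableEq ι₁] [Fintype ι₁'] [DecidableEq ι₁']
  [Fintype ι₂] [DecidableEq ι₂] [Fintype ι₂'] [DecidableEq ι₂']

/-- The map `Φ₁ ⊗ Φ₂`, where the basis of the tensor products are reindexed by `e`, `e'`. -/
def tensE (e : ι₁ × ι₂ ≃ ι) (e' : ι₁' × ι₂' ≃ ι') (Φ₁ : Matrix ι₁ ι₁ ℂ →ₗ[ℂ] Matrix ι₁' ι₁' ℂ)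
    (Φ₂ : Matrix ι₂ ι₂ ℂ →ₗ[ℂ] Matrix ι₂' ι₂' ℂ) : Matrix ι ι ℂ →ₗ[ℂ] Matrix ι' ι' ℂ :=
  (reindexLinearEquiv ℂ ℂ e' e').toLinearMap ∘ₗ tensorIdₗ ι₂' Φ₁ ∘ₗ
    (reindexLinearEquiv ℂ ℂ (Equiv.prodComm ι₂' ι₁) (Equiv.prodComm ι₂' ι₁)).toLinearMap ∘ₗ
    tensorIdₗ ι₁ Φ₂ ∘ₗ
    (reindexLinearEquiv ℂ ℂ (e.symm.trans (Equiv.prodComm ι₁ ι₂))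
      (e.symm.trans (Equiv.prodComm ι₁ ι₂))).toLinearMap

variable {e : ι₁ × ι₂ ≃ ι} {e' : ι₁' × ι₂' ≃ ι'}
  {Φ₁ Ψ₁ : Matrix ι₁ ι₁ ℂ →ₗ[ℂ] Matrix ι₁' ι₁' ℂ} {Φ₂ Ψ₂ : Matrix ι₂ ι₂ ℂ →ₗ[ℂ] Matrix ι₂' ι₂' ℂ}

theorem tensE_apply (ρ : Matrix ι ι ℂ) (x y : ι') :
    tensE e e' Φ₁ Φ₂ ρ x y =
      Φ₁ (Matrix.of fun a b => Φ₂ (Matrix.of fun c d => ρ (e (a, c)) (e (b, d)))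
        (e'.symm x).2 (e'.symm y).2) (e'.symm x).1 (e'.symm y).1 := rfl

theorem tensE_sub_left : tensE e e' (Φ₁ - Ψ₁) Φ₂ = tensE e e' Φ₁ Φ₂ - tensE e e' Ψ₁ Φ₂ := rfl

theorem tensE_sub_right : tensE e e' Φ₁ (Φ₂ - Ψ₂) = tensE e e' Φ₁ Φ₂ - tensE e e' Φ₁ Ψ₂ := by
  ext ρ x y
  simp only [LinearMap.sub_apply, Matrix.sub_apply, tensE_apply]
  exact congrFun (congrFun (map_sub Φ₁
    (Matrix.of fun a b => Φ₂ (Matrix.of fun c d => ρ (e (a, c)) (e (b, d)))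
      (e'.symm x).2 (e'.symm y).2)
    (Matrix.of fun a b => Ψ₂ (Matrix.of fun c d => ρ (e (a, c)) (e (b, d)))
      (e'.symm x).2 (e'.symm y).2)) _) _

variable {μ : Type} [Fintype μ] [DecidableEq μ]

/-- Both factors act one after the other, each with all remaining systems as reference. Bounds and
positivity for every reference therefore pass to tensor products. -/
theorem tensorId_tensE (X : Matrix (ι × μ) (ι × μ) ℂ) :
    tensorId μ (tensE e e' Φ₁ Φ₂) X =
      (tensorId (ι₂' × μ) Φ₁
        ((tensorId (ι₁ × μ) Φ₂
          (X.submatrix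
            (((Equiv.prodAssoc ι₂ ι₁ μ).symm.trans
              (Equiv.prodCongr (Equiv.prodComm ι₂ ι₁) (Equiv.refl μ))).trans
              (Equiv.prodCongr e (Equiv.refl μ)))
            (((Equiv.prodAssoc ι₂ ι₁ μ).symm.trans
              (Equiv.prodCongr (Equiv.prodComm ι₂ ι₁) (Equiv.refl μ))).trans
              (Equiv.prodCongr e (Equiv.refl μ))))).submatrix
            (((Equiv.prodAssoc ι₁ ι₂' μ).symm.trans
              (Equiv.prodCongr (Equiv.prodComm ι₁ ι₂') (Equiv.refl μ))).trans
              (Equiv.prodAssoc ι₂' ι₁ μ))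
            (((Equiv.prodAssoc ι₁ ι₂' μ).symm.trans
              (Equiv.prodCongr (Equiv.prodComm ι₁ ι₂') (Equiv.refl μ))).trans
              (Equiv.prodAssoc ι₂' ι₁ μ)))).submatrix
          ((Equiv.prodCongr e'.symm (Equiv.refl μ)).trans (Equiv.prodAssoc ι₁' ι₂' μ))
          ((Equiv.prodCongr e'.symm (Equiv.refl μ)).trans (Equiv.prodAssoc ι₁' ι₂' μ)) := rfl

theorem DBound.tensE {c d : ℝ} (hc : 0 ≤ c) (h₁ : DBound Φ₁ c) (h₂ : DBound Φ₂ d) :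
    DBound (tensE e e' Φ₁ Φ₂) (c * d) := fun μ _ _ X => by
  rw [tensorId_tensE, traceNorm_submatrix, mul_assoc]
  refine (h₁ _ _).trans (mul_le_mul_of_nonneg_left ?_ hc)
  rw [traceNorm_submatrix]
  refine (h₂ _ _).trans (le_of_eq ?_)
  rw [traceNorm_submatrix]

theorem IsChan.tensE (h₁ : IsChan Φ₁) (h₂ : IsChan Φ₂) : IsChan (tensE e e' Φ₁ Φ₂) where
  pos μ _ _ X hX := by
    rw [tensorId_tensE]
    exact (h₁.pos _ _ ((h₂.pos _ _ (hX.submatrix _)).submatrix _)).submatrix _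
  tr X := by
    have hre : ∀ {α β : Type} [Fintype α] [Fintype β] (f : α ≃ β) (Y : Matrix β β ℂ),
        (Y.submatrix f f).trace = Y.trace := fun f Y => by
      simp only [Matrix.trace, Matrix.diag_apply, Matrix.submatrix_apply]
      exact Equiv.sum_comp f fun i => Y i i
    change ((tensorId ι₂' Φ₁ ((tensorId ι₁ Φ₂ (X.submatrix ((Equiv.prodComm ι₂ ι₁).trans e)
      ((Equiv.prodComm ι₂ ι₁).trans e))).submatrix (Equiv.prodComm ι₁ ι₂')
      (Equiv.prodComm ι₁ ι₂'))).submatrix e'.symm e'.symm).trace = _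
    rw [hre, h₁.trace_tensorId, hre, h₂.trace_tensorId, hre]

variable {κ₁ κ₂ : Type} [Fintype κ₁] [DecidableEq κ₁] [Fintype κ₂] [DecidableEq κ₂]

/-- Regrouping of the indices of `(ι₁ ⊗ ι₂) ⊗ (κ₁ ⊗ κ₂)`. -/
def regroup (e : ι₁ × ι₂ ≃ ι) (κ₁ κ₂ : Type) : ι × (κ₁ × κ₂) ≃ (ι₁ × κ₁) × (ι₂ × κ₂) :=
  (Equiv.prodCongr e.symm (Equiv.refl _)).trans (Equiv.prodProdProdComm ι₁ ι₂ κ₁ κ₂)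

theorem tensorId_tensE_kronecker (X : Matrix (ι₁ × κ₁) (ι₁ × κ₁) ℂ)
    (Y : Matrix (ι₂ × κ₂) (ι₂ × κ₂) ℂ) :
    tensorId (κ₁ × κ₂) (tensE e e' Φ₁ Φ₂)
      ((X ⊗ₖ Y).submatrix (regroup e κ₁ κ₂) (regroup e κ₁ κ₂)) =
    (tensorId κ₁ Φ₁ X ⊗ₖ tensorId κ₂ Φ₂ Y).submatrix (regroup e' κ₁ κ₂) (regroup e' κ₁ κ₂) := by
  ext ⟨x, k⟩ ⟨y, l⟩
  simp only [tensorId, Matrix.of_apply, tensE_apply, Matrix.submatrix_apply, kroneckerMap_apply,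
    regroup, Equiv.trans_apply, Equiv.prodCongr_apply, Prod.map, Equiv.symm_apply_apply,
    Equiv.refl_apply, Equiv.prodProdProdComm_apply]
  have e1 : ∀ a b, Φ₂ (Matrix.of fun c d => X (a, k.1) (b, l.1) * Y (c, k.2) (d, l.2)) =
      X (a, k.1) (b, l.1) • Φ₂ (Matrix.of fun c d => Y (c, k.2) (d, l.2)) := fun a b => by
    rw [← map_smul]; rfl
  simp only [e1, Matrix.smul_apply, smul_eq_mul]
  set t := Φ₂ (Matrix.of fun c d => Y (c, k.2) (d, l.2)) (e'.symm x).2 (e'.symm y).2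
  have e2 : (Matrix.of fun a b => X (a, k.1) (b, l.1) * t) =
      t • Matrix.of fun a b => X (a, k.1) (b, l.1) := by
    ext a b; simp [mul_comm]
  rw [e2, map_smul, Matrix.smul_apply, smul_eq_mul, mul_comm]

theorem contr_submatrix {α β : Type*} [Fintype α] [Fintype β]
    (f : α ≃ β) {W : Matrix β β ℂ} (hW : Contr W) : Contr (W.submatrix f f) := fun a => by
  have hn : ∀ b : β → ℂ, vnorm (b ∘ f) = vnorm b := fun b => by
    refine (pow_left_inj₀ (vnorm_nonneg _) (vnorm_nonneg _) two_ne_zero).1 ?_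
    rw [vnorm_sq, vnorm_sq]
    exact Equiv.sum_comp f fun i => ‖b i‖ ^ 2
  rw [submatrix_mulVec_equiv, hn]
  refine (hW _).trans_eq ?_
  rw [← hn (a ∘ f.symm)]
  congr 1
  ext i; simp

theorem contr_kronecker {α β : Type} [Fintype α] [Fintype β] [DecidableEq α] [DecidableEq β]
    {W : Matrix α α ℂ} {V : Matrix β β ℂ} (hW : Contr W) (hV : Contr V) : Contr (W ⊗ₖ V) := by
  have e : W ⊗ₖ V = ((1 : Matrix α α ℂ) ⊗ₖ V) *
      ((1 : Matrix β β ℂ) ⊗ₖ W).submatrix (Equiv.prodComm α β) (Equiv.prodComm α β) := by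
    have : ((1 : Matrix β β ℂ) ⊗ₖ W).submatrix (Equiv.prodComm α β) (Equiv.prodComm α β) =
        W ⊗ₖ (1 : Matrix β β ℂ) := by
      ext ⟨i, k⟩ ⟨j, l⟩; simp [mul_comm]
    rw [this, ← mul_kronecker_mul, Matrix.one_mul, Matrix.mul_one]
  rw [e]
  exact (contr_one_kronecker hV).mul (contr_submatrix _ (contr_one_kronecker hW))

/-- Test with the tensor product of the two optimal contractions. -/
theorem traceNorm_mul_le_kronecker {α β : Type} [Fintype α] [Fintype β] [DecidableEq α]
    [DecidableEq β] (X : Matrix α α ℂ) (Y : Matrix β β ℂ) :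
    traceNorm X * traceNorm Y ≤ traceNorm (X ⊗ₖ Y) := by
  obtain ⟨W, hW, hX⟩ := exists_trace_mul_eq X
  obtain ⟨V, hV, hY⟩ := exists_trace_mul_eq Y
  have h := norm_trace_mul_le (contr_kronecker hW hV) (X ⊗ₖ Y)
  rw [← mul_kronecker_mul, trace_kronecker, hX, hY, ← Complex.ofReal_mul, Complex.norm_real,
    Real.norm_of_nonneg (mul_nonneg (traceNorm_nonneg X) (traceNorm_nonneg Y))] at h
  exact h

/-- The tensor product of two vectors. -/
def vecTens {α β : Type} (a : α → ℂ) (b : β → ℂ) : α × β → ℂ := fun q => a q.1 * b q.2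

theorem vnorm_vecTens {α β : Type} [Fintype α] [Fintype β] {a : α → ℂ} {b : β → ℂ}
    (ha : vnorm a = 1) (hb : vnorm b = 1) : vnorm (vecTens a b) = 1 := by
  have h : vnorm (vecTens a b) ^ 2 = vnorm a ^ 2 * vnorm b ^ 2 := by
    simp only [vnorm_sq, Fintype.sum_prod_type, vecTens, norm_mul, mul_pow, Finset.sum_mul_sum]
  rw [ha, hb] at h
  have h0 := vnorm_nonneg (vecTens a b)
  nlinarith

theorem vecMulVec_kronecker {α β : Type} (a a' : α → ℂ) (b b' : β → ℂ) :
    vecMulVec a (star a') ⊗ₖ vecMulVec b (star b') =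
      vecMulVec (vecTens a b) (star (vecTens a' b')) := by
  ext p q
  simp [vecMulVec_apply, vecTens]
  ring

/-- The upper bound is `DBound.tensE`. The lower bound uses tensor products of normalized rank-one
inputs, whose outputs are tensor products. -/
theorem diamondNorm_tensE : diamondNorm (tensE e e' Φ₁ Φ₂) = diamondNorm Φ₁ * diamondNorm Φ₂ := by
  refine le_antisymm (diamondNorm_le_of_dBound (mul_nonneg (diamondNorm_nonneg _)
    (diamondNorm_nonneg _)) ((dBound_diamondNorm Φ₁).tensE (diamondNorm_nonneg _)
    (dBound_diamondNorm Φ₂))) ?_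
  set D := diamondNorm (tensE e e' Φ₁ Φ₂) with hD
  have hD0 : 0 ≤ D := diamondNorm_nonneg _
  have key : ∀ (κ₁ κ₂ : Type) [Fintype κ₁] [DecidableEq κ₁] [Fintype κ₂] [DecidableEq κ₂]
      (a v : ι₁ × κ₁ → ℂ) (b w : ι₂ × κ₂ → ℂ), vnorm a = 1 → vnorm v = 1 → vnorm b = 1 →
      vnorm w = 1 → traceNorm (tensorId κ₁ Φ₁ (vecMulVec a (star v))) *
        traceNorm (tensorId κ₂ Φ₂ (vecMulVec b (star w))) ≤ D := by
    intro κ₁ κ₂ _ _ _ _ a v b w ha hv hb hw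
    refine (traceNorm_mul_le_kronecker _ _).trans ?_
    rw [← traceNorm_submatrix (regroup e' κ₁ κ₂), ← tensorId_tensE_kronecker (e := e)]
    refine (dBound_diamondNorm _ _ _).trans ?_
    rw [traceNorm_submatrix, vecMulVec_kronecker]
    have := traceNorm_vecMulVec_le (vecTens a b) (vecTens v w)
    rw [vnorm_vecTens ha hb, vnorm_vecTens hv hw, mul_one] at this
    exact mul_le_of_le_one_right hD0 this
  -- The supremum is taken over the first factor with the second input fixed, and then over the
  -- second. Each time one divides by the other factor, whence the separate zero cases.
  have step : ∀ (κ₂ : Type) [Fintype κ₂] [DecidableEq κ₂] (b w : ι₂ × κ₂ → ℂ), vnorm b = 1 →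
      vnorm w = 1 → diamondNorm Φ₁ * traceNorm (tensorId κ₂ Φ₂ (vecMulVec b (star w))) ≤ D := by
    intro κ₂ _ _ b w hb hw
    rcases (traceNorm_nonneg (tensorId κ₂ Φ₂ (vecMulVec b (star w)))).eq_or_lt with h0 | h0
    · rw [← h0, mul_zero]; exact hD0
    · rw [← le_div_iff₀ h0]
      refine diamondNorm_le_of_rankOne (div_nonneg hD0 h0.le) fun κ₁ _ _ a v ha hv => ?_
      rw [le_div_iff₀ h0]
      exact key κ₁ κ₂ a v b w ha hv hb hw
  rcases (diamondNorm_nonneg Φ₁).eq_or_lt with h0 | h0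
  · rw [← h0, zero_mul]; exact hD0
  · rw [mul_comm, ← le_div_iff₀ h0]
    refine diamondNorm_le_of_rankOne (div_nonneg hD0 h0.le) fun κ₂ _ _ b w hb hw => ?_
    rw [le_div_iff₀ h0, mul_comm]
    exact step κ₂ b w hb hw

end Tens

/-! ### Tensor products of pairs of channels -/

section TensPair

variable {ι ι' ι₁ ι₁' ι₂ ι₂' : Type} [Fintype ι] [DecidableEq ι] [Fintype ι'] [DecidableEq ι']
  [Fintype ι₁] [DecidableEq ι₁] [Fintype ι₁'] [DecidableEq ι₁']
  [Fintype ι₂] [DecidableEq ι₂] [Fintype ι₂'] [DecidableEq ι₂']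
  {e : ι₁ × ι₂ ≃ ι} {e' : ι₁' × ι₂' ≃ ι'}
  {Φ : Fin 2 → (Matrix ι₁ ι₁ ℂ →ₗ[ℂ] Matrix ι₁' ι₁' ℂ)}
  {Ψ : Fin 2 → (Matrix ι₂ ι₂ ℂ →ₗ[ℂ] Matrix ι₂' ι₂' ℂ)}

/-- With the product state and the product measurement the outcomes are independent, and the
Bhattacharyya sum factors. -/
theorem Distinguishable.tensE {β γ : ℝ} (hΦ : Distinguishable Φ β) (hΨ : Distinguishable Ψ γ) :
    Distinguishable (fun c => tensE e e' (Φ c) (Ψ c)) (β * γ) := by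
  obtain ⟨κ₁, α₁, _, _, _, ψ₁, E₁, p₁, hψ₁, hE₁, hs₁, ht₁, hp₁, ho₁, hb₁⟩ := hΦ
  obtain ⟨κ₂, α₂, _, _, _, ψ₂, E₂, p₂, hψ₂, hE₂, hs₂, ht₂, hp₂, ho₂, hb₂⟩ := hΨ
  have hvec : vecMulVec (vecTens ψ₁ ψ₂ ∘ regroup e κ₁ κ₂) (star (vecTens ψ₁ ψ₂ ∘ regroup e κ₁ κ₂)) =
      (vecMulVec ψ₁ (star ψ₁) ⊗ₖ vecMulVec ψ₂ (star ψ₂)).submatrix (regroup e κ₁ κ₂)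
        (regroup e κ₁ κ₂) := by
    rw [vecMulVec_kronecker]; rfl
  have hre : ∀ {α β : Type} [Fintype α] [Fintype β] (f : α ≃ β) (Y : Matrix β β ℂ),
      (Y.submatrix f f).trace = Y.trace := fun f Y => by
    simp only [Matrix.trace, Matrix.diag_apply, Matrix.submatrix_apply]
    exact Equiv.sum_comp f fun i => Y i i
  refine ⟨κ₁ × κ₂, α₁ × α₂, inferInstance, inferInstance, inferInstance,
    vecTens ψ₁ ψ₂ ∘ regroup e κ₁ κ₂,
    fun x => (E₁ x.1 ⊗ₖ E₂ x.2).submatrix (regroup e' κ₁ κ₂) (regroup e' κ₁ κ₂),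
    fun c x => p₁ c x.1 * p₂ c x.2, ?_, ?_, ?_, ?_, ?_, ?_, ?_⟩
  · refine (pow_left_inj₀ (vnorm_nonneg _) zero_le_one two_ne_zero).1 ?_
    rw [← vnorm_vecTens hψ₁ hψ₂, vnorm_sq, vnorm_sq]
    exact Equiv.sum_comp (regroup e κ₁ κ₂) fun i => ‖vecTens ψ₁ ψ₂ i‖ ^ 2
  · exact fun x => ((hE₁ x.1).kronecker (hE₂ x.2)).submatrix _
  · ext p q
    have h1 := congrFun (congrFun hs₁ (regroup e' κ₁ κ₂ p).1) (regroup e' κ₁ κ₂ q).1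
    have h2 := congrFun (congrFun hs₂ (regroup e' κ₁ κ₂ p).2) (regroup e' κ₁ κ₂ q).2
    rw [Matrix.sum_apply] at h1 h2
    rw [Matrix.sum_apply, Fintype.sum_prod_type]
    simp only [Matrix.submatrix_apply, kroneckerMap_apply]
    rw [← Finset.sum_mul_sum, h1, h2, Matrix.one_apply, Matrix.one_apply, Matrix.one_apply,
      ite_zero_mul_ite_zero, one_mul]
    congr 1
    rw [← Prod.ext_iff, (regroup e' κ₁ κ₂).apply_eq_iff_eq]
  · intro c x
    rw [hvec, tensorId_tensE_kronecker, submatrix_mul_equiv, hre, ← mul_kronecker_mul,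
      trace_kronecker, ht₁, ht₂, Complex.ofReal_mul]
  · exact fun c x => mul_nonneg (hp₁ c x.1) (hp₂ c x.2)
  · intro c
    rw [Fintype.sum_prod_type]
    simp only
    rw [← Finset.sum_mul_sum, ho₁, ho₂, one_mul]
  · have h : ∀ x : α₁ × α₂, Real.sqrt (p₁ 0 x.1 * p₂ 0 x.2 * (p₁ 1 x.1 * p₂ 1 x.2)) =
        Real.sqrt (p₁ 0 x.1 * p₁ 1 x.1) * Real.sqrt (p₂ 0 x.2 * p₂ 1 x.2) := fun x => by
      rw [← Real.sqrt_mul (mul_nonneg (hp₁ _ _) (hp₁ _ _))]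
      congr 1; ring
    simp only [h]
    rw [Fintype.sum_prod_type]
    simp only
    rw [← Finset.sum_mul_sum]
    exact mul_le_mul hb₁ hb₂ (Finset.sum_nonneg fun _ _ => Real.sqrt_nonneg _)
      ((Finset.sum_nonneg fun _ _ => Real.sqrt_nonneg _).trans hb₁)

/-- Hybrid argument: exchange one factor at a time, the other being a channel and so of norm at most
one. -/
theorem dBound_tensE_sub {c d : ℝ} (hΦ : DBound (Φ 0 - Φ 1) c) (hΨ : DBound (Ψ 0 - Ψ 1) d)
    (hΦc : ∀ b, IsChan (Φ b)) (hΨc : ∀ b, IsChan (Ψ b)) (hc : 0 ≤ c) :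
    DBound (tensE e e' (Φ 0) (Ψ 0) - tensE e e' (Φ 1) (Ψ 1)) (c + d) := by
  have h : tensE e e' (Φ 0) (Ψ 0) - tensE e e' (Φ 1) (Ψ 1) =
      tensE e e' (Φ 0 - Φ 1) (Ψ 0) + tensE e e' (Φ 1) (Ψ 0 - Ψ 1) := by
    rw [tensE_sub_left, tensE_sub_right]; abel
  rw [h]
  have h1 := hΦ.tensE (e := e) (e' := e') hc (hΨc 0).dBound
  have h2 := (hΦc 1).dBound.tensE (e := e) (e' := e') zero_le_one hΨ
  simpa using h1.add h2

end TensPair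

end

section

open Matrix
open scoped ComplexOrder Kronecker MatrixOrder

/-! ### Parallel repetition and parity of pairs of channels -/

section Convex

variable {ι ι' κ : Type} [Fintype ι] [DecidableEq ι] [Fintype ι'] [DecidableEq ι']
  [Fintype κ] [DecidableEq κ]

/-- A reindexing compressed by a diagonal projection. Several of the non-unitary maps below are sums
of operators of this form. -/
theorem posSemidef_mask {α β : Type*} [Fintype α] [Fintype β] [DecidableEq α] [DecidableEq β]
    {X : Matrix α α ℂ} (hX : X.PosSemidef) (f : β → α) (s : β → Prop) [DecidablePred s] :
    (Matrix.of fun x y => if s x ∧ s y then X (f x) (f y) else 0 : Matrix β β ℂ).PosSemidef := by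
  have h := (hX.submatrix f).mul_mul_conjTranspose_same
    (diagonal fun x => if s x then (1 : ℂ) else 0)
  convert h using 1
  ext x y
  rw [diagonal_conjTranspose, mul_diagonal, diagonal_mul]
  by_cases hx : s x <;> by_cases hy : s y <;> simp [hx, hy]

theorem IsChan.average {Φ : Fin 2 → (Matrix ι ι ℂ →ₗ[ℂ] Matrix ι' ι' ℂ)} (h : ∀ c, IsChan (Φ c)) :
    IsChan ((1 / 2 : ℂ) • ∑ c, Φ c) where
  pos κ _ _ X hX := by
    have e : tensorId κ ((1 / 2 : ℂ) • ∑ c, Φ c) X =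
        (1 / 2 : ℝ) • (tensorId κ (Φ 0) X + tensorId κ (Φ 1) X) := by
      ext p q
      simp [tensorId, Fin.sum_univ_two]
    rw [e]
    exact (((h 0).pos κ X hX).add ((h 1).pos κ X hX)).smul (by norm_num)
  tr X := by
    rw [Fin.sum_univ_two, LinearMap.smul_apply, LinearMap.add_apply, trace_smul, trace_add,
      (h 0).tr, (h 1).tr, smul_eq_mul]
    ring

end Convex

variable {k l k' l' : ℕ}

/-- The tensor product of maps on operators on qubits. -/
def tens (Φ : QOp k →ₗ[ℂ] QOp l) (Ψ : QOp k' →ₗ[ℂ] QOp l') : QOp (k + k') →ₗ[ℂ] QOp (l + l') :=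
  tensE (Fin.appendEquiv k k') (Fin.appendEquiv l l') Φ Ψ

/-- The number of output qubits of the parity construction. -/
def parityOutputs (l : ℕ) : ℕ → ℕ
  | 0 => 1
  | r + 1 => parityOutputs l r + l

/-- Preparation of one qubit in the state `|b⟩`. -/
def prepBit (b : Fin 2) : QOp 0 →ₗ[ℂ] QOp 1 where
  toFun ρ := Matrix.of fun x y => if x 0 = b ∧ y 0 = b then ρ default default else 0
  map_add' ρ σ := by
    ext x y
    by_cases h : x 0 = b ∧ y 0 = b <;> simp [h]
  map_smul' c ρ := by
    ext x y
    by_cases h : x 0 = b ∧ y 0 = b <;> simp [h]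

/-- The average of `Φ_{y₁} ⊗ ⋯ ⊗ Φ_{y_r}` over all `y`, together with the bit `b + ∑ y_i`. -/
def parityPair (Φ : Fin 2 → (QOp k →ₗ[ℂ] QOp l)) :
    (r : ℕ) → Fin 2 → (QOp (k * r) →ₗ[ℂ] QOp (parityOutputs l r))
  | 0, b => prepBit b
  | r + 1, b => (1 / 2 : ℂ) • ∑ y, tens (parityPair Φ r (b + y)) (Φ y)

/-- The `r`-fold tensor powers of a pair of maps. -/
def powerPair (Φ : Fin 2 → (QOp k →ₗ[ℂ] QOp l)) :
    (r : ℕ) → Fin 2 → (QOp (k * r) →ₗ[ℂ] QOp (l * r))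
  | 0, _ => (LinearMap.id : QOp 0 →ₗ[ℂ] QOp 0)
  | r + 1, c => tens (powerPair Φ r c) (Φ c)

theorem isChan_prepBit (b : Fin 2) : IsChan (prepBit b) where
  pos κ _ _ X hX := by
    have e : tensorId κ (prepBit b) X = Matrix.of fun p q : (Fin 1 → Fin 2) × κ =>
        if p.1 0 = b ∧ q.1 0 = b then X (default, p.2) (default, q.2) else 0 := rfl
    rw [e]
    exact posSemidef_mask hX (fun p : (Fin 1 → Fin 2) × κ => (default, p.2)) fun p => p.1 0 = b
  tr X := by
    simp only [Matrix.trace, Matrix.diag_apply, prepBit, LinearMap.coe_mk, AddHom.coe_mk,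
      Matrix.of_apply, and_self]
    rw [← Equiv.sum_comp (Equiv.funUnique (Fin 1) (Fin 2)).symm]
    simp
    exact congrArg₂ X (Subsingleton.elim _ _) (Subsingleton.elim _ _)

theorem isChan_parityPair {Φ : Fin 2 → (QOp k →ₗ[ℂ] QOp l)} (h : ∀ c, IsChan (Φ c)) (r : ℕ)
    (b : Fin 2) : IsChan (parityPair Φ r b) := by
  induction r generalizing b with
  | zero => exact isChan_prepBit b
  | succ r ih => exact IsChan.average fun y => (ih (b + y)).tensE (h y)

theorem isChan_powerPair {Φ : Fin 2 → (QOp k →ₗ[ℂ] QOp l)} (h : ∀ c, IsChan (Φ c)) (r : ℕ)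
    (b : Fin 2) : IsChan (powerPair Φ r b) := by
  induction r with
  | zero => exact isChan_id
  | succ r ih => exact ih.tensE (h b)

theorem diamondNorm_sub_le_two {Φ Ψ : QOp k →ₗ[ℂ] QOp l} (hΦ : IsChan Φ) (hΨ : IsChan Ψ) :
    diamondNorm (Φ - Ψ) ≤ 2 := by
  refine diamondNorm_le_of_dBound zero_le_two fun κ _ _ X => ?_
  have e : tensorId κ (Φ - Ψ) X = tensorId κ Φ X + (-1 : ℂ) • tensorId κ Ψ X := by
    rw [tensorId_sub, sub_eq_add_neg, neg_one_smul]
  have h1 := hΦ.dBound κ X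
  have h2 := hΨ.dBound κ X
  have h3 := traceNorm_smul (-1 : ℂ) (tensorId κ Ψ X)
  rw [norm_neg, norm_one, one_mul] at h3
  rw [e]
  refine (traceNorm_add_le _ _).trans ?_
  rw [h3]
  linarith

/-- Measuring the bit tells the two preparations apart with certainty, so the Bhattacharyya
coefficient is zero. -/
theorem diamondNorm_prepBit_sub : diamondNorm (prepBit 0 - prepBit 1) = 2 := by
  refine le_antisymm (diamondNorm_sub_le_two (isChan_prepBit 0) (isChan_prepBit 1)) ?_
  have h := Distinguishable.le_diamondNorm (Φ := prepBit) (β := 0) ?_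
  · simpa using h
  refine ⟨Unit, Fin 2, inferInstance, inferInstance, inferInstance, fun _ => 1,
    fun x => diagonal fun p => if p.1 0 = x then 1 else 0, fun c x => if c = x then 1 else 0,
    ?_, ?_, ?_, ?_, ?_, ?_, ?_⟩
  · refine (pow_left_inj₀ (vnorm_nonneg _) zero_le_one two_ne_zero).1 ?_
    rw [vnorm_sq]
    simp
  · intro x
    refine PosSemidef.diagonal fun p => ?_
    simp only [Pi.zero_apply]
    split_ifs <;> simp
  · ext p q
    rw [Matrix.sum_apply]
    by_cases h : p = q
    · subst h; simp
    · simp [h]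
  · intro c x
    simp only [Matrix.trace, Matrix.diag_apply, diagonal_mul, Fintype.sum_prod_type, tensorId,
      prepBit, LinearMap.coe_mk, AddHom.coe_mk, Matrix.of_apply, vecMulVec_apply]
    rw [← Equiv.sum_comp (Equiv.funUnique (Fin 1) (Fin 2)).symm]
    fin_cases c <;> fin_cases x <;> simp
  · intro c x
    dsimp only
    split_ifs <;> simp
  · intro c
    simp
  · simp [Fin.sum_univ_two]

/-- The four terms carry the signs of a product of two differences; this is why parity multiplies
distances. -/
theorem average_tens_sub (Ψ : Fin 2 → (QOp k' →ₗ[ℂ] QOp l')) (Φ : Fin 2 → (QOp k →ₗ[ℂ] QOp l)) :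
    (1 / 2 : ℂ) • ∑ y, tens (Ψ (0 + y)) (Φ y) - (1 / 2 : ℂ) • ∑ y, tens (Ψ (1 + y)) (Φ y) =
      (1 / 2 : ℂ) • tens (Ψ 0 - Ψ 1) (Φ 0 - Φ 1) := by
  have e : (1 + 1 : Fin 2) = 0 := rfl
  simp only [tens, tensE_sub_left, tensE_sub_right, Fin.sum_univ_two, zero_add, add_zero, e]
  module

theorem diamondNorm_average_tens_sub (Ψ : Fin 2 → (QOp k' →ₗ[ℂ] QOp l'))
    (Φ : Fin 2 → (QOp k →ₗ[ℂ] QOp l)) :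
    diamondNorm ((1 / 2 : ℂ) • ∑ y, tens (Ψ (0 + y)) (Φ y) -
      (1 / 2 : ℂ) • ∑ y, tens (Ψ (1 + y)) (Φ y)) =
      1 / 2 * (diamondNorm (Ψ 0 - Ψ 1) * diamondNorm (Φ 0 - Φ 1)) := by
  rw [average_tens_sub, diamondNorm_smul, tens, diamondNorm_tensE]
  norm_num

theorem diamondNorm_parityPair_sub (Φ : Fin 2 → (QOp k →ₗ[ℂ] QOp l)) (r : ℕ) :
    diamondNorm (parityPair Φ r 0 - parityPair Φ r 1) = 2 * (diamondNorm (Φ 0 - Φ 1) / 2) ^ r := by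
  induction r with
  | zero => rw [pow_zero, mul_one]; exact diamondNorm_prepBit_sub
  | succ r ih =>
    refine (diamondNorm_average_tens_sub (parityPair Φ r) Φ).trans ?_
    rw [ih, pow_succ]
    ring

theorem dBound_powerPair_sub {Φ : Fin 2 → (QOp k →ₗ[ℂ] QOp l)} (h : ∀ c, IsChan (Φ c)) (r : ℕ) :
    DBound (powerPair Φ r 0 - powerPair Φ r 1) (r * diamondNorm (Φ 0 - Φ 1)) := by
  induction r with
  | zero =>
    intro κ _ _ X
    have e : tensorId κ (powerPair Φ 0 0 - powerPair Φ 0 1) X = 0 := by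
      rw [tensorId_sub]; exact sub_self _
    rw [e, traceNorm_zero]; simp
  | succ r ih =>
    have := dBound_tensE_sub (e := Fin.appendEquiv (k * r) k) (e' := Fin.appendEquiv (l * r) l)
      (Φ := powerPair Φ r) (Ψ := Φ) ih (dBound_diamondNorm _) (isChan_powerPair h r) h
      (mul_nonneg (Nat.cast_nonneg r) (diamondNorm_nonneg _))
    refine DBound.mono this (le_of_eq ?_)
    push_cast; ring

/-- Distinguishability is kept through the induction in place of a norm bound, because the
Bhattacharyya coefficient multiplies under repetition and the distance does not. -/
theorem distinguishable_powerPair {Φ : Fin 2 → (QOp k →ₗ[ℂ] QOp l)} {β : ℝ}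
    (h : Distinguishable Φ β) (r : ℕ) : Distinguishable (powerPair Φ r) (β ^ r) := by
  induction r with
  | zero =>
    refine ⟨Unit, Unit, inferInstance, inferInstance, inferInstance, fun _ => 1, fun _ => 1,
      fun _ _ => 1, ?_, ?_, ?_, ?_, ?_, ?_, ?_⟩
    · refine (pow_left_inj₀ (vnorm_nonneg _) zero_le_one two_ne_zero).1 ?_
      rw [vnorm_sq]
      simp
    · exact fun _ => PosSemidef.one
    · simp
    · intro c x
      rw [Matrix.one_mul, IsChan.trace_tensorId (Φ := powerPair Φ 0 c) isChan_id, trace_vecMulVec]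
      simp [dotProduct]
    · simp
    · simp
    · simp
  | succ r ih =>
    rw [pow_succ]
    exact ih.tensE h

/-- The pair of channels obtained by taking parities, then tensor powers, then parities. -/
def polarizedPair (Φ : Fin 2 → (QOp k →ₗ[ℂ] QOp l)) (r K s : ℕ) :=
  parityPair (powerPair (parityPair Φ r) K) s

/-- The distance passes from `2β` to `2β^r` by parity, to at most `2Kβ^r` by repetition, and to
`2(Kβ^r)^s` by the last parity. -/
theorem diamondNorm_polarizedPair_le {Φ : Fin 2 → (QOp k →ₗ[ℂ] QOp l)} (h : ∀ c, IsChan (Φ c))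
    {β : ℝ} (hd : diamondNorm (Φ 0 - Φ 1) ≤ 2 * β) (r K s : ℕ) :
    diamondNorm (polarizedPair Φ r K s 0 - polarizedPair Φ r K s 1) ≤ 2 * (K * β ^ r) ^ s := by
  rw [polarizedPair, diamondNorm_parityPair_sub]
  have h0 := diamondNorm_nonneg (Φ 0 - Φ 1)
  have h1 : diamondNorm (powerPair (parityPair Φ r) K 0 - powerPair (parityPair Φ r) K 1) ≤
      K * (2 * β ^ r) := by
    refine (diamondNorm_le_of_dBound (mul_nonneg (Nat.cast_nonneg K) (diamondNorm_nonneg _))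
      (dBound_powerPair_sub (isChan_parityPair h r) K)).trans ?_
    rw [diamondNorm_parityPair_sub]
    refine mul_le_mul_of_nonneg_left ?_ (Nat.cast_nonneg K)
    exact mul_le_mul_of_nonneg_left (pow_le_pow_left₀ (by linarith) (by linarith) r) zero_le_two
  have h2 := diamondNorm_nonneg
    (powerPair (parityPair Φ r) K 0 - powerPair (parityPair Φ r) K 1)
  refine mul_le_mul_of_nonneg_left (pow_le_pow_left₀ (by linarith) (by linarith) s) zero_le_two

/-- The hypothesis `hB` keeps the base of the last power nonnegative; `r ≠ 0` keeps the inequality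
for the first parity strict, as `distinguishable_of_lt` requires. -/
theorem le_diamondNorm_polarizedPair {Φ : Fin 2 → (QOp k →ₗ[ℂ] QOp l)} (h : ∀ c, IsChan (Φ c))
    {α : ℝ} (hα : 0 ≤ α) (hd : 2 * α < diamondNorm (Φ 0 - Φ 1)) {r : ℕ} (hr : r ≠ 0) (K s : ℕ)
    (hB : Real.sqrt (1 - (α ^ r) ^ 2) ^ K ≤ 1) :
    2 * (1 - Real.sqrt (1 - (α ^ r) ^ 2) ^ K) ^ s ≤
      diamondNorm (polarizedPair Φ r K s 0 - polarizedPair Φ r K s 1) := by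
  rw [polarizedPair, diamondNorm_parityPair_sub]
  have h1 : 2 * α ^ r < diamondNorm (parityPair Φ r 0 - parityPair Φ r 1) := by
    rw [diamondNorm_parityPair_sub]
    exact mul_lt_mul_of_pos_left (pow_lt_pow_left₀ (by linarith) hα hr) two_pos
  have h2 := distinguishable_of_lt (isChan_parityPair h r) (by positivity) h1
  rw [mul_div_cancel_left₀ _ (two_ne_zero)] at h2
  have h3 := (distinguishable_powerPair h2 K).le_diamondNorm
  exact mul_le_mul_of_nonneg_left (pow_le_pow_left₀ (by linarith) (by linarith) s) zero_le_two

end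

section

/-! ### The choice of parameters -/

theorem sqrt_one_sub_pow_le {x : ℝ} (K : ℕ) :
    Real.sqrt (1 - x) ^ K ≤ Real.exp (-(K * x / 2)) := by
  have h : Real.sqrt (1 - x) ≤ Real.exp (-(x / 2)) := by
    refine Real.sqrt_le_iff.2 ⟨(Real.exp_pos _).le, ?_⟩
    rw [← Real.exp_nat_mul]
    have := Real.add_one_le_exp (-x)
    have e : ((2 : ℕ) : ℝ) * -(x / 2) = -x := by push_cast; ring
    rw [e]; linarith
  refine (pow_le_pow_left₀ (Real.sqrt_nonneg _) h K).trans (le_of_eq ?_)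
  rw [← Real.exp_nat_mul]
  congr 1; ring

/-- With `L` the number of binary digits of `n + 1`, take `r = c L` and `K = M ^ L`. Then `K β^r =
(M β^c)^L` and `K α^(2r) = (M α^(2c))^L`, so it suffices to choose the constants `c`, `M` with `M
β^c ≤ 1/4` and `M α^(2c) ≥ 8`. As `L` is logarithmic in `n`, the number `K` stays polynomial in `n`.
-/
theorem exists_polarization_parameters {a b : ℝ} (ha : 0 < a) (ha2 : a < 2) (hb : 0 < b)
    (hab : 2 * b < a ^ 2) :
    ∃ c M : ℕ, c ≠ 0 ∧ ∀ (k l : ℕ) (Φ : Fin 2 → (QOp k →ₗ[ℂ] QOp l)), (∀ i, IsChan (Φ i)) →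
      ∀ n : ℕ,
        (diamondNorm (Φ 0 - Φ 1) ≤ b →
          diamondNorm (polarizedPair Φ (c * (n + 1).size) (M ^ (n + 1).size) (n + 1) 0 -
            polarizedPair Φ (c * (n + 1).size) (M ^ (n + 1).size) (n + 1) 1) < (1 / 2 : ℝ) ^ n) ∧
        (a ≤ diamondNorm (Φ 0 - Φ 1) →
          2 - (1 / 2 : ℝ) ^ n <
            diamondNorm (polarizedPair Φ (c * (n + 1).size) (M ^ (n + 1).size) (n + 1) 0 -
            polarizedPair Φ (c * (n + 1).size) (M ^ (n + 1).size) (n + 1) 1)) := by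
  -- Strictly below `a / 2`, so that `a ≤ d` gives the strict bound needed for distinguishability,
  -- and still with `b / 2 < α²`.
  obtain ⟨α, hα1, hα2⟩ : ∃ α, Real.sqrt (b / 2) < α ∧ α < a / 2 :=
    exists_between ((Real.sqrt_lt' (by linarith)).2 (by nlinarith))
  have hα0 : 0 < α := (Real.sqrt_nonneg _).trans_lt hα1
  have hαβ : b / 2 < α ^ 2 := (Real.sqrt_lt' hα0).1 hα1
  set β := b / 2 with hβ
  have hβ0 : 0 < β := by positivity
  have hlam : 1 < α ^ 2 / β := (one_lt_div hβ0).2 hαβ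
  -- `36 = 4 * 9`: rounding `8 / A` up costs at most `1 ≤ 1 / A`, so that `M ≤ 9 / A`, and `M β^c ≤
  -- 1/4` is wanted.
  obtain ⟨c, hc⟩ := pow_unbounded_of_one_lt 36 hlam
  have hc0 : c ≠ 0 := by rintro rfl; norm_num at hc
  set A := (α ^ 2) ^ c with hA
  have hA0 : 0 < A := by positivity
  obtain ⟨M, hM1, hM2⟩ : ∃ M : ℕ, 8 ≤ M * A ∧ M * β ^ c ≤ 1 / 4 := by
    have hA1 : A ≤ 1 := pow_le_one₀ (by positivity) (pow_le_one₀ hα0.le (by linarith))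
    refine ⟨⌈8 / A⌉₊, ?_, ?_⟩
    · have := Nat.le_ceil (8 / A)
      rwa [div_le_iff₀ hA0] at this
    · have h1 : (⌈8 / A⌉₊ : ℝ) ≤ 9 / A := by
        refine (Nat.ceil_lt_add_one (by positivity)).le.trans ?_
        have : 1 ≤ 1 / A := (one_le_div hA0).2 hA1
        have e : 9 / A = 8 / A + 1 / A := by ring
        linarith
      rw [div_pow, lt_div_iff₀ (by positivity)] at hc
      have h2 : 0 < β ^ c := by positivity
      calc (⌈8 / A⌉₊ : ℝ) * β ^ c ≤ 9 / A * β ^ c := mul_le_mul_of_nonneg_right h1 h2.le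
        _ ≤ 1 / 4 := by
          rw [div_mul_eq_mul_div, div_le_iff₀ hA0]; linarith
  refine ⟨c, M, hc0, fun k l Φ hΦ n => ?_⟩
  set L := (n + 1).size with hL
  have hL0 : L ≠ 0 := by
    rw [hL, ne_eq, Nat.size_eq_zero]; omega
  have hLn : n + 2 ≤ 2 ^ L := Nat.lt_size_self (n + 1)
  constructor
  · intro hd
    have hd' : diamondNorm (Φ 0 - Φ 1) ≤ 2 * β := by rw [hβ]; linarith
    refine (diamondNorm_polarizedPair_le hΦ hd' (c * L) (M ^ L) (n + 1)).trans_lt ?_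
    have e : ((M ^ L : ℕ) : ℝ) * β ^ (c * L) = (M * β ^ c) ^ L := by
      rw [Nat.cast_pow, mul_pow, pow_mul]
    have h0 : 0 ≤ M * β ^ c := by positivity
    have h1 : (M * β ^ c) ^ L ≤ 1 / 4 :=
      (pow_le_of_le_one h0 (by linarith) hL0).trans hM2
    rw [e]
    -- The resulting bound `2 * 4^(-(n+1)) = 4^(-n) / 2` is below `2^(-n)`.
    have h2 : ((M * β ^ c) ^ L) ^ (n + 1) ≤ (1 / 4 : ℝ) ^ (n + 1) :=
      pow_le_pow_left₀ (by positivity) h1 _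
    have h3 : (1 / 4 : ℝ) ^ (n + 1) = 1 / 4 * ((1 / 2) ^ n * (1 / 2) ^ n) := by
      rw [← mul_pow, pow_succ]; norm_num; ring
    have h4 : (1 / 2 : ℝ) ^ n ≤ 1 := pow_le_one₀ (by norm_num) (by norm_num)
    have h5 : 0 < (1 / 2 : ℝ) ^ n := by positivity
    nlinarith
  · intro hd
    have e : ((M ^ L : ℕ) : ℝ) * (α ^ (c * L)) ^ 2 = (M * A) ^ L := by
      rw [Nat.cast_pow, mul_pow, hA]
      congr 1
      rw [← pow_mul, ← pow_mul, ← pow_mul]; ring_nf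
    -- `8^L = 4^L * 2^L` with `4^L ≥ 4` and `2^L ≥ n + 2`. Half of this is the exponent `2 (n + 2)`
    -- in the bound for the Bhattacharyya coefficient, and `e^(-2) ≤ 1/4`.
    have h1 : (4 * (n + 2) : ℝ) ≤ (M * A) ^ L := by
      have h2 : (8 : ℝ) ^ L ≤ (M * A) ^ L := pow_le_pow_left₀ (by norm_num) hM1 L
      have h3 : (8 : ℝ) ^ L = 4 ^ L * 2 ^ L := by rw [← mul_pow]; norm_num
      have h4 : (4 : ℝ) ≤ 4 ^ L := le_self_pow₀ (by norm_num) hL0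
      have h5 : (n + 2 : ℝ) ≤ 2 ^ L := by exact_mod_cast hLn
      rw [h3] at h2
      refine le_trans ?_ h2
      exact mul_le_mul h4 h5 (by positivity) (by positivity)
    have hB : Real.sqrt (1 - (α ^ (c * L)) ^ 2) ^ (M ^ L) ≤ (1 / 4 : ℝ) ^ (n + 2) := by
      refine (sqrt_one_sub_pow_le _).trans ?_
      rw [e]
      have h2 : Real.exp (-2) ≤ 1 / 4 := by
        have h3 := Real.add_one_le_exp (1 : ℝ)
        have h4 : Real.exp 2 = Real.exp 1 * Real.exp 1 := by rw [← Real.exp_add]; norm_num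
        rw [Real.exp_neg, ← one_div]
        refine one_div_le_one_div_of_le (by norm_num) ?_
        rw [h4]; nlinarith
      calc Real.exp (-((M * A) ^ L / 2)) ≤ Real.exp (((n + 2 : ℕ) : ℝ) * (-2)) := by
            refine Real.exp_le_exp.2 ?_
            push_cast; linarith
        _ = Real.exp (-2) ^ (n + 2) := Real.exp_nat_mul _ _
        _ ≤ (1 / 4) ^ (n + 2) := pow_le_pow_left₀ (Real.exp_pos _).le h2 _
    have hB1 : (1 / 4 : ℝ) ^ (n + 2) ≤ 1 := pow_le_one₀ (by norm_num) (by norm_num)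
    refine lt_of_lt_of_le ?_ (le_diamondNorm_polarizedPair hΦ hα0.le (by linarith)
      (mul_ne_zero hc0 hL0) (M ^ L) (n + 1) (hB.trans hB1))
    set δ := Real.sqrt (1 - (α ^ (c * L)) ^ 2) ^ (M ^ L)
    -- Bernoulli's inequality: the loss is at most `2 (n + 1) δ ≤ 2 * 2^n * 4^(-(n+2)) = 2^(-n) /
    -- 8`.
    have h2 := one_add_mul_le_pow (a := -δ) (by linarith) (n + 1)
    have h3 : (1 / 4 : ℝ) ^ (n + 2) = 1 / 16 * ((1 / 2) ^ n * (1 / 2) ^ n) := by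
      rw [← mul_pow, pow_add]; norm_num; ring
    have h4 : ((n + 1 : ℕ) : ℝ) ≤ 2 ^ n := by exact_mod_cast Nat.lt_two_pow_self
    have h5 : (2 : ℝ) ^ n * (1 / 2) ^ n = 1 := by rw [← mul_pow]; norm_num
    have h6 : 0 < (1 / 2 : ℝ) ^ n := by positivity
    have h7 : ((n + 1 : ℕ) : ℝ) * δ ≤ 1 / 16 * (1 / 2) ^ n := by
      calc ((n + 1 : ℕ) : ℝ) * δ ≤ ((n + 1 : ℕ) : ℝ) * (1 / 16 * ((1 / 2) ^ n * (1 / 2) ^ n)) := by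
            rw [← h3]; exact mul_le_mul_of_nonneg_left hB (Nat.cast_nonneg _)
        _ ≤ 2 ^ n * (1 / 16 * ((1 / 2) ^ n * (1 / 2) ^ n)) :=
            mul_le_mul_of_nonneg_right h4 (by positivity)
        _ = 1 / 16 * (1 / 2) ^ n * (2 ^ n * (1 / 2) ^ n) := by ring
        _ = 1 / 16 * (1 / 2) ^ n := by rw [h5, mul_one]
    have e2 : 1 - δ = 1 + -δ := by ring
    rw [e2]
    nlinarith

end

section

open Matrix
open scoped ComplexOrder Kronecker MatrixOrder

/-! ### Circuits implement channels -/

section Gates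

variable {n : ℕ}

/-- Bit strings agreeing with `x` away from `i` are determined by their bit at `i`. This reduces
matrix products of one-qubit operators to sums over bits. -/
theorem sum_agree_off {β : Type*} [AddCommMonoid β] (i : Fin n) (x : Fin n → Fin 2)
    (f : (Fin n → Fin 2) → β) :
    (∑ z, if ∀ m, m ≠ i → x m = z m then f z else 0) = ∑ c, f (Function.update x i c) := by
  rw [← Finset.sum_filter]
  symm
  refine Finset.sum_bij' (fun c _ => Function.update x i c) (fun z _ => z i) ?_ ?_ ?_ ?_ ?_
  · intro c _
    simp only [Finset.mem_filter, Finset.mem_univ, true_and]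
    intro m hm
    rw [Function.update_of_ne hm]
  · intro z _; exact Finset.mem_univ _
  · intro c _; simp
  · intro z hz
    simp only [Finset.mem_filter, Finset.mem_univ, true_and] at hz
    ext m
    by_cases hm : m = i
    · subst hm; simp
    · rw [Function.update_of_ne hm, hz m hm]
  · intro c _; rfl

theorem sum_sum_update {β : Type*} [AddCommMonoid β] (i : Fin n) (f : (Fin n → Fin 2) → β) :
    ∑ x, ∑ c, f (Function.update x i c) = ∑ x, (f x + f x) := by
  simp only [← sum_agree_off]
  rw [Finset.sum_comm]
  refine Finset.sum_congr rfl fun z _ => ?_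
  have h : ∀ x : Fin n → Fin 2, (if ∀ m, m ≠ i → x m = z m then f z else 0) =
      if ∀ m, m ≠ i → z m = x m then f z else 0 := fun x => by
    simp only [eq_comm]
  simp only [h]
  rw [sum_agree_off i z fun _ => f z, Fin.sum_univ_two]

theorem conjBy_onQubit_apply (U : Matrix (Fin 2) (Fin 2) ℂ) (i : Fin n) (ρ : QOp n)
    (x y : Fin n → Fin 2) :
    conjBy (onQubit U i) ρ x y = ∑ a, ∑ b, U (x i) a * star (U (y i) b) *
      ρ (Function.update x i a) (Function.update y i b) := by
  simp only [conjBy, LinearMap.coe_mk, AddHom.coe_mk, Matrix.mul_apply, onQubit, Matrix.of_apply,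
    conjTranspose_apply, ite_mul, zero_mul]
  have h1 : ∀ w z : Fin n → Fin 2, (if ∀ m, m ≠ i → x m = z m then U (x i) (z i) * ρ z w else 0) =
      if ∀ m, m ≠ i → x m = z m then (fun z => U (x i) (z i) * ρ z w) z else 0 := fun _ _ => rfl
  simp only [h1]
  simp only [sum_agree_off i x]
  have h2 : ∀ w : Fin n → Fin 2, (∑ c, U (x i) (Function.update x i c i) *
      ρ (Function.update x i c) w) * star (if ∀ m, m ≠ i → y m = w m then U (y i) (w i) else 0) =
      if ∀ m, m ≠ i → y m = w m then (fun w => (∑ c, U (x i) (Function.update x i c i) *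
      ρ (Function.update x i c) w) * star (U (y i) (w i))) w else 0 := fun w => by
    split_ifs <;> simp
  simp only [h2]
  rw [sum_agree_off i y fun w => (∑ c, U (x i) (Function.update x i c i) *
      ρ (Function.update x i c) w) * star (U (y i) (w i))]
  simp only [Function.update_self, Finset.sum_mul]
  rw [Finset.sum_comm]
  refine Finset.sum_congr rfl fun a _ => Finset.sum_congr rfl fun b _ => by ring

theorem onQubit_isometry {U : Matrix (Fin 2) (Fin 2) ℂ} (hU : Uᴴ * U = 1) (i : Fin n) :
    (onQubit U i)ᴴ * onQubit U i = 1 := by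
  ext x y
  have h1 : ∀ z : Fin n → Fin 2, (onQubit U i)ᴴ x z * onQubit U i z y =
      if ∀ m, m ≠ i → x m = z m then
        (fun z => if ∀ m, m ≠ i → z m = y m then star (U (z i) (x i)) * U (z i) (y i) else 0) z
      else 0 := fun z => by
    have : (∀ m, m ≠ i → z m = x m) ↔ ∀ m, m ≠ i → x m = z m := by simp only [eq_comm]
    simp only [onQubit, conjTranspose_apply, Matrix.of_apply, this]
    split_ifs <;> simp
  rw [Matrix.mul_apply]
  simp only [h1]
  rw [sum_agree_off i x fun z => if ∀ m, m ≠ i → z m = y m then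
    star (U (z i) (x i)) * U (z i) (y i) else 0]
  have h2 : ∀ c, (∀ m, m ≠ i → Function.update x i c m = y m) ↔ ∀ m, m ≠ i → x m = y m := fun c =>
    forall_congr' fun m => imp_congr_right fun hm => by rw [Function.update_of_ne hm]
  simp only [h2, Function.update_self]
  have h3 := congrFun (congrFun hU (x i)) (y i)
  rw [Matrix.mul_apply] at h3
  simp only [conjTranspose_apply] at h3
  by_cases hxy : ∀ m, m ≠ i → x m = y m
  · simp only [if_pos hxy]
    rw [h3, Matrix.one_apply, Matrix.one_apply]
    by_cases hi : x i = y i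
    · have : x = y := funext fun m => by
        by_cases hm : m = i
        · rw [hm, hi]
        · exact hxy m hm
      rw [if_pos hi, if_pos this]
    · have : x ≠ y := fun h => hi (by rw [h])
      rw [if_neg hi, if_neg this]
  · simp only [if_neg hxy, Finset.sum_const_zero]
    rw [Matrix.one_apply_ne]
    rintro rfl
    exact hxy fun _ _ => rfl

/-- The exchange of the values at two places. -/
def swapVec (i j : Fin n) (x : Fin n → Fin 2) : Fin n → Fin 2 :=
  Function.update (Function.update x i (x j)) j (x i)

/-- The addition of the value at place `i` to that at place `j`. -/
def cnotVec (i j : Fin n) (x : Fin n → Fin 2) : Fin n → Fin 2 :=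
  Function.update x j (x i + x j)

/-- Swap and controlled-not permute basis vectors, so conjugation by them only relabels matrix
entries. -/
theorem conjBy_of_perm {U : QOp n} {f : (Fin n → Fin 2) → (Fin n → Fin 2)}
    (h : ∀ x y, U x y = if y = f x then 1 else 0) (ρ : QOp n) (x y : Fin n → Fin 2) :
    conjBy U ρ x y = ρ (f x) (f y) := by
  simp only [conjBy, LinearMap.coe_mk, AddHom.coe_mk, Matrix.mul_apply, conjTranspose_apply, h]
  simp

theorem fin_two_add_self (a : Fin 2) : a + a = 0 := by fin_cases a <;> rfl

theorem onQubits_matSwap_apply {i j : Fin n} (hij : i ≠ j) (x y : Fin n → Fin 2) :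
    onQubits matSwap i j x y = if y = swapVec i j x then 1 else 0 := by
  simp only [onQubits, matSwap, Matrix.of_apply, Prod.mk.injEq]
  rw [← ite_and]
  congr 1
  rw [eq_iff_iff]
  constructor
  · rintro ⟨h, h1, h2⟩
    ext m
    by_cases hj : m = j
    · subst hj; simp [swapVec, h1]
    · by_cases hi : m = i
      · subst hi; simp [swapVec, hij, h2]
      · simp [swapVec, hj, hi, h m hi hj]
  · rintro rfl
    refine ⟨fun m hi hj => ?_, ?_, ?_⟩
    · simp [swapVec, hi, hj]
    · simp [swapVec]
    · simp [swapVec, hij]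

theorem onQubits_matCNOT_apply {i j : Fin n} (hij : i ≠ j) (x y : Fin n → Fin 2) :
    onQubits matCNOT i j x y = if y = cnotVec i j x then 1 else 0 := by
  simp only [onQubits, matCNOT, Matrix.of_apply, Prod.mk.injEq]
  rw [← ite_and]
  congr 1
  rw [eq_iff_iff]
  constructor
  · rintro ⟨h, h1, h2⟩
    ext m
    by_cases hj : m = j
    · subst hj; simp [cnotVec, h1, h2, ← add_assoc, fin_two_add_self]
    · by_cases hi : m = i
      · subst hi; simp [cnotVec, hij, h1]
      · simp [cnotVec, hj, h m hi hj]
  · rintro rfl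
    refine ⟨fun m hi hj => ?_, ?_, ?_⟩
    · simp [cnotVec, hj]
    · simp [cnotVec, hij]
    · simp [cnotVec, hij, ← add_assoc, fin_two_add_self]

theorem swapVec_swapVec {i j : Fin n} (hij : i ≠ j) (x : Fin n → Fin 2) :
    swapVec i j (swapVec i j x) = x := by
  ext m
  by_cases hj : m = j
  · subst hj; simp [swapVec, hij]
  · by_cases hi : m = i
    · subst hi; simp [swapVec, hij]
    · simp [swapVec, hj, hi]

theorem cnotVec_cnotVec {i j : Fin n} (hij : i ≠ j) (x : Fin n → Fin 2) :
    cnotVec i j (cnotVec i j x) = x := by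
  ext m
  by_cases hj : m = j
  · subst hj; simp [cnotVec, hij, ← add_assoc, fin_two_add_self]
  · simp [cnotVec, hj]

end Gates

/-! ### Every gate is a quantum channel -/

section Channel

variable {n m : ℕ}

theorem isChan_conjBy {U : QOp n} (hU : Uᴴ * U = 1) : IsChan (conjBy U) where
  pos κ _ _ X hX := by
    have e : tensorId κ (conjBy U) X = (U ⊗ₖ (1 : Matrix κ κ ℂ)) * X * (U ⊗ₖ (1 : Matrix κ κ ℂ))ᴴ := by
      have h1 : ∀ p r, ((U ⊗ₖ (1 : Matrix κ κ ℂ)) * X) p r = ∑ z, U p.1 z * X (z, p.2) r := by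
        intro p r
        simp [Matrix.mul_apply, Fintype.sum_prod_type, Matrix.one_apply]
      ext p q
      rw [Matrix.mul_apply, Fintype.sum_prod_type]
      simp only [h1, conjTranspose_apply, kroneckerMap_apply, Matrix.one_apply, tensorId,
        Matrix.of_apply, conjBy, LinearMap.coe_mk, AddHom.coe_mk, Matrix.mul_apply]
      simp [apply_ite (starRingEnd ℂ)]
    rw [e]
    exact hX.mul_mul_conjTranspose_same _
  tr X := by
    change (U * X * Uᴴ).trace = _
    rw [trace_mul_comm, ← Matrix.mul_assoc, hU, Matrix.one_mul]

theorem isChan_of_perm {Φ : QOp n →ₗ[ℂ] QOp n} {f : (Fin n → Fin 2) → (Fin n → Fin 2)}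
    (hf : ∀ x, f (f x) = x) (h : ∀ ρ x y, Φ ρ x y = ρ (f x) (f y)) : IsChan Φ where
  pos κ _ _ X hX := by
    have e : tensorId κ Φ X = X.submatrix (fun p => (f p.1, p.2)) fun p => (f p.1, p.2) := by
      ext p q
      simp [tensorId, h]
    rw [e]
    exact hX.submatrix _
  tr X := by
    simp only [Matrix.trace, Matrix.diag_apply, h]
    exact Equiv.sum_comp (Function.Involutive.toPerm f hf) fun x => X x x

theorem isChan_dephaseAt (i : Fin n) : IsChan (dephaseAt i) where
  pos κ _ _ X hX := by
    have e : tensorId κ (dephaseAt i) X = ∑ d : Fin 2, Matrix.of fun p q : (Fin n → Fin 2) × κ =>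
        if p.1 i = d ∧ q.1 i = d then X p q else 0 := by
      ext p q
      simp only [tensorId, dephaseAt, LinearMap.coe_mk, AddHom.coe_mk, Matrix.of_apply,
        Matrix.sum_apply, ite_and]
      rw [Finset.sum_ite_eq]
      simp [eq_comm]
    rw [e]
    exact posSemidef_sum _ fun d _ => posSemidef_mask hX (fun p => p) fun p => p.1 i = d
  tr X := by simp [Matrix.trace, dephaseAt]

theorem isChan_depolarizeAt (i : Fin n) : IsChan (depolarizeAt i) where
  pos κ _ _ X hX := by
    -- Here `c` is the discarded value of the qubit and `d` the freshly prepared random one.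
    have e : tensorId κ (depolarizeAt i) X = (1 / 2 : ℝ) • ∑ d : Fin 2, ∑ c : Fin 2,
        Matrix.of fun p q : (Fin n → Fin 2) × κ => if p.1 i = d ∧ q.1 i = d then
          X (Function.update p.1 i c, p.2) (Function.update q.1 i c, q.2) else 0 := by
      ext p q
      simp only [tensorId, depolarizeAt, LinearMap.coe_mk, AddHom.coe_mk, Matrix.of_apply,
        Matrix.sum_apply, Matrix.smul_apply, ite_and]
      rw [Finset.sum_comm]
      simp only [Finset.sum_ite_eq, Finset.mem_univ, if_true]
      by_cases h : p.1 i = q.1 i <;> simp [h, eq_comm, mul_add]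
    rw [e]
    exact (posSemidef_sum _ fun d _ => posSemidef_sum _ fun c _ => posSemidef_mask hX
      (fun p : (Fin n → Fin 2) × κ => (Function.update p.1 i c, p.2)) fun p => p.1 i = d).smul (by norm_num)
  tr X := by
    simp only [Matrix.trace, Matrix.diag_apply, depolarizeAt, LinearMap.coe_mk, AddHom.coe_mk,
      Matrix.of_apply, if_true]
    rw [← Finset.mul_sum, sum_sum_update i fun x => X x x, Finset.sum_add_distrib]
    ring

theorem isChan_ancillaAt (i : Fin (n + 1)) : IsChan (ancillaAt i) where
  pos κ _ _ X hX := posSemidef_mask hX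
    (fun p : (Fin (n + 1) → Fin 2) × κ => (i.removeNth p.1, p.2)) fun p => p.1 i = 0
  tr X := by
    simp only [Matrix.trace, Matrix.diag_apply, ancillaAt, LinearMap.coe_mk, AddHom.coe_mk,
      Matrix.of_apply, and_self]
    rw [← Equiv.sum_comp (Fin.insertNthEquiv (fun _ => Fin 2) i), Fintype.sum_prod_type]
    simp [Fin.insertNthEquiv]

theorem isChan_traceAt (i : Fin (n + 1)) : IsChan (traceAt i) where
  pos κ _ _ X hX := by
    have e : tensorId κ (traceAt i) X = ∑ c : Fin 2, X.submatrix
        (fun p => (i.insertNth (α := fun _ => Fin 2) c p.1, p.2))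
        fun p => (i.insertNth (α := fun _ => Fin 2) c p.1, p.2) := by
      ext p q
      simp [tensorId, traceAt]
    rw [e]
    exact posSemidef_sum _ fun c _ => hX.submatrix _
  tr X := by
    simp only [Matrix.trace, Matrix.diag_apply, traceAt, LinearMap.coe_mk, AddHom.coe_mk,
      Matrix.of_apply]
    rw [← Equiv.sum_comp (Fin.insertNthEquiv (fun _ => Fin 2) i), Fintype.sum_prod_type,
      Finset.sum_comm]
    rfl

theorem matH_isometry : matHᴴ * matH = 1 := by
  have h : ((Real.sqrt 2 : ℝ) : ℂ)⁻¹ * ((Real.sqrt 2 : ℝ) : ℂ)⁻¹ = 1 / 2 := by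
    rw [← mul_inv, ← Complex.ofReal_mul, Real.mul_self_sqrt (by norm_num)]; norm_num
  ext a b
  fin_cases a <;> fin_cases b <;>
    simp [matH, Matrix.mul_apply, Fin.sum_univ_two, h] <;> norm_num

theorem matT_isometry : matTᴴ * matT = 1 := by
  have h : ‖Complex.exp (Complex.I * (Real.pi : ℂ) / 4)‖ = 1 := by
    have : Complex.I * (Real.pi : ℂ) / 4 = ((Real.pi / 4 : ℝ) : ℂ) * Complex.I := by
      push_cast; ring
    rw [this, Complex.norm_exp_ofReal_mul_I]
  have h2 := Complex.normSq_eq_conj_mul_self (z := Complex.exp (Complex.I * (Real.pi : ℂ) / 4))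
  rw [Complex.normSq_eq_norm_sq, h] at h2
  ext a b
  fin_cases a <;> fin_cases b <;> simp [matT, Matrix.mul_apply, Fin.sum_univ_two]
  simpa using h2.symm

theorem isChan_gate (g : Gate n m) : IsChan g.channel := by
  cases g with
  | pauliX i =>
    refine isChan_conjBy (onQubit_isometry ?_ i)
    ext a b; fin_cases a <;> fin_cases b <;> simp [matX, Matrix.mul_apply, Fin.sum_univ_two]
  | pauliZ i =>
    refine isChan_conjBy (onQubit_isometry ?_ i)
    ext a b; fin_cases a <;> fin_cases b <;> simp [matZ, Matrix.mul_apply, Fin.sum_univ_two]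
  | hadamard i => exact isChan_conjBy (onQubit_isometry matH_isometry i)
  | phaseT i => exact isChan_conjBy (onQubit_isometry matT_isometry i)
  | swap i j hij =>
    exact isChan_of_perm (swapVec_swapVec hij) (conjBy_of_perm (onQubits_matSwap_apply hij))
  | cnot i j hij =>
    exact isChan_of_perm (cnotVec_cnotVec hij) (conjBy_of_perm (onQubits_matCNOT_apply hij))
  | measure i => exact isChan_dephaseAt i
  | dephase i => exact isChan_dephaseAt i
  | depolarize i => exact isChan_depolarizeAt i
  | ancilla i => exact isChan_ancillaAt i
  | traceOut i => exact isChan_traceAt i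

theorem isChan_circuit {n m : ℕ} (C : Circuit n m) : IsChan C.channel := by
  induction C with
  | nil => exact isChan_id
  | cons g C ih => exact ih.comp (isChan_gate g)

end Channel

end

section

/-! ### Untyped gates acting on matrices indexed by bit strings -/

/-- Matrices indexed by bit strings of arbitrary lengths. -/
abbrev LOp : Type := List (Fin 2) → List (Fin 2) → ℂ

/-- The restriction of a matrix to bit strings of length `n`. -/
def toQ (n : ℕ) (f : LOp) : QOp n := Matrix.of fun x y => f (List.ofFn x) (List.ofFn y)

/-- Gates whose wires are given by natural numbers. -/
inductive RGate : Type
  | pauliX (i : ℕ)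
  | pauliZ (i : ℕ)
  | hadamard (i : ℕ)
  | phaseT (i : ℕ)
  | swap (i j : ℕ)
  | cnot (i j : ℕ)
  | measure (i : ℕ)
  | dephase (i : ℕ)
  | depolarize (i : ℕ)
  | ancilla (i : ℕ)
  | traceOut (i : ℕ)

namespace RGate

def encode : RGate → List Sym
  | pauliX i => .pauliX :: unary i
  | pauliZ i => .pauliZ :: unary i
  | hadamard i => .hadamard :: unary i
  | phaseT i => .phaseT :: unary i
  | swap i j => .swap :: (unary i ++ unary j)
  | cnot i j => .cnot :: (unary i ++ unary j)
  | measure i => .measure :: unary i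
  | dephase i => .dephase :: unary i
  | depolarize i => .depolarize :: unary i
  | ancilla i => .ancilla :: unary i
  | traceOut i => .traceOut :: unary i

/-- The same gate on wires moved by `o`. -/
def shift (o : ℕ) : RGate → RGate
  | pauliX i => pauliX (o + i)
  | pauliZ i => pauliZ (o + i)
  | hadamard i => hadamard (o + i)
  | phaseT i => phaseT (o + i)
  | swap i j => swap (o + i) (o + j)
  | cnot i j => cnot (o + i) (o + j)
  | measure i => measure (o + i)
  | dephase i => dephase (o + i)
  | depolarize i => depolarize (o + i)
  | ancilla i => ancilla (o + i)
  | traceOut i => traceOut (o + i)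

/-- The gate can be applied when there are `n` wires, and leaves `m` wires. -/
def Ok : RGate → ℕ → ℕ → Prop
  | pauliX i, n, m | pauliZ i, n, m | hadamard i, n, m | phaseT i, n, m
  | measure i, n, m | dephase i, n, m | depolarize i, n, m => i < n ∧ m = n
  | swap i j, n, m | cnot i j, n, m => i < n ∧ j < n ∧ i ≠ j ∧ m = n
  | ancilla i, n, m => i ≤ n ∧ m = n + 1
  | traceOut i, n, m => i ≤ m ∧ n = m + 1

end RGate

/-- The action of the one-qubit operator `U` on qubit `i`. -/
def lOne (U : Matrix (Fin 2) (Fin 2) ℂ) (i : ℕ) (f : LOp) : LOp := fun x y =>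
  ∑ a, ∑ b, U (x.getD i 0) a * star (U (y.getD i 0) b) * f (x.set i a) (y.set i b)

def swapList (i j : ℕ) (x : List (Fin 2)) : List (Fin 2) :=
  (x.set i (x.getD j 0)).set j (x.getD i 0)

def cnotList (i j : ℕ) (x : List (Fin 2)) : List (Fin 2) :=
  x.set j (x.getD i 0 + x.getD j 0)

/-- The action of a gate on matrices indexed by bit strings. -/
def RGate.sem : RGate → LOp → LOp
  | .pauliX i, f => lOne matX i f
  | .pauliZ i, f => lOne matZ i f
  | .hadamard i, f => lOne matH i f
  | .phaseT i, f => lOne matT i f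
  | .swap i j, f => fun x y => f (swapList i j x) (swapList i j y)
  | .cnot i j, f => fun x y => f (cnotList i j x) (cnotList i j y)
  | .measure i, f | .dephase i, f => fun x y => if x.getD i 0 = y.getD i 0 then f x y else 0
  | .depolarize i, f => fun x y => if x.getD i 0 = y.getD i 0 then
      (1 / 2 : ℂ) * ∑ c : Fin 2, f (x.set i c) (y.set i c) else 0
  | .ancilla i, f => fun x y => if x.getD i 0 = 0 ∧ y.getD i 0 = 0 then
      f (x.eraseIdx i) (y.eraseIdx i) else 0
  | .traceOut i, f => fun x y => ∑ c : Fin 2, f (x.insertIdx i c) (y.insertIdx i c)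

/-- The action of a sequence of gates. -/
def semList : List RGate → LOp → LOp
  | [], f => f
  | g :: w, f => semList w (g.sem f)

/-- The description of a sequence of gates. -/
def encodeList (w : List RGate) : List Sym := w.flatMap RGate.encode

/-- A sequence of gates that can be applied to `n` wires and leaves `m` wires. -/
def Typed : List RGate → ℕ → ℕ → Prop
  | [], n, m => n = m
  | g :: w, n, m => ∃ k, g.Ok n k ∧ Typed w k m

theorem semList_append (w w' : List RGate) (f : LOp) :
    semList (w ++ w') f = semList w' (semList w f) := by
  induction w generalizing f with
  | nil => rfl
  | cons g w ih => exact ih _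

theorem encodeList_append (w w' : List RGate) :
    encodeList (w ++ w') = encodeList w ++ encodeList w' := by
  simp [encodeList]

theorem Typed.append {w w' : List RGate} {n m k : ℕ} (h : Typed w n m) (h' : Typed w' m k) :
    Typed (w ++ w') n k := by
  induction w generalizing n with
  | nil => cases h; exact h'
  | cons g w ih =>
    obtain ⟨k, hk, hw⟩ := h
    exact ⟨k, hk, ih hw⟩

theorem typed_singleton {g : RGate} {n m : ℕ} (h : g.Ok n m) : Typed [g] n m := ⟨m, h, rfl⟩

section ListLemmas

variable {n : ℕ}

theorem getD_ofFn (x : Fin n → Fin 2) (i : Fin n) : (List.ofFn x).getD i 0 = x i := by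
  simp [List.getD_eq_getElem?_getD]

theorem ofFn_update (x : Fin n → Fin 2) (i : Fin n) (a : Fin 2) :
    List.ofFn (Function.update x i a) = (List.ofFn x).set i a := by
  refine List.ext_getElem (by simp) fun j h1 h2 => ?_
  simp only [List.getElem_ofFn, List.getElem_set, Function.update_apply, Fin.ext_iff]
  simp only [eq_comm]

theorem ofFn_insertNth (x : Fin n → Fin 2) (i : Fin (n + 1)) (a : Fin 2) :
    List.ofFn (i.insertNth (α := fun _ => Fin 2) a x) = (List.ofFn x).insertIdx i a :=
  by
  refine List.ext_getElem (by simp [List.length_insertIdx, Nat.lt_succ_iff.1 i.2]) fun j h1 h2 => ?_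
  rw [List.getElem_ofFn]
  have hj : j < n + 1 := by simpa using h1
  rcases lt_trichotomy j i with h | h | h
  · rw [List.getElem_insertIdx_of_lt h, List.getElem_ofFn]
    have : (⟨j, hj⟩ : Fin (n + 1)) = i.succAbove ⟨j, by omega⟩ := by
      rw [Fin.succAbove_of_castSucc_lt _ _ (by simpa [Fin.lt_def] using h)]; rfl
    rw [this, Fin.insertNth_apply_succAbove]
  · subst h
    rw [List.getElem_insertIdx_self]
    exact Fin.insertNth_apply_same (α := fun _ => Fin 2) i a x
  · rw [List.getElem_insertIdx_of_gt h, List.getElem_ofFn]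
    have : (⟨j, hj⟩ : Fin (n + 1)) = i.succAbove ⟨j - 1, by omega⟩ := by
      rw [Fin.succAbove_of_le_castSucc _ _ (by simp [Fin.le_def]; omega)]
      ext; simp; omega
    rw [this, Fin.insertNth_apply_succAbove]

theorem ofFn_removeNth (x : Fin (n + 1) → Fin 2) (i : Fin (n + 1)) :
    List.ofFn (i.removeNth x) = (List.ofFn x).eraseIdx i := by
  refine List.ext_getElem (by simp [List.length_eraseIdx]; omega) fun j h1 h2 => ?_
  simp only [List.getElem_ofFn, List.getElem_eraseIdx, Fin.removeNth]
  have hj : j < n := by simpa using h1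
  split_ifs with h
  · rw [Fin.succAbove_of_castSucc_lt _ _ (by simpa [Fin.lt_def] using h)]; rfl
  · rw [Fin.succAbove_of_le_castSucc _ _ (by simpa [Fin.le_def] using h)]; rfl

end ListLemmas

/-- Forgetting the types of a gate. -/
def Gate.raw : {n m : ℕ} → Gate n m → RGate
  | _, _, .pauliX i => .pauliX i
  | _, _, .pauliZ i => .pauliZ i
  | _, _, .hadamard i => .hadamard i
  | _, _, .phaseT i => .phaseT i
  | _, _, .swap i j _ => .swap i j
  | _, _, .cnot i j _ => .cnot i j
  | _, _, .measure i => .measure i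
  | _, _, .dephase i => .dephase i
  | _, _, .depolarize i => .depolarize i
  | _, _, .ancilla i => .ancilla i
  | _, _, .traceOut i => .traceOut i

/-- Forgetting the types of a circuit. -/
def Circuit.raw : {n m : ℕ} → Circuit n m → List RGate
  | _, _, .nil => []
  | _, _, .cons g C => g.raw :: C.raw

theorem Gate.encode_raw {n m : ℕ} (g : Gate n m) : g.raw.encode = g.encode := by
  cases g <;> rfl

theorem Gate.ok_raw {n m : ℕ} (g : Gate n m) : g.raw.Ok n m := by
  cases g with
  | swap i j hij => exact ⟨i.2, j.2, fun h => hij (Fin.ext h), rfl⟩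
  | cnot i j hij => exact ⟨i.2, j.2, fun h => hij (Fin.ext h), rfl⟩
  | ancilla i => exact ⟨Nat.lt_succ_iff.1 i.2, rfl⟩
  | traceOut i => exact ⟨Nat.lt_succ_iff.1 i.2, rfl⟩
  | _ i => exact ⟨i.2, rfl⟩

theorem exists_gate {g : RGate} {n m : ℕ} (h : g.Ok n m) : ∃ g' : Gate n m, g'.raw = g := by
  cases g with
  | pauliX i => obtain ⟨hi, rfl⟩ := h; exact ⟨.pauliX ⟨i, hi⟩, rfl⟩
  | pauliZ i => obtain ⟨hi, rfl⟩ := h; exact ⟨.pauliZ ⟨i, hi⟩, rfl⟩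
  | hadamard i => obtain ⟨hi, rfl⟩ := h; exact ⟨.hadamard ⟨i, hi⟩, rfl⟩
  | phaseT i => obtain ⟨hi, rfl⟩ := h; exact ⟨.phaseT ⟨i, hi⟩, rfl⟩
  | measure i => obtain ⟨hi, rfl⟩ := h; exact ⟨.measure ⟨i, hi⟩, rfl⟩
  | dephase i => obtain ⟨hi, rfl⟩ := h; exact ⟨.dephase ⟨i, hi⟩, rfl⟩
  | depolarize i => obtain ⟨hi, rfl⟩ := h; exact ⟨.depolarize ⟨i, hi⟩, rfl⟩
  | swap i j =>
    obtain ⟨hi, hj, hij, rfl⟩ := h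
    exact ⟨.swap ⟨i, hi⟩ ⟨j, hj⟩ fun h => hij (Fin.ext_iff.1 h), rfl⟩
  | cnot i j =>
    obtain ⟨hi, hj, hij, rfl⟩ := h
    exact ⟨.cnot ⟨i, hi⟩ ⟨j, hj⟩ fun h => hij (Fin.ext_iff.1 h), rfl⟩
  | ancilla i => obtain ⟨hi, rfl⟩ := h; exact ⟨.ancilla ⟨i, Nat.lt_succ_iff.2 hi⟩, rfl⟩
  | traceOut i => obtain ⟨hi, rfl⟩ := h; exact ⟨.traceOut ⟨i, Nat.lt_succ_iff.2 hi⟩, rfl⟩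

theorem conjBy_onQubit_toQ {n : ℕ} (U : Matrix (Fin 2) (Fin 2) ℂ) (i : Fin n) (f : LOp) :
    conjBy (onQubit U i) (toQ n f) = toQ n (lOne U i f) := by
  ext x y
  rw [conjBy_onQubit_apply]
  simp only [toQ, Matrix.of_apply, lOne, getD_ofFn, ofFn_update]

theorem Gate.channel_toQ {n m : ℕ} (g : Gate n m) (f : LOp) :
    g.channel (toQ n f) = toQ m (g.raw.sem f) := by
  cases g with
  | pauliX i => exact conjBy_onQubit_toQ _ i f
  | pauliZ i => exact conjBy_onQubit_toQ _ i f
  | hadamard i => exact conjBy_onQubit_toQ _ i f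
  | phaseT i => exact conjBy_onQubit_toQ _ i f
  | swap i j hij =>
    ext x y
    rw [Gate.channel, conjBy_of_perm (onQubits_matSwap_apply hij)]
    simp only [toQ, Matrix.of_apply, swapVec, Gate.raw, RGate.sem, swapList, getD_ofFn, ofFn_update]
  | cnot i j hij =>
    ext x y
    rw [Gate.channel, conjBy_of_perm (onQubits_matCNOT_apply hij)]
    simp only [toQ, Matrix.of_apply, cnotVec, Gate.raw, RGate.sem, cnotList, getD_ofFn, ofFn_update]
  | measure i =>
    ext x y
    simp only [Gate.channel, dephaseAt, LinearMap.coe_mk, AddHom.coe_mk, toQ, Matrix.of_apply,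
      Gate.raw, RGate.sem, getD_ofFn]
  | dephase i =>
    ext x y
    simp only [Gate.channel, dephaseAt, LinearMap.coe_mk, AddHom.coe_mk, toQ, Matrix.of_apply,
      Gate.raw, RGate.sem, getD_ofFn]
  | depolarize i =>
    ext x y
    simp only [Gate.channel, depolarizeAt, LinearMap.coe_mk, AddHom.coe_mk, toQ, Matrix.of_apply,
      Gate.raw, RGate.sem, getD_ofFn, ofFn_update]
  | ancilla i =>
    ext x y
    simp only [Gate.channel, ancillaAt, LinearMap.coe_mk, AddHom.coe_mk, toQ, Matrix.of_apply,
      Gate.raw, RGate.sem, getD_ofFn, ofFn_removeNth]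
  | traceOut i =>
    ext x y
    simp only [Gate.channel, traceAt, LinearMap.coe_mk, AddHom.coe_mk, toQ, Matrix.of_apply,
      Gate.raw, RGate.sem, ofFn_insertNth]

theorem Circuit.encode_raw {n m : ℕ} (C : Circuit n m) :
    C.encodeGates = encodeList C.raw ++ [Sym.endMark] := by
  induction C with
  | nil => rfl
  | cons g C ih =>
    simp [Circuit.encodeGates, ih, Circuit.raw, encodeList, Gate.encode_raw]

theorem Circuit.typed_raw {n m : ℕ} (C : Circuit n m) : Typed C.raw n m := by
  induction C with
  | nil => rfl
  | cons g C ih => exact ⟨_, g.ok_raw, ih⟩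

/-- This bridge permits computing with untyped gates and lists, where concatenation and shifting of
circuits need no casts between numbers of wires. -/
theorem Circuit.channel_toQ {n m : ℕ} (C : Circuit n m) (f : LOp) :
    C.channel (toQ n f) = toQ m (semList C.raw f) := by
  induction C generalizing f with
  | nil => rfl
  | cons g C ih =>
    rw [Circuit.channel, LinearMap.comp_apply, Gate.channel_toQ, ih]
    rfl

theorem Typed.exists_circuit {w : List RGate} {n m : ℕ} (h : Typed w n m) :
    ∃ C : Circuit n m, C.raw = w := by
  induction w generalizing n with
  | nil => cases h; exact ⟨.nil, rfl⟩
  | cons g w ih =>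
    obtain ⟨k, hk, hw⟩ := h
    obtain ⟨C, rfl⟩ := ih hw
    obtain ⟨g', rfl⟩ := exists_gate hk
    exact ⟨.cons g' C, rfl⟩

/-! ### Moving gates to other wires -/

section Shift

variable {u x v : List (Fin 2)} {i : ℕ}

theorem getD_mid (hi : i < x.length) : (u ++ x ++ v).getD (u.length + i) 0 = x.getD i 0 := by
  rw [List.append_assoc]
  simp [List.getD_eq_getElem?_getD, List.getElem?_append_right, List.getElem?_append_left hi]

theorem set_mid (hi : i < x.length) (a : Fin 2) :
    (u ++ x ++ v).set (u.length + i) a = u ++ x.set i a ++ v := by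
  rw [List.append_assoc, List.set_append_right _ _ (Nat.le_add_right _ _), Nat.add_sub_cancel_left,
    List.set_append_left _ _ hi, List.append_assoc]

theorem eraseIdx_mid (hi : i < x.length) :
    (u ++ x ++ v).eraseIdx (u.length + i) = u ++ x.eraseIdx i ++ v := by
  rw [List.append_assoc, List.eraseIdx_append_of_length_le (Nat.le_add_right _ _),
    Nat.add_sub_cancel_left, List.eraseIdx_append_of_lt_length hi, List.append_assoc]

theorem insertIdx_mid (hi : i ≤ x.length) (a : Fin 2) :
    (u ++ x ++ v).insertIdx (u.length + i) a = u ++ x.insertIdx i a ++ v := by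
  induction u with
  | nil =>
    simp only [List.nil_append, List.length_nil, zero_add]
    induction x generalizing i with
    | nil =>
      have : i = 0 := by simpa using hi
      subst this; simp
    | cons b x ih =>
      cases i with
      | zero => simp
      | succ i => simpa using ih (by simpa using hi)
  | cons b u ih =>
    simp only [List.cons_append, List.length_cons, Nat.add_right_comm _ 1, List.insertIdx_succ_cons]
    rw [ih]

end Shift

theorem RGate.Ok.shift {g : RGate} {n m : ℕ} (h : g.Ok n m) (o r : ℕ) :
    (g.shift o).Ok (o + n + r) (o + m + r) := by
  cases g <;> simp only [RGate.Ok, RGate.shift] at h ⊢ <;> omega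

theorem Typed.shift {w : List RGate} {n m : ℕ} (h : Typed w n m) (o r : ℕ) :
    Typed (w.map (RGate.shift o)) (o + n + r) (o + m + r) := by
  induction w generalizing n with
  | nil => cases h; rfl
  | cons g w ih =>
    obtain ⟨k, hk, hw⟩ := h
    exact ⟨_, hk.shift o r, ih hw⟩

/-- The prefixes `u`, `u'` and the suffixes `v`, `v'` are spectators: a shifted gate acts on the
middle part with the outer bits as parameters. -/
theorem RGate.sem_shift {g : RGate} {n m : ℕ} (h : g.Ok n m) (f : LOp)
    {u u' x x' v v' : List (Fin 2)} {o : ℕ} (hu : u.length = o) (hu' : u'.length = o)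
    (hx : x.length = m) (hx' : x'.length = m) :
    (g.shift o).sem f (u ++ x ++ v) (u' ++ x' ++ v') =
      g.sem (fun a a' => f (u ++ a ++ v) (u' ++ a' ++ v')) x x' := by
  have G : ∀ {i}, i < m → (u ++ x ++ v).getD (o + i) 0 = x.getD i 0 :=
    fun hi => by rw [← hu]; exact getD_mid (by omega)
  have G' : ∀ {i}, i < m → (u' ++ x' ++ v').getD (o + i) 0 = x'.getD i 0 :=
    fun hi => by rw [← hu']; exact getD_mid (by omega)
  have S : ∀ {i} {z : List (Fin 2)} (a), i < m → z.length = m →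
      (u ++ z ++ v).set (o + i) a = u ++ z.set i a ++ v :=
    fun a hi hz => by rw [← hu]; exact set_mid (by omega) a
  have S' : ∀ {i} {z : List (Fin 2)} (a), i < m → z.length = m →
      (u' ++ z ++ v').set (o + i) a = u' ++ z.set i a ++ v' :=
    fun a hi hz => by rw [← hu']; exact set_mid (by omega) a
  cases g with
  | swap i j =>
    obtain ⟨hi, hj, -, rfl⟩ := h
    simp only [RGate.shift, RGate.sem, swapList, G hi, G hj, G' hi, G' hj]
    rw [S _ hi hx, S _ hj (by simpa using hx), S' _ hi hx', S' _ hj (by simpa using hx')]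
  | cnot i j =>
    obtain ⟨hi, hj, -, rfl⟩ := h
    simp only [RGate.shift, RGate.sem, cnotList, G hi, G hj, G' hi, G' hj]
    rw [S _ hj hx, S' _ hj hx']
  | ancilla i =>
    obtain ⟨hi, rfl⟩ := h
    simp only [RGate.shift, RGate.sem, G (Nat.lt_succ_of_le hi), G' (Nat.lt_succ_of_le hi)]
    have e := eraseIdx_mid (u := u) (x := x) (v := v) (i := i) (by omega)
    have e' := eraseIdx_mid (u := u') (x := x') (v := v') (i := i) (by omega)
    rw [hu] at e; rw [hu'] at e'
    rw [e, e']
  | traceOut i =>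
    obtain ⟨hi, rfl⟩ := h
    simp only [RGate.shift, RGate.sem]
    refine Finset.sum_congr rfl fun c _ => ?_
    have e := insertIdx_mid (u := u) (x := x) (v := v) (i := i) (by omega) c
    have e' := insertIdx_mid (u := u') (x := x') (v := v') (i := i) (by omega) c
    rw [hu] at e; rw [hu'] at e'
    rw [e, e']
  | _ i =>
    obtain ⟨hi, rfl⟩ := h
    simp only [RGate.shift, RGate.sem, lOne, G hi, G' hi, S _ hi hx, S' _ hi hx']

theorem semList_shift {w : List RGate} {n m : ℕ} (h : Typed w n m) (f : LOp)
    {u u' x x' v v' : List (Fin 2)} {o : ℕ} (hu : u.length = o) (hu' : u'.length = o)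
    (hx : x.length = m) (hx' : x'.length = m) :
    semList (w.map (RGate.shift o)) f (u ++ x ++ v) (u' ++ x' ++ v') =
      semList w (fun a a' => f (u ++ a ++ v) (u' ++ a' ++ v')) x x' := by
  induction w generalizing n f with
  | nil => rfl
  | cons g w ih =>
    obtain ⟨k, hk, hw⟩ := h
    rw [List.map_cons, semList, ih hw, semList]
    -- The shifted and the original gate agree only on strings of length `k`. Writing the rest as a
    -- typed circuit shows that its values at length `m` depend only on those strings, so the
    -- agreement `h3` suffices.
    obtain ⟨C, rfl⟩ := hw.exists_circuit
    have h1 := C.channel_toQ fun a a' => (g.shift o).sem f (u ++ a ++ v) (u' ++ a' ++ v')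
    have h2 := C.channel_toQ (g.sem fun a a' => f (u ++ a ++ v) (u' ++ a' ++ v'))
    have h3 : toQ k (fun a a' => (g.shift o).sem f (u ++ a ++ v) (u' ++ a' ++ v')) =
        toQ k (g.sem fun a a' => f (u ++ a ++ v) (u' ++ a' ++ v')) := by
      ext a a'
      exact RGate.sem_shift hk f hu hu' (by simp) (by simp)
    rw [h3, h2] at h1
    subst hx
    have hget : ∀ z : List (Fin 2), List.ofFn (fun i : Fin z.length => z[i]) = z := fun z => by simp
    obtain ⟨y, rfl⟩ : ∃ y : Fin x.length → Fin 2, x' = List.ofFn y :=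
      ⟨fun i => x'[i], by
        refine List.ext_getElem (by simp [hx']) fun j h1 h2 => by simp⟩
    have h4 := congrFun (congrFun h1 fun i => x[i]) y
    simp only [toQ, Matrix.of_apply] at h4
    rw [hget] at h4
    exact h4.symm

end

section

/-! ### The controlled swap -/

theorem set_getD_self (x : List (Fin 2)) (i : ℕ) : x.set i (x.getD i 0) = x := by
  refine List.ext_getElem (by simp) fun j h1 h2 => ?_
  rw [List.getElem_set]
  split_ifs with h
  · subst h
    simp [List.getD_eq_getElem?_getD, h2]
  · rfl

/-- The diagonal of the `π/8` gate. -/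
def tPhase (a : Fin 2) : ℂ := matT a a

theorem sem_phaseT (i : ℕ) (f : LOp) (x y : List (Fin 2)) :
    (RGate.phaseT i).sem f x y =
      tPhase (x.getD i 0) * star (tPhase (y.getD i 0)) * f x y := by
  have h : ∀ a b : Fin 2, matT a b = if b = a then tPhase a else 0 := by
    intro a b
    fin_cases a <;> fin_cases b <;> simp [matT, tPhase]
  simp only [RGate.sem, lOne, h]
  rw [Finset.sum_eq_single (x.getD i 0) (by simp +contextual) (by simp),
    Finset.sum_eq_single (y.getD i 0) (by simp +contextual) (by simp)]
  simp only [if_true, set_getD_self]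

theorem sem_pauliX (i : ℕ) (f : LOp) (x y : List (Fin 2)) :
    (RGate.pauliX i).sem f x y =
      f (x.set i (x.getD i 0 + 1)) (y.set i (y.getD i 0 + 1)) := by
  have h : ∀ a b : Fin 2, matX a b = if b = a + 1 then 1 else 0 := by
    intro a b
    fin_cases a <;> fin_cases b <;> simp [matX]
  simp only [RGate.sem, lOne, h]
  rw [Finset.sum_eq_single (x.getD i 0 + 1) (by simp +contextual) (by simp),
    Finset.sum_eq_single (y.getD i 0 + 1) (by simp +contextual) (by simp)]
  simp

/-- A family of bit strings whose entries `0`, `i`, `j` are free. -/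
structure Frame (i j : ℕ) (F : Fin 2 → Fin 2 → Fin 2 → List (Fin 2)) : Prop where
  get_zero : ∀ c a b, (F c a b).getD 0 0 = c
  get_fst : ∀ c a b, (F c a b).getD i 0 = a
  get_snd : ∀ c a b, (F c a b).getD j 0 = b
  set_fst : ∀ c a b d, (F c a b).set i d = F c d b
  set_snd : ∀ c a b d, (F c a b).set j d = F c a d

theorem frame_append (u v w : List (Fin 2)) :
    Frame (1 + u.length) (2 + u.length + v.length)
      fun c a b => c :: (u ++ a :: (v ++ b :: w)) := by
  constructor <;> intro c a b
  · rfl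
  · simpa [add_comm] using getD_mid (u := c :: u) (x := [a]) (v := v ++ b :: w) (i := 0) (by simp)
  · have := getD_mid (u := c :: (u ++ a :: v)) (x := [b]) (v := w) (i := 0) (by simp)
    simp only [List.cons_append, List.append_assoc, List.nil_append, List.length_cons,
      List.length_append] at this
    rw [← show u.length + (v.length + 1) + 1 + 0 = 2 + u.length + v.length by omega]
    simp
  · intro d
    simpa [add_comm] using set_mid (u := c :: u) (x := [a]) (v := v ++ b :: w) (i := 0) (by simp) d
  · intro d
    have := set_mid (u := c :: (u ++ a :: v)) (x := [b]) (v := w) (i := 0) (by simp) d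
    simp only [List.cons_append, List.append_assoc, List.nil_append, List.length_cons,
      List.length_append] at this
    rw [← show u.length + (v.length + 1) + 1 + 0 = 2 + u.length + v.length by omega]
    simp

/-- The doubly controlled `Z` gate on the wires `0`, `i`, `j`, up to a global phase. -/
def cczGates (i j : ℕ) : List RGate :=
  [.phaseT 0, .phaseT i, .phaseT j, .cnot 0 i, .pauliX i, .phaseT i, .pauliX i, .cnot i j,
    .phaseT j, .cnot 0 i, .cnot 0 j, .pauliX j, .phaseT j, .pauliX j, .cnot i j, .cnot 0 j,
    .pauliX j, .phaseT j, .pauliX j, .cnot 0 j]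

/-- The doubly controlled not gate with controls `0`, `i` and target `j`, up to a global phase. -/
def toffoliGates (i j : ℕ) : List RGate :=
  .hadamard j :: (cczGates i j ++ [.hadamard j])

/-- The swap gate on `i`, `j` controlled by `0`, up to a global phase. -/
def cswapGates (i j : ℕ) : List RGate :=
  .cnot j i :: (toffoliGates i j ++ [.cnot j i])

theorem typed_cswapGates {i j n : ℕ} (hi : 0 < i) (hij : i < j) (hj : j < n) :
    Typed (cswapGates i j) n n := by
  simp only [cswapGates, toffoliGates, cczGates, List.cons_append, List.nil_append, Typed,
    RGate.Ok]
  have : i < n := by omega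
  have : 0 < n := by omega
  have : i ≠ j := by omega
  have : 0 ≠ i := by omega
  have : 0 ≠ j := by omega
  simp_all [eq_comm]

/-- The phase of the doubly controlled `Z` gate. -/
def cczPhase (c a b : Fin 2) : ℂ := if c = 1 ∧ a = 1 ∧ b = 1 then -1 else 1

theorem tPhase_zero : tPhase 0 = 1 := by simp [tPhase, matT]

theorem tPhase_one_pow : tPhase 1 ^ 4 = -1 := by
  have : tPhase 1 = Complex.exp (Complex.I * (Real.pi : ℂ) / 4) := by simp [tPhase, matT]
  rw [this, ← Complex.exp_nat_mul, ← Complex.exp_pi_mul_I]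
  congr 1
  push_cast
  ring

theorem tPhase_one_mul_star : tPhase 1 * star (tPhase 1) = 1 := by
  have : tPhase 1 = Complex.exp ((Real.pi / 4 : ℝ) * Complex.I) := by
    simp only [tPhase, matT, Matrix.of_apply, Matrix.cons_val_one, Matrix.cons_val_fin_one]
    congr 1
    push_cast
    ring
  rw [this, Complex.star_def, Complex.mul_conj, Complex.normSq_eq_norm_sq,
    Complex.norm_exp_ofReal_mul_I]
  simp

/-- The phase polynomial `4cab = c + a + b - (c⊕a) - (c⊕b) - (a⊕b) + (c⊕a⊕b)`. Each negative term is
replaced by the phase of the complemented bit, which avoids inverse `T` gates and costs the global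
factor `tPhase 1 ^ 3`. -/
theorem tPhase_product (c a b : Fin 2) :
    tPhase c * tPhase a * tPhase b * tPhase (c + a + 1) * tPhase (c + a + b) *
      tPhase (a + b + 1) * tPhase (c + b + 1) = tPhase 1 ^ 3 * cczPhase c a b := by
  have h := tPhase_one_pow
  generalize hω : tPhase 1 = ω at *
  fin_cases c <;> fin_cases a <;> fin_cases b <;>
    simp [cczPhase, tPhase_zero, hω] <;>
    first | ring1 | linear_combination ω ^ 3 * h

/-! ### The controlled swap in terms of the available gates -/

section Frame

variable {i j : ℕ} {F F' : Fin 2 → Fin 2 → Fin 2 → List (Fin 2)}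

theorem sem_cnot_fst (hF : Frame i j F) (hF' : Frame i j F') (f : LOp) (c a b c' a' b' : Fin 2) :
    (RGate.cnot 0 i).sem f (F c a b) (F' c' a' b') = f (F c (c + a) b) (F' c' (c' + a') b') := by
  simp only [RGate.sem, cnotList, hF.get_zero, hF'.get_zero, hF.get_fst, hF'.get_fst, hF.set_fst,
    hF'.set_fst]

theorem sem_cnot_snd (hF : Frame i j F) (hF' : Frame i j F') (f : LOp) (c a b c' a' b' : Fin 2) :
    (RGate.cnot 0 j).sem f (F c a b) (F' c' a' b') = f (F c a (c + b)) (F' c' a' (c' + b')) := by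
  simp only [RGate.sem, cnotList, hF.get_zero, hF'.get_zero, hF.get_snd, hF'.get_snd, hF.set_snd,
    hF'.set_snd]

theorem sem_cnot_fst_snd (hF : Frame i j F) (hF' : Frame i j F') (f : LOp)
    (c a b c' a' b' : Fin 2) :
    (RGate.cnot i j).sem f (F c a b) (F' c' a' b') = f (F c a (a + b)) (F' c' a' (a' + b')) := by
  simp only [RGate.sem, cnotList, hF.get_fst, hF'.get_fst, hF.get_snd, hF'.get_snd, hF.set_snd,
    hF'.set_snd]

theorem sem_cnot_snd_fst (hF : Frame i j F) (hF' : Frame i j F') (f : LOp)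
    (c a b c' a' b' : Fin 2) :
    (RGate.cnot j i).sem f (F c a b) (F' c' a' b') = f (F c (b + a) b) (F' c' (b' + a') b') := by
  simp only [RGate.sem, cnotList, hF.get_fst, hF'.get_fst, hF.get_snd, hF'.get_snd, hF.set_fst,
    hF'.set_fst]

/-- The gates act diagonally and collect the phases of the seven parities of `tPhase_product`; the
global phase cancels against its conjugate on the column index. -/
theorem semList_cczGates (hF : Frame i j F) (hF' : Frame i j F') (f : LOp)
    (c a b c' a' b' : Fin 2) :
    semList (cczGates i j) f (F c a b) (F' c' a' b') =
      cczPhase c a b * star (cczPhase c' a' b') * f (F c a b) (F' c' a' b') := by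
  simp only [cczGates, semList, sem_cnot_fst hF hF', sem_cnot_snd hF hF', sem_cnot_fst_snd hF hF',
    sem_phaseT, sem_pauliX, hF.get_zero, hF'.get_zero, hF.get_fst, hF'.get_fst, hF.get_snd,
    hF'.get_snd, hF.set_fst, hF'.set_fst, hF.set_snd, hF'.set_snd]
  have e1 : ∀ c b : Fin 2, c + (c + b + 1 + 1) = b := by decide
  have e2 : ∀ c a b : Fin 2, c + (a + b + 1 + 1) = c + a + b := by decide
  have e3 : ∀ c a b : Fin 2, c + a + (c + a + b) = b := by decide
  simp only [e1, e2, e3]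
  have h := tPhase_product c a b
  have h' := congrArg star (tPhase_product c' a' b')
  have hω : tPhase 1 ^ 3 * star (tPhase 1 ^ 3) = 1 := by
    rw [star_pow, ← mul_pow, tPhase_one_mul_star, one_pow]
  simp only [star_mul'] at h'
  calc _ = (tPhase c * tPhase a * tPhase b * tPhase (c + a + 1) * tPhase (c + a + b) *
      tPhase (a + b + 1) * tPhase (c + b + 1)) * (star (tPhase c') * star (tPhase a') *
      star (tPhase b') * star (tPhase (c' + a' + 1)) * star (tPhase (c' + a' + b')) *
      star (tPhase (a' + b' + 1)) * star (tPhase (c' + b' + 1))) *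
      f (F c a b) (F' c' a' b') := by ring
    _ = (tPhase 1 ^ 3 * star (tPhase 1 ^ 3)) * (cczPhase c a b * star (cczPhase c' a' b') *
      f (F c a b) (F' c' a' b')) := by rw [h, h']; ring
    _ = _ := by rw [hω, one_mul]

/-- `H Z H = X`, applied when both controls are on; otherwise `H H = 1`. -/
theorem sum_matH_cczPhase (c a b d : Fin 2) :
    ∑ e, matH b e * cczPhase c a e * matH e d = if d = b + c * a then 1 else 0 := by
  have h : ((Real.sqrt 2 : ℝ) : ℂ)⁻¹ * ((Real.sqrt 2 : ℝ) : ℂ)⁻¹ = 1 / 2 := by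
    rw [← mul_inv, ← Complex.ofReal_mul, Real.mul_self_sqrt (by norm_num)]
    norm_num
  generalize hs : ((Real.sqrt 2 : ℝ) : ℂ)⁻¹ = s at h
  have hM : matH = s • !![1, 1; 1, -1] := by rw [← hs]; rfl
  rw [hM]
  fin_cases c <;> fin_cases a <;> fin_cases b <;> fin_cases d <;>
    simp [cczPhase] <;> linear_combination 2 * h

theorem semList_toffoliGates (hF : Frame i j F) (hF' : Frame i j F') (f : LOp)
    (c a b c' a' b' : Fin 2) :
    semList (toffoliGates i j) f (F c a b) (F' c' a' b') =
      f (F c a (b + c * a)) (F' c' a' (b' + c' * a')) := by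
  simp only [toffoliGates, semList, semList_append]
  have H : ∀ (f : LOp) (c a b c' a' b' : Fin 2),
      (RGate.hadamard j).sem f (F c a b) (F' c' a' b') =
        ∑ e, ∑ e', matH b e * star (matH b' e') * f (F c a e) (F' c' a' e') := by
    intro f c a b c' a' b'
    simp only [RGate.sem, lOne, hF.get_snd, hF'.get_snd, hF.set_snd, hF'.set_snd]
  rw [H]
  simp only [semList_cczGates hF hF', H]
  have e : f (F c a (b + c * a)) (F' c' a' (b' + c' * a')) =
      ∑ d, ∑ d', (∑ e, matH b e * cczPhase c a e * matH e d) *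
        star (∑ e, matH b' e * cczPhase c' a' e * matH e d') * f (F c a d) (F' c' a' d') := by
    simp only [sum_matH_cczPhase]
    rw [Finset.sum_eq_single (b + c * a) (by simp +contextual) (by simp),
      Finset.sum_eq_single (b' + c' * a') (by simp +contextual) (by simp)]
    simp
  rw [e]
  simp only [Fin.sum_univ_two, star_add, star_mul']
  ring

/-- A swap is three controlled-nots, and only the middle one has to be controlled in addition: if it
does not fire, the outer two cancel. -/
theorem semList_cswapGates (hF : Frame i j F) (hF' : Frame i j F') (f : LOp)
    (c a b c' a' b' : Fin 2) :
    semList (cswapGates i j) f (F c a b) (F' c' a' b') =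
      f (F c (if c = 0 then a else b) (if c = 0 then b else a))
        (F' c' (if c' = 0 then a' else b') (if c' = 0 then b' else a')) := by
  have h1 : ∀ c a b : Fin 2, (b + c * (b + a)) + (b + a) = if c = 0 then a else b := by decide
  have h2 : ∀ c a b : Fin 2, b + c * (b + a) = if c = 0 then b else a := by decide
  simp only [cswapGates, semList, semList_append, sem_cnot_snd_fst hF hF',
    semList_toffoliGates hF hF', h1]
  simp only [h2]

end Frame

end

section

open Matrix
open scoped ComplexOrder Kronecker MatrixOrder

/-! ### Running one of two circuits, selected by a control qubit -/

/-- Distributing the `t` wires from `q` on to these and to `t` new wires in front of `E`,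
depending on wire `0`. -/
def inGates : ℕ → ℕ → ℕ → List RGate
  | _, _, 0 => []
  | q, E, t + 1 => .ancilla E :: (cswapGates q E ++ inGates (q + 1) (E + 1) t)

/-- Choosing between `t` wires from `q` on and `t` wires from `E` on, depending on wire `0`. -/
def outGates : ℕ → ℕ → ℕ → List RGate
  | _, _, 0 => []
  | q, E, t + 1 => cswapGates q E ++ .traceOut E :: outGates (q + 1) E t

theorem typed_inGates {q E t n : ℕ} (hq : 0 < q) (hE : q + t ≤ E) (hn : E ≤ n) :
    Typed (inGates q E t) n (n + t) := by
  induction t generalizing q E n with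
  | zero => rfl
  | succ t ih =>
    refine ⟨n + 1, ⟨hn, rfl⟩, (typed_cswapGates hq (by omega) (by omega)).append ?_⟩
    rw [show n + (t + 1) = n + 1 + t by omega]
    exact ih (by omega) (by omega) (by omega)

theorem typed_outGates {q E t n : ℕ} (hq : 0 < q) (hE : E = q + t) (hn : E ≤ n) :
    Typed (outGates q E t) (n + t) n := by
  induction t generalizing q with
  | zero => rfl
  | succ t ih =>
    refine (typed_cswapGates hq (by omega) (by omega)).append ⟨n + t, ⟨by omega, rfl⟩, ?_⟩
    exact ih (by omega) (by omega)

theorem insertIdx_append_length (u v : List (Fin 2)) (a : Fin 2) :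
    (u ++ v).insertIdx u.length a = u ++ a :: v := by
  have := insertIdx_mid (u := u) (x := []) (v := v) (i := 0) (by simp) a
  simpa using this

theorem eraseIdx_append_length (u v : List (Fin 2)) (a : Fin 2) :
    (u ++ a :: v).eraseIdx u.length = u ++ v := by
  have := eraseIdx_mid (u := u) (x := [a]) (v := v) (i := 0) (by simp)
  simpa using this

theorem semList_cswap_append (f : LOp) (c a b a' b' : Fin 2) {u u' v v' w w' : List (Fin 2)}
    {i j : ℕ} (hu : i = 1 + u.length) (hu' : i = 1 + u'.length) (hv : j = 1 + i + v.length)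
    (hv' : j = 1 + i + v'.length) :
    semList (cswapGates i j) f (c :: (u ++ a :: (v ++ b :: w))) (c :: (u' ++ a' :: (v' ++ b' :: w')))
      = if c = 0 then f (c :: (u ++ a :: (v ++ b :: w))) (c :: (u' ++ a' :: (v' ++ b' :: w')))
        else f (c :: (u ++ b :: (v ++ a :: w))) (c :: (u' ++ b' :: (v' ++ a' :: w'))) := by
  have h := frame_append u v w
  have h' := frame_append u' v' w'
  rw [← hu, show 2 + u.length + v.length = j by omega] at h
  rw [← hu', show 2 + u'.length + v'.length = j by omega] at h'
  rw [semList_cswapGates h h' f c a b c a' b']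
  split_ifs <;> rfl

theorem sem_ancilla_append (f : LOp) (a a' : Fin 2) {u u' v v' : List (Fin 2)} {i : ℕ}
    (hu : i = u.length) (hu' : i = u'.length) :
    (RGate.ancilla i).sem f (u ++ a :: v) (u' ++ a' :: v') =
      if a = 0 ∧ a' = 0 then f (u ++ v) (u' ++ v') else 0 := by
  have g : (u ++ a :: v).getD i 0 = a := by simp [hu]
  have g' : (u' ++ a' :: v').getD i 0 = a' := by simp [hu']
  simp only [RGate.sem, g, g']
  rw [hu, eraseIdx_append_length, ← hu, hu', eraseIdx_append_length]

/-- Semantics run backwards here: an output entry is expressed by input entries. Of the registers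
`A` and `B` one carries the input and the other must be zero, as it holds the swapped-in ancillas.
Only equal control bits on the row and column side are considered, because wire `0` is discarded in
the end. -/
theorem semList_inGates (f : LOp) (c : Fin 2) {t q E : ℕ}
    {u u' A A' M M' B B' v v' : List (Fin 2)} (hu : q = 1 + u.length) (hu' : q = 1 + u'.length)
    (hA : A.length = t) (hA' : A'.length = t) (hB : B.length = t) (hB' : B'.length = t)
    (hM : E = q + t + M.length) (hM' : E = q + t + M'.length) :
    semList (inGates q E t) f (c :: (u ++ (A ++ (M ++ (B ++ v)))))
        (c :: (u' ++ (A' ++ (M' ++ (B' ++ v'))))) =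
      if (if c = 0 then B else A) = List.replicate t 0 ∧
          (if c = 0 then B' else A') = List.replicate t 0 then
        f (c :: (u ++ ((if c = 0 then A else B) ++ (M ++ v))))
          (c :: (u' ++ ((if c = 0 then A' else B') ++ (M' ++ v'))))
      else 0 := by
  induction t generalizing f q E u u' A A' M M' B B' with
  | zero =>
    simp only [List.length_eq_zero_iff] at hA hA' hB hB'
    subst hA hA' hB hB'
    simp [inGates, semList]
  | succ t ih =>
    obtain ⟨a, A, rfl⟩ := List.exists_cons_of_length_eq_add_one hA
    obtain ⟨a', A', rfl⟩ := List.exists_cons_of_length_eq_add_one hA'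
    obtain ⟨b, B, rfl⟩ := List.exists_cons_of_length_eq_add_one hB
    obtain ⟨b', B', rfl⟩ := List.exists_cons_of_length_eq_add_one hB'
    simp only [List.length_cons, Nat.add_right_cancel_iff] at hA hA' hB hB'
    -- The wires already treated move into `u` and `M`; the middle part `M` is there for this
    -- induction.
    have := ih (semList (cswapGates q E) ((RGate.ancilla E).sem f)) (q := q + 1) (E := E + 1)
      (u := u ++ [a]) (u' := u' ++ [a']) (A := A) (A' := A') (B := B) (B' := B') (M := M ++ [b])
      (M' := M' ++ [b']) (by simp; omega) (by simp; omega) hA hA' hB hB'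
      (by simp; omega) (by simp; omega)
    simp only [List.append_assoc, List.singleton_append] at this
    simp only [inGates, semList, semList_append, List.cons_append]
    rw [this]
    have hc := semList_cswap_append ((RGate.ancilla E).sem f) c a b a' b' (i := q) (j := E)
      (u := u) (u' := u') (w := v) (w' := v') (v := (if c = 0 then A else B) ++ M)
      (v' := (if c = 0 then A' else B') ++ M') hu hu'
      (by simp; split_ifs <;> omega) (by simp; split_ifs <;> omega)
    simp only [List.append_assoc] at hc
    rw [hc]
    have ha : ∀ a b a' b', (RGate.ancilla E).sem f
        (c :: (u ++ a :: ((if c = 0 then A else B) ++ (M ++ b :: v))))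
        (c :: (u' ++ a' :: ((if c = 0 then A' else B') ++ (M' ++ b' :: v')))) =
        if b = 0 ∧ b' = 0 then f (c :: (u ++ a :: ((if c = 0 then A else B) ++ (M ++ v))))
        (c :: (u' ++ a' :: ((if c = 0 then A' else B') ++ (M' ++ v')))) else 0 := by
      intro a b a' b'
      have := sem_ancilla_append f b b' (i := E) (v := v) (v' := v')
        (u := c :: (u ++ a :: ((if c = 0 then A else B) ++ M)))
        (u' := c :: (u' ++ a' :: ((if c = 0 then A' else B') ++ M')))
        (by simp; split_ifs <;> omega) (by simp; split_ifs <;> omega)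
      simpa only [List.append_assoc, List.cons_append] using this
    rw [ha, ha]
    by_cases hc0 : c = 0
    · simp only [hc0, if_true, List.replicate_succ, List.cons.injEq, List.cons_append]
      simp only [← ite_and]
      exact if_congr (by tauto) rfl rfl
    · simp only [hc0, if_false, List.replicate_succ, List.cons.injEq, List.cons_append]
      simp only [← ite_and]
      exact if_congr (by tauto) rfl rfl

theorem sum_fin_succ_fun {t : ℕ} (F : List (Fin 2) → ℂ) :
    ∑ w : Fin (t + 1) → Fin 2, F (List.ofFn w) =
      ∑ w : Fin t → Fin 2, ∑ d : Fin 2, F (d :: List.ofFn w) := by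
  rw [← (Fin.consEquiv fun _ => Fin 2).sum_comp, Fintype.sum_prod_type, Finset.sum_comm]
  simp [Fin.consEquiv, List.ofFn_succ]

theorem insertIdx_cons_append {u : List (Fin 2)} {c d : Fin 2} {t q E : ℕ}
    (hu : q = 1 + u.length) (a : Fin 2) (A : List (Fin 2)) (hA : A.length = t)
    (v : List (Fin 2)) (hE : E = q + (t + 1)) :
    (c :: (u ++ a :: (A ++ v))).insertIdx E d = c :: (u ++ a :: (A ++ d :: v)) := by
  have := insertIdx_append_length (c :: (u ++ a :: A)) v d
  rw [show (c :: (u ++ a :: A)).length = E by simp; omega] at this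
  simpa only [List.append_assoc, List.cons_append] using this

/-- After each swap the unwanted wire sits at `E` and is traced out, which brings the next wire of
the second register to `E`. The sum over `w` is the trace over the unwanted register. -/
theorem semList_outGates (f : LOp) (c : Fin 2) {t q E : ℕ}
    {u u' A A' v v' : List (Fin 2)} (hu : q = 1 + u.length) (hu' : q = 1 + u'.length)
    (hA : A.length = t) (hA' : A'.length = t) (hE : E = q + t) :
    semList (outGates q E t) f (c :: (u ++ (A ++ v))) (c :: (u' ++ (A' ++ v'))) =
      ∑ w : Fin t → Fin 2,
        f (c :: (u ++ ((if c = 0 then A else List.ofFn w) ++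
            ((if c = 0 then List.ofFn w else A) ++ v))))
          (c :: (u' ++ ((if c = 0 then A' else List.ofFn w) ++
            ((if c = 0 then List.ofFn w else A') ++ v')))) := by
  induction t generalizing f q u u' A A' with
  | zero =>
    simp only [List.length_eq_zero_iff] at hA hA'
    subst hA hA'
    rw [Fintype.sum_subsingleton _ (fun i => i.elim0)]
    simp only [List.ofFn_zero, ite_self]
    rfl
  | succ t ih =>
    obtain ⟨a, A, rfl⟩ := List.exists_cons_of_length_eq_add_one hA
    obtain ⟨a', A', rfl⟩ := List.exists_cons_of_length_eq_add_one hA'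
    simp only [List.length_cons, Nat.add_right_cancel_iff] at hA hA'
    have := ih ((RGate.traceOut E).sem (semList (cswapGates q E) f)) (q := q + 1)
      (u := u ++ [a]) (u' := u' ++ [a']) (A := A) (A' := A') (by simp; omega) (by simp; omega)
      hA hA' (by omega)
    simp only [List.append_assoc, List.singleton_append] at this
    rw [outGates, semList_append, semList, List.cons_append, List.cons_append, this]
    rw [sum_fin_succ_fun fun w => f (c :: (u ++ ((if c = 0 then a :: A else w) ++
            ((if c = 0 then w else a :: A) ++ v))))
          (c :: (u' ++ ((if c = 0 then a' :: A' else w) ++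
            ((if c = 0 then w else a' :: A') ++ v'))))]
    refine Finset.sum_congr rfl fun w _ => ?_
    simp only [RGate.sem]
    refine Finset.sum_congr rfl fun d _ => ?_
    have hw : (List.ofFn w).length = t := List.length_ofFn
    generalize List.ofFn w = w at hw ⊢
    have hl : ∀ A : List (Fin 2), A.length = t → (if c = 0 then A else w).length = t :=
      fun A hA => by split_ifs <;> assumption
    rw [insertIdx_cons_append hu a _ (hl A hA) _ hE, insertIdx_cons_append hu' a' _ (hl A' hA') _ hE,
      semList_cswap_append f c a d a' d hu hu' (by rw [hl A hA]; omega) (by rw [hl A' hA']; omega)]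
    by_cases hc : c = 0
    · simp only [hc, if_true, List.cons_append]
    · simp only [hc, if_false, List.cons_append]

end

section

open Matrix
open scoped ComplexOrder Kronecker MatrixOrder

/-! ### Selectors: families of circuits that run one of two channels -/

/-- `S g` runs `Φ c` if wire `0` is in the state `c` and then discards that wire. The input wires
of `Φ c` are those after the first `1 + g`. -/
structure IsSelector (k l : ℕ) (Φ : Fin 2 → (QOp k →ₗ[ℂ] QOp l)) (S : ℕ → List RGate) : Prop where
  typed : ∀ g m, Typed (S g) (1 + g + k + m) (g + l + m)
  sem : ∀ (g : ℕ) (f : LOp) (u u' v v' : List (Fin 2)) (z z' : Fin l → Fin 2),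
    u.length = g → u'.length = g → v.length = v'.length →
    semList (S g) f (u ++ (List.ofFn z ++ v)) (u' ++ (List.ofFn z' ++ v')) =
      ∑ c, Φ c (Matrix.of fun a a' => f (c :: (u ++ (List.ofFn a ++ v)))
        (c :: (u' ++ (List.ofFn a' ++ v')))) z z'

variable {k l : ℕ}

/-- Running `w₁` or `w₂`. -/
def selectGates (k l : ℕ) (w₁ w₂ : List RGate) (g : ℕ) : List RGate :=
  inGates (1 + g) (1 + g + k) k ++ (w₂.map (RGate.shift (1 + g + k)) ++
    (w₁.map (RGate.shift (1 + g)) ++ (outGates (1 + g) (1 + g + l) l ++ [.traceOut 0])))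

theorem replicate_eq_ofFn (t : ℕ) : List.replicate t (0 : Fin 2) = List.ofFn fun _ : Fin t => 0 :=
  List.ext_getElem (by simp) (by simp)

/-- The circuit that is not selected acts on `|0…0⟩` and its output is traced out, so by trace
preservation it contributes only the scalar. -/
theorem IsChan.sum_diag_mask {Φ : QOp k →ₗ[ℂ] QOp l} (hΦ : IsChan Φ) (z : ℂ) :
    ∑ w : Fin l → Fin 2, Φ (Matrix.of fun a a' => if a = 0 ∧ a' = 0 then z else 0) w w = z := by
  have := hΦ.tr (Matrix.of fun a a' => if a = 0 ∧ a' = 0 then z else 0)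
  simpa [Matrix.trace] using this

theorem semList_shift_circuit {n m : ℕ} (C : Circuit n m) (f : LOp) {o : ℕ}
    {u u' v v' : List (Fin 2)} (hu : u.length = o) (hu' : u'.length = o) (z z' : Fin m → Fin 2) :
    semList (C.raw.map (RGate.shift o)) f (u ++ (List.ofFn z ++ v)) (u' ++ (List.ofFn z' ++ v')) =
      C.channel (Matrix.of fun a a' => f (u ++ (List.ofFn a ++ v)) (u' ++ (List.ofFn a' ++ v')))
        z z' := by
  rw [← List.append_assoc, ← List.append_assoc, semList_shift C.typed_raw f hu hu' (by simp)
    (by simp)]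
  have := congrFun (congrFun (C.channel_toQ fun a a' => f (u ++ a ++ v) (u' ++ a' ++ v')) z) z'
  simp only [toQ, List.append_assoc, Matrix.of_apply] at this ⊢
  exact this.symm

theorem sum_map_apply {ι : Type*} (Φ : QOp k →ₗ[ℂ] QOp l) (s : Finset ι) (M : ι → QOp k)
    (z z' : Fin l → Fin 2) : ∑ i ∈ s, Φ (M i) z z' = Φ (∑ i ∈ s, M i) z z' := by
  rw [map_sum, Matrix.sum_apply]

theorem map_of_sum {κ : Type*} (s : Finset κ) (Φ : QOp k →ₗ[ℂ] QOp l)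
    (M : κ → (Fin k → Fin 2) → (Fin k → Fin 2) → ℂ) (z z' : Fin l → Fin 2) :
    Φ (Matrix.of fun a a' => ∑ i ∈ s, M i a a') z z' = ∑ i ∈ s, Φ (Matrix.of (M i)) z z' := by
  rw [sum_map_apply]
  refine congrArg (fun M => Φ M z z') ?_
  ext a a'
  simp [Matrix.sum_apply]

theorem map_of_mul (Φ : QOp k →ₗ[ℂ] QOp l) (c : ℂ)
    (M : (Fin k → Fin 2) → (Fin k → Fin 2) → ℂ) (z z' : Fin l → Fin 2) :
    Φ (Matrix.of fun a a' => c * M a a') z z' = c * Φ (Matrix.of M) z z' :=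
  congrFun (congrFun (map_smul Φ c (Matrix.of M)) z) z'

theorem map_of_ite (Φ : QOp k →ₗ[ℂ] QOp l) (p : Prop) [Decidable p]
    (M : (Fin k → Fin 2) → (Fin k → Fin 2) → ℂ) (z z' : Fin l → Fin 2) :
    Φ (Matrix.of fun a a' => if p then M a a' else 0) z z' =
      if p then Φ (Matrix.of M) z z' else 0 := by
  split_ifs
  · rfl
  · exact congrFun (congrFun (map_zero Φ) z) z'

/-- Distribute the input by the control bit, run both circuits, swap the wanted output to the front,
and discard the rest. Discarding the control leaves only its diagonal, which is the sum over `c`. -/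
theorem isSelector_selectGates (C D : Circuit k l) :
    IsSelector k l (![C.channel, D.channel]) (selectGates k l C.raw D.raw) where
  typed g m := by
    refine (typed_inGates (by omega) le_rfl (by omega)).append ?_
    have h1 := D.typed_raw.shift (1 + g + k) m
    have h2 := C.typed_raw.shift (1 + g) (l + m)
    have h3 := typed_outGates (q := 1 + g) (E := 1 + g + l) (t := l) (n := 1 + g + l + m)
      (by omega) rfl (by omega)
    rw [show 1 + g + k + m + k = 1 + g + k + k + m by omega]
    refine h1.append ?_
    rw [← add_assoc, show 1 + g + k + l + m = 1 + g + k + (l + m) by omega] at *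
    refine h2.append ?_
    rw [show 1 + g + l + (l + m) = 1 + g + l + m + l by omega]
    exact h3.append (typed_singleton ⟨by omega, by omega⟩)
  sem g f u u' v v' z z' hu hu' hv := by
    simp only [selectGates, semList_append, semList]
    have hq : 1 + g = 1 + u.length := by omega
    have hq' : 1 + g = 1 + u'.length := by omega
    simp only [RGate.sem, List.insertIdx_zero]
    refine Finset.sum_congr rfl fun c _ => ?_
    rw [semList_outGates _ c hq hq' (by simp) (by simp) rfl]
    -- Here `p` indexes the output of `C` and `q` that of `D`; the condition says that the register
    -- not selected by `c` starts in zero.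
    have step : ∀ (p p' q q' : Fin l → Fin 2), semList (C.raw.map (RGate.shift (1 + g)))
        (semList (D.raw.map (RGate.shift (1 + g + k))) (semList (inGates (1 + g) (1 + g + k) k) f))
        (c :: (u ++ (List.ofFn p ++ (List.ofFn q ++ v))))
        (c :: (u' ++ (List.ofFn p' ++ (List.ofFn q' ++ v')))) =
        C.channel (Matrix.of fun a a' => D.channel (Matrix.of fun b b' =>
          if (if c = 0 then b else a) = 0 ∧ (if c = 0 then b' else a') = 0 then
            f (c :: (u ++ (List.ofFn (if c = 0 then a else b) ++ v)))
              (c :: (u' ++ (List.ofFn (if c = 0 then a' else b') ++ v')))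
          else 0) q q') p p' := by
      intro p p' q q'
      have h1 := semList_shift_circuit C (semList (D.raw.map (RGate.shift (1 + g + k)))
        (semList (inGates (1 + g) (1 + g + k) k) f)) (o := 1 + g) (u := c :: u) (u' := c :: u')
        (v := List.ofFn q ++ v) (v' := List.ofFn q' ++ v') (by simp; omega) (by simp; omega) p p'
      simp only [List.cons_append] at h1
      rw [h1]
      refine congrArg (fun M => C.channel M p p') ?_
      ext a a'
      simp only [Matrix.of_apply]
      have h2 := semList_shift_circuit D (semList (inGates (1 + g) (1 + g + k) k) f)
        (o := 1 + g + k) (u := c :: (u ++ List.ofFn a)) (u' := c :: (u' ++ List.ofFn a'))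
        (v := v) (v' := v') (by simp; omega) (by simp; omega) q q'
      simp only [List.cons_append, List.append_assoc] at h2
      rw [h2]
      refine congrArg (fun M => D.channel M q q') ?_
      ext b b'
      simp only [Matrix.of_apply]
      have h3 := semList_inGates f c (t := k) (A := List.ofFn a) (A' := List.ofFn a')
        (M := []) (M' := []) (B := List.ofFn b) (B' := List.ofFn b') (v := v) (v' := v') hq hq'
        (by simp) (by simp) (by simp) (by simp) (E := 1 + g + k) (by simp) (by simp)
      simp only [List.nil_append] at h3
      rw [h3]
      have e : ∀ a : Fin k → Fin 2, List.ofFn a = List.replicate k 0 ↔ a = 0 :=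
        fun a => by rw [replicate_eq_ofFn, List.ofFn_injective.eq_iff]; rfl
      fin_cases c <;> simp [e]
    -- For control `0` the output of `D` is traced out inside `C`; for control `1` the trace of `C`
    -- is the outer one.
    fin_cases c
    · simp only [Fin.zero_eta, if_true, Matrix.cons_val_zero] at step ⊢
      simp only [step]
      rw [sum_map_apply]
      refine congrArg (fun M => C.channel M z z') ?_
      ext a a'
      rw [Matrix.sum_apply]
      exact (isChan_circuit D).sum_diag_mask _
    · simp only [Fin.mk_one, one_ne_zero, if_false, Matrix.cons_val_one, Matrix.cons_val_fin_one]
        at step ⊢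
      simp only [step]
      simp only [map_of_ite]
      exact (isChan_circuit C).sum_diag_mask _

/-- Running `Φ_y` for random bits `y`, and adding these bits to wire `0`. -/
def parityGates (k : ℕ) (S : ℕ → List RGate) : ℕ → ℕ → List RGate
  | 0, g => [.ancilla (1 + g), .cnot 0 (1 + g), .traceOut 0]
  | r + 1, g => [.ancilla 0, .depolarize 0, .cnot 0 1] ++ (S (1 + g + k * r) ++ parityGates k S r g)

/-- Running `r` copies of `Φ_c`, where `c` is the bit on wire `0`. -/
def powerGates (k : ℕ) (S : ℕ → List RGate) : ℕ → ℕ → List RGate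
  | 0, _ => [.traceOut 0]
  | r + 1, g => [.ancilla 0, .cnot 1 0] ++ (S (1 + g + k * r) ++ powerGates k S r g)

theorem tens_append {k' l' : ℕ} (Φ : QOp k →ₗ[ℂ] QOp l) (Ψ : QOp k' →ₗ[ℂ] QOp l') (F : LOp)
    (z₁ z₁' : Fin l → Fin 2) (z₂ z₂' : Fin l' → Fin 2) :
    tens Φ Ψ (Matrix.of fun a a' => F (List.ofFn a) (List.ofFn a')) (Fin.appendEquiv l l' (z₁, z₂))
      (Fin.appendEquiv l l' (z₁', z₂')) = Φ (Matrix.of fun a a' => Ψ (Matrix.of fun b b' =>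
        F (List.ofFn a ++ List.ofFn b) (List.ofFn a' ++ List.ofFn b')) z₂ z₂') z₁ z₁' := by
  rw [tens, tensE_apply]
  simp only [Equiv.symm_apply_apply, Matrix.of_apply, ← List.ofFn_fin_append]
  rfl

theorem half_sum_apply (A : Fin 2 → (QOp k →ₗ[ℂ] QOp l)) (ρ : QOp k) (z z' : Fin l → Fin 2) :
    ((1 / 2 : ℂ) • ∑ y, A y) ρ z z' = (1 / 2 : ℂ) * ∑ y, A y ρ z z' := by
  rw [LinearMap.smul_apply, Matrix.smul_apply, LinearMap.sum_apply, Matrix.sum_apply, smul_eq_mul]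

/-- Copying the control to a fresh wire and discarding the original is the same as measuring it and
preparing the result. -/
theorem semList_copyBit (f : LOp) {g : ℕ} {u u' v v' : List (Fin 2)} (hu : u.length = g)
    (hu' : u'.length = g) (z z' : Fin 1 → Fin 2) :
    semList [.ancilla (1 + g), .cnot 0 (1 + g), .traceOut 0] f
        (u ++ (List.ofFn z ++ v)) (u' ++ (List.ofFn z' ++ v')) =
      ∑ c, prepBit c (Matrix.of fun a a' => f (c :: (u ++ (List.ofFn a ++ v)))
        (c :: (u' ++ (List.ofFn a' ++ v')))) z z' := by
  rw [semList, semList, semList, semList]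
  have e1 : ∀ z : Fin 1 → Fin 2, List.ofFn z = [z 0] := fun z => by simp
  have e0 : ∀ z : Fin 0 → Fin 2, List.ofFn z = [] := fun z => by simp
  have hc : ∀ (c : Fin 2) (u v : List (Fin 2)) (z : Fin 1 → Fin 2), u.length = g →
      cnotList 0 (1 + g) (c :: (u ++ (z 0 :: v))) = c :: (u ++ (c + z 0) :: v) := by
    intro c u v z hu
    have h1 := getD_mid (u := c :: u) (x := [z 0]) (v := v) (i := 0) (by simp)
    have h2 := set_mid (u := c :: u) (x := [z 0]) (v := v) (i := 0) (by simp) (c + z 0)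
    simp only [List.length_cons, hu, add_zero, add_comm _ 1, List.append_assoc,
      List.cons_append, List.nil_append, List.set_cons_zero] at h1 h2
    rw [cnotList, h1]
    exact h2
  have hz : ∀ (u v : List (Fin 2)) (z : Fin 1 → Fin 2),
      u ++ (List.ofFn z ++ v) = u ++ z 0 :: v := fun u v z => by rw [e1]; rfl
  have h2 : ∀ c d : Fin 2, c + d = 0 ↔ d = c := by decide
  have ha := fun c => sem_ancilla_append f (c + z 0) (c + z' 0) (i := 1 + g) (u := c :: u)
    (u' := c :: u') (v := v) (v' := v') (by simp; omega) (by simp; omega)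
  simp only [List.cons_append] at ha
  rw [hz u v z, hz u' v' z']
  simp only [RGate.sem, List.insertIdx_zero, hc _ _ _ _ hu, hc _ _ _ _ hu'] at ha ⊢
  simp only [ha, h2]
  refine Finset.sum_congr rfl fun c _ => ?_
  change _ = if z 0 = c ∧ z' 0 = c then
    f (c :: (u ++ (List.ofFn (default : Fin 0 → Fin 2) ++ v)))
      (c :: (u' ++ (List.ofFn (default : Fin 0 → Fin 2) ++ v'))) else 0
  simp

/-- A depolarized ancilla is the random bit `y`; it is added to the control and then consumed as the
control of `S`, which leaves `b + y` for the remaining repetitions. Relative to `S` the old control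
and the earlier inputs are spectators, hence the offset `1 + g + k * r`. -/
theorem isSelector_parityGates {Φ : Fin 2 → (QOp k →ₗ[ℂ] QOp l)} {S : ℕ → List RGate}
    (h : IsSelector k l Φ S) (r : ℕ) :
    IsSelector (k * r) (parityOutputs l r) (parityPair Φ r) (parityGates k S r) := by
  induction r with
  | zero =>
    constructor
    · intro g m
      simp only [parityGates, Typed, RGate.Ok, parityOutputs]
      exact ⟨_, ⟨by omega, rfl⟩, _, ⟨by omega, by omega, by omega, rfl⟩, _, ⟨by omega, by omega⟩, rfl⟩
    · intro g f u u' v v' z z' hu hu' hv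
      exact semList_copyBit f hu hu' z z'
  | succ r ih =>
    constructor
    · intro g m
      have h1 := h.typed (1 + g + k * r) m
      have h2 := ih.typed g (l + m)
      refine Typed.append (m := 1 + (1 + g + k * r) + k + m) ?_ (h1.append ?_)
      · simp only [Typed, RGate.Ok]
        have e : k * (r + 1) = k * r + k := rfl
        exact ⟨_, ⟨by omega, rfl⟩, _, ⟨by omega, rfl⟩, _, ⟨by omega, by omega, by omega, rfl⟩, by omega⟩
      · have e : parityOutputs l (r + 1) = parityOutputs l r + l := rfl
        convert h2 using 1 <;> omega
    · intro g f u u' v v' z z' hu hu' hv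
      obtain ⟨⟨z₁, z₂⟩, rfl⟩ := (Fin.appendEquiv (α := Fin 2) (parityOutputs l r) l).surjective z
      obtain ⟨⟨z₁', z₂'⟩, rfl⟩ := (Fin.appendEquiv (α := Fin 2) (parityOutputs l r) l).surjective z'
      have e : ∀ z₁ z₂, List.ofFn (n := parityOutputs l (r + 1))
          (Fin.appendEquiv (α := Fin 2) (parityOutputs l r) l (z₁, z₂)) =
          List.ofFn z₁ ++ List.ofFn z₂ := fun _ _ => List.ofFn_fin_append _ _
      -- Only equal bits on both sides are needed, since both controls are eventually traced out.
      have hd : ∀ c y : Fin 2, ∀ w w', semList [.ancilla 0, .depolarize 0, .cnot 0 1] f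
          (y :: c :: w) (y :: c :: w') = (1 / 2 : ℂ) * f ((y + c) :: w) ((y + c) :: w') := by
        intro c y w w'
        simp [semList, RGate.sem, cnotList]
      have hG : ∀ c (a a' : Fin (k * r) → Fin 2), semList (S (1 + g + k * r))
          (semList [.ancilla 0, .depolarize 0, .cnot 0 1] f)
          (c :: (u ++ (List.ofFn a ++ (List.ofFn z₂ ++ v))))
          (c :: (u' ++ (List.ofFn a' ++ (List.ofFn z₂' ++ v')))) =
          ∑ y, (1 / 2 : ℂ) * Φ y (Matrix.of fun b b' =>
            f ((y + c) :: (u ++ (List.ofFn a ++ (List.ofFn b ++ v))))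
              ((y + c) :: (u' ++ (List.ofFn a' ++ (List.ofFn b' ++ v'))))) z₂ z₂' := by
        intro c a a'
        have := h.sem (1 + g + k * r) (semList [.ancilla 0, .depolarize 0, .cnot 0 1] f)
          (c :: (u ++ List.ofFn a)) (c :: (u' ++ List.ofFn a')) v v' z₂ z₂'
          (by simp; omega) (by simp; omega) hv
        simp only [List.cons_append, List.append_assoc, hd, map_of_mul] at this
        exact this
      rw [e, e, parityGates, semList_append, semList_append, List.append_assoc, List.append_assoc,
        ih.sem g _ u u' _ _ z₁ z₁' hu hu' (by simp [hv])]
      simp only [hG, map_of_sum, map_of_mul]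
      have hT : ∀ c, parityPair Φ (r + 1) c (Matrix.of fun a a' =>
          f (c :: (u ++ (List.ofFn a ++ v))) (c :: (u' ++ (List.ofFn a' ++ v'))))
          (Fin.appendEquiv (α := Fin 2) (parityOutputs l r) l (z₁, z₂))
          (Fin.appendEquiv (α := Fin 2) (parityOutputs l r) l (z₁', z₂')) =
          (1 / 2 : ℂ) * ∑ y, parityPair Φ r (c + y) (Matrix.of fun a a' =>
            Φ y (Matrix.of fun b b' => f (c :: (u ++ (List.ofFn a ++ (List.ofFn b ++ v))))
              (c :: (u' ++ (List.ofFn a' ++ (List.ofFn b' ++ v'))))) z₂ z₂') z₁ z₁' := by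
        intro c
        have := fun y => tens_append (parityPair Φ r (c + y)) (Φ y)
          (fun x x' => f (c :: (u ++ (x ++ v))) (c :: (u' ++ (x' ++ v')))) z₁ z₁' z₂ z₂'
        simp only [List.append_assoc] at this
        simp only [← this]
        exact half_sum_apply _ _ _ _
      rw [Finset.sum_congr rfl fun c _ => hT c]
      simp only [Fin.sum_univ_two, add_zero, zero_add, show (1 : Fin 2) + 1 = 0 from rfl]
      ring

/-- A controlled-not copies the control bit for each run of `S`. Coherence between the copies is
harmless, because every copy and the original are discarded. -/
theorem isSelector_powerGates {Φ : Fin 2 → (QOp k →ₗ[ℂ] QOp l)} {S : ℕ → List RGate}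
    (h : IsSelector k l Φ S) (r : ℕ) :
    IsSelector (k * r) (l * r) (powerPair Φ r) (powerGates k S r) := by
  induction r with
  | zero =>
    constructor
    · intro g m
      exact typed_singleton ⟨by omega, by omega⟩
    · intro g f u u' v v' z z' hu hu' hv
      rw [powerGates, semList, semList]
      simp only [RGate.sem, List.insertIdx_zero]
      rfl
  | succ r ih =>
    constructor
    · intro g m
      have h1 := h.typed (1 + g + k * r) m
      have h2 := ih.typed g (l + m)
      refine Typed.append (m := 1 + (1 + g + k * r) + k + m) ?_ (h1.append ?_)
      · simp only [Typed, RGate.Ok]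
        have e : k * (r + 1) = k * r + k := rfl
        exact ⟨_, ⟨by omega, rfl⟩, _, ⟨by omega, by omega, by omega, rfl⟩, by omega⟩
      · have e : l * (r + 1) = l * r + l := rfl
        convert h2 using 1 <;> omega
    · intro g f u u' v v' z z' hu hu' hv
      obtain ⟨⟨z₁, z₂⟩, rfl⟩ := (Fin.appendEquiv (α := Fin 2) (l * r) l).surjective z
      obtain ⟨⟨z₁', z₂'⟩, rfl⟩ := (Fin.appendEquiv (α := Fin 2) (l * r) l).surjective z'
      have e : ∀ z₁ z₂, List.ofFn (Fin.appendEquiv (α := Fin 2) (l * r) l (z₁, z₂)) =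
          List.ofFn z₁ ++ List.ofFn z₂ := fun _ _ => List.ofFn_fin_append _ _
      have hd : ∀ c y : Fin 2, ∀ w w', semList [.ancilla 0, .cnot 1 0] f
          (y :: c :: w) (y :: c :: w') = if y = c then f (c :: w) (c :: w') else 0 := by
        intro c y w w'
        have h2 : ∀ c d : Fin 2, c + d = 0 ↔ d = c := by decide
        simp [semList, RGate.sem, cnotList, h2]
      have hG : ∀ c (a a' : Fin (k * r) → Fin 2), semList (S (1 + g + k * r))
          (semList [.ancilla 0, .cnot 1 0] f)
          (c :: (u ++ (List.ofFn a ++ (List.ofFn z₂ ++ v))))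
          (c :: (u' ++ (List.ofFn a' ++ (List.ofFn z₂' ++ v')))) =
          Φ c (Matrix.of fun b b' =>
            f (c :: (u ++ (List.ofFn a ++ (List.ofFn b ++ v))))
              (c :: (u' ++ (List.ofFn a' ++ (List.ofFn b' ++ v'))))) z₂ z₂' := by
        intro c a a'
        have := h.sem (1 + g + k * r) (semList [.ancilla 0, .cnot 1 0] f)
          (c :: (u ++ List.ofFn a)) (c :: (u' ++ List.ofFn a')) v v' z₂ z₂'
          (by simp; omega) (by simp; omega) hv
        simp only [List.cons_append, List.append_assoc, hd, map_of_ite, Finset.sum_ite_eq',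
          Finset.mem_univ, if_true] at this
        exact this
      rw [e, e, powerGates, semList_append, semList_append, List.append_assoc, List.append_assoc,
        ih.sem g _ u u' _ _ z₁ z₁' hu hu' (by simp [hv])]
      simp only [hG]
      refine Finset.sum_congr rfl fun c _ => ?_
      have := tens_append (powerPair Φ r c) (Φ c)
        (fun x x' => f (c :: (u ++ (x ++ v))) (c :: (u' ++ (x' ++ v')))) z₁ z₁' z₂ z₂'
      simp only [List.append_assoc] at this
      exact this.symm

/-- The selector that is run on a fixed control bit in the polarized circuits. -/
def polarGates (k l : ℕ) (w₁ w₂ : List RGate) (r K s : ℕ) : List RGate :=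
  parityGates (k * r * K) (powerGates (k * r) (parityGates k (selectGates k l w₁ w₂) r) K) s 0

/-- Preparation of the control bit. -/
def bitGates (b : Fin 2) : List RGate := .ancilla 0 :: if b = 0 then [] else [.pauliX 0]

theorem semList_bitGates (b c : Fin 2) (f : LOp) (x x' : List (Fin 2)) :
    semList (bitGates b) f (c :: x) (c :: x') = if c = b then f x x' else 0 := by
  have h : ∀ c : Fin 2, c + 1 = 0 ↔ c = 1 := by decide
  fin_cases b
  · simp [bitGates, semList, RGate.sem]
  · simp only [bitGates, Fin.mk_one, one_ne_zero, if_false, semList, sem_pauliX]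
    simp [RGate.sem, h]

/-- The three constructions are nested as selectors, and the outermost control is prepared in the
state `b`, which singles out one summand. -/
theorem exists_polarized_circuit (C D : Circuit k l) (r K s : ℕ) (b : Fin 2) :
    ∃ P : Circuit (k * r * K * s) (parityOutputs (parityOutputs l r * K) s),
      P.raw = bitGates b ++ polarGates k l C.raw D.raw r K s ∧
      P.channel = polarizedPair (![C.channel, D.channel]) r K s b := by
  have hS := isSelector_parityGates (isSelector_powerGates (isSelector_parityGates
    (isSelector_selectGates C D) r) K) s
  have h1 := hS.typed 0 0
  have hb : Typed (bitGates b) (k * r * K * s) (1 + 0 + k * r * K * s + 0) := by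
    fin_cases b
    · exact ⟨_, ⟨by omega, rfl⟩, show _ = _ by omega⟩
    · exact ⟨_, ⟨by omega, rfl⟩, _, ⟨by omega, rfl⟩, show _ = _ by omega⟩
  have h2 := hb.append h1
  simp only [zero_add, add_zero] at h2
  obtain ⟨P, hP⟩ := h2.exists_circuit
  refine ⟨P, hP, LinearMap.ext fun ρ => ?_⟩
  -- Every operator is the restriction of some matrix on bit strings, so the untyped semantics
  -- determine the channel.
  obtain ⟨f, rfl⟩ : ∃ f, ρ = toQ _ f :=
    ⟨fun x y => ρ (fun i => x.getD i 0) (fun i => y.getD i 0), by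
      ext x y
      simp only [toQ, Matrix.of_apply, getD_ofFn]⟩
  rw [P.channel_toQ, hP, semList_append]
  ext z z'
  have := hS.sem 0 (semList (bitGates b) f) [] [] [] [] z z' rfl rfl rfl
  simp only [List.nil_append, List.append_nil, semList_bitGates, map_of_ite, Finset.sum_ite_eq',
    Finset.mem_univ, if_true] at this
  exact this

end

section

open Turing

/-! ### A structured programming language for stack machines -/

/-- Structured programs that act on stacks of symbols. -/
inductive Prog (K : Type) : Type
  | skip
  /-- push `a` onto the stack `k` -/
  | push (k : K) (a : Sym)
  /-- remove the top of the stack `k` -/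
  | drop (k : K)
  /-- empty the stack `k` -/
  | clear (k : K)
  | seq (p q : Prog K)
  /-- choose a program depending on the top of the stack `k` -/
  | case (k : K) (f : Option Sym → Prog K)
  /-- run `f a` for all symbols `a` of the stack `k` from top to bottom -/
  | each (k : K) (f : Sym → Prog K)

namespace Prog

variable {K : Type}

/-- The program mentions the stack `k`. -/
def Uses (k : K) : Prog K → Prop
  | skip => False
  | push j _ => k = j
  | drop j => k = j
  | clear j => k = j
  | seq p q => p.Uses k ∨ q.Uses k
  | case j f => k = j ∨ ∃ o, (f o).Uses k
  | each j f => k = j ∨ ∃ a, (f a).Uses k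

/-- Loops over a stack do not mention this stack in their body. -/
def WF : Prog K → Prop
  | skip => True
  | push _ _ => True
  | drop _ => True
  | clear _ => True
  | seq p q => p.WF ∧ q.WF
  | case _ f => ∀ o, (f o).WF
  | each k f => ∀ a, (f a).WF ∧ ¬ (f a).Uses k

/-- The program transforms the stacks `S` into `S'`, and all stacks that are traversed on the way
have at most `B` entries. -/
def Runs [DecidableEq K] (B : ℕ) : Prog K → (K → List Sym) → (K → List Sym) → Prop
  | skip, S, S' => S' = S
  | push k a, S, S' => S' = Function.update S k (a :: S k)
  | drop k, S, S' => S' = Function.update S k (S k).tail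
  | clear k, S, S' => (S k).length ≤ B ∧ S' = Function.update S k []
  | seq p q, S, S' => ∃ S₁, p.Runs B S S₁ ∧ q.Runs B S₁ S'
  | case k f, S, S' => (f (S k).head?).Runs B S S'
  | each k f, S, S' => (S k).length ≤ B ∧ ∃ σ : ℕ → K → List Sym, σ 0 = S ∧
      σ (S k).length = S' ∧ ∀ i a, (S k)[i]? = some a → (f a).Runs B (σ i) (σ (i + 1))

/-- A bound for the number of steps, in terms of a bound for the traversed stacks. -/
def bound : Prog K → Polynomial ℕ
  | skip => 1
  | push _ _ => 1
  | drop _ => 1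
  | clear _ => Polynomial.X + 1
  | seq p q => p.bound + q.bound
  | case _ f => 1 + ∑ o, (f o).bound
  | each _ f => Polynomial.X * (2 + ∑ a, (f a).bound) + 2

/-- The labels of the stack machine for a program. -/
def Lab : Prog K → Type
  | skip => Unit
  | push _ _ => Unit
  | drop _ => Unit
  | clear _ => Unit
  | seq p q => p.Lab ⊕ q.Lab
  | case _ f => Option (Σ o, (f o).Lab)
  | each _ f => Bool ⊕ (Σ a, (f a).Lab)

instance fintypeLab : (p : Prog K) → Fintype p.Lab
  | skip => inferInstanceAs (Fintype Unit)
  | push _ _ => inferInstanceAs (Fintype Unit)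
  | drop _ => inferInstanceAs (Fintype Unit)
  | clear _ => inferInstanceAs (Fintype Unit)
  | seq p q =>
    letI := fintypeLab p
    letI := fintypeLab q
    inferInstanceAs (Fintype (p.Lab ⊕ q.Lab))
  | case _ f =>
    letI := fun o => fintypeLab (f o)
    inferInstanceAs (Fintype (Option (Σ o, (f o).Lab)))
  | each _ f =>
    letI := fun o => fintypeLab (f o)
    inferInstanceAs (Fintype (Bool ⊕ (Σ a, (f a).Lab)))

/-- The label at which a program starts. -/
def entry : (p : Prog K) → p.Lab
  | skip => ()
  | push _ _ => ()
  | drop _ => ()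
  | clear _ => ()
  | seq p _ => .inl p.entry
  | case _ _ => none
  | each _ _ => .inl false

variable {Λ : Type}

/-- The code of the stack machine for a program that is followed by the code at label `e`. Every
stack of the program comes with a second stack that keeps the traversed symbols. -/
def code : (p : Prog K) → (p.Lab → Λ) → Λ → p.Lab →
    TM2.Stmt (fun _ : K × Bool => Sym) Λ (Option Sym)
  | skip, _, e, _ => .goto fun _ => e
  | push k a, _, e, _ => .push (k, false) (fun _ => a) (.goto fun _ => e)
  | drop k, _, e, _ => .pop (k, false) (fun v _ => v) (.goto fun _ => e)
  | clear k, emb, e, _ => .pop (k, false) (fun _ o => o)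
      (.branch (fun v => v.isNone) (.goto fun _ => e) (.goto fun _ => emb ()))
  | seq p q, emb, _, .inl x => p.code (fun x => emb (.inl x)) (emb (.inr q.entry)) x
  | seq _ q, emb, e, .inr x => q.code (fun x => emb (.inr x)) e x
  | case k f, emb, _, none => .peek (k, false) (fun _ o => o)
      (.goto fun v => emb (some ⟨v, (f v).entry⟩))
  | case _ f, emb, e, some ⟨o, x⟩ => (f o).code (fun x => emb (some ⟨o, x⟩)) e x
  | each k f, emb, _, .inl false => .pop (k, false) (fun _ o => o)
      (.branch (fun v => v.isNone) (.goto fun _ => emb (.inl true))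
        (.push (k, true) (fun v => v.getD .tick)
          (.goto fun v => emb (.inr ⟨v.getD .tick, (f (v.getD .tick)).entry⟩))))
  | each k _, emb, e, .inl true => .pop (k, true) (fun _ o => o)
      (.branch (fun v => v.isNone) (.goto fun _ => e)
        (.push (k, false) (fun v => v.getD .tick) (.goto fun _ => emb (.inl true))))
  | each _ f, emb, _, .inr ⟨a, x⟩ => (f a).code (fun x => emb (.inr ⟨a, x⟩)) (emb (.inl false)) x

variable [DecidableEq K]

/-- Frame property: it makes the stack of a loop constant during the loop and lets the correctness
of subprograms be stated on their own stacks. -/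
theorem Runs.eq_of_not_uses {B : ℕ} {p : Prog K} {S S' : K → List Sym} (h : p.Runs B S S') {k : K}
    (hk : ¬ p.Uses k) : S' k = S k := by
  induction p generalizing S S' with
  | skip => rw [show S' = S from h]
  | push j a => rw [show S' = _ from h]; exact Function.update_of_ne hk _ _
  | drop j => rw [show S' = _ from h]; exact Function.update_of_ne hk _ _
  | clear j => rw [show S' = _ from h.2]; exact Function.update_of_ne hk _ _
  | seq p q ihp ihq =>
    obtain ⟨S₁, h1, h2⟩ := h
    rw [ihq h2 fun h => hk (Or.inr h), ihp h1 fun h => hk (Or.inl h)]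
  | case j f ih => exact ih _ h fun h => hk (Or.inr ⟨_, h⟩)
  | each j f ih =>
    obtain ⟨-, σ, h0, h1, h2⟩ := h
    have : ∀ i ≤ (S j).length, σ i k = S k := by
      intro i hi
      induction i with
      | zero => rw [h0]
      | succ i ihi =>
        rw [ih _ (h2 i _ (List.getElem?_eq_getElem (by omega))) fun h => hk (Or.inr ⟨_, h⟩)]
        exact ihi (by omega)
    rw [← h1]
    exact this _ le_rfl

/-- The machine gets from the configuration `c` to `c'` in at most `n` steps. -/
def Reaches (m : Λ → TM2.Stmt (fun _ : K × Bool => Sym) Λ (Option Sym)) (n : ℕ)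
    (c c' : TM2.Cfg (fun _ : K × Bool => Sym) Λ (Option Sym)) : Prop :=
  ∃ t ≤ n, (flip bind (TM2.step m))^[t] (some c) = some c'

variable {m : Λ → TM2.Stmt (fun _ : K × Bool => Sym) Λ (Option Sym)}
  {c c' c'' : TM2.Cfg (fun _ : K × Bool => Sym) Λ (Option Sym)} {n n' : ℕ}

theorem Reaches.refl : Reaches m 0 c c := ⟨0, le_rfl, rfl⟩

theorem Reaches.trans (h : Reaches m n c c') (h' : Reaches m n' c' c'') :
    Reaches m (n + n') c c'' := by
  obtain ⟨t, ht, e⟩ := h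
  obtain ⟨t', ht', e'⟩ := h'
  exact ⟨t' + t, by omega, by rw [Function.iterate_add_apply, e, e']⟩

theorem Reaches.mono (h : Reaches m n c c') (hn : n ≤ n') : Reaches m n' c c' := by
  obtain ⟨t, ht, e⟩ := h
  exact ⟨t, ht.trans hn, e⟩

theorem reaches_one {l : Λ} {s : TM2.Stmt (fun _ : K × Bool => Sym) Λ (Option Sym)} (h : m l = s)
    (v : Option Sym) (S : K × Bool → List Sym) :
    Reaches m 1 ⟨some l, v, S⟩ (TM2.stepAux s v S) := ⟨1, le_rfl, h ▸ rfl⟩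

/-- The stacks of the machine hold the stacks `S`, as far as they are in the set `U`. -/
def Holds (U : K → Prop) (T : K × Bool → List Sym) (S : K → List Sym) : Prop :=
  ∀ k, U k → T (k, false) = S k ∧ T (k, true) = []

theorem reaches_clear {l e : Λ} {k : K}
    (h : m l = .pop (k, false) (fun _ o => o)
      (.branch (fun v => v.isNone) (.goto fun _ => e) (.goto fun _ => l)))
    (v : Option Sym) (T : K × Bool → List Sym) :
    ∃ v', Reaches m ((T (k, false)).length + 1) ⟨some l, v, T⟩
      ⟨some e, v', Function.update T (k, false) []⟩ := by
  generalize hx : T (k, false) = x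
  induction x generalizing v T with
  | nil =>
    have := reaches_one (m := m) h v T
    simp only [TM2.stepAux, hx, List.head?_nil, List.tail_nil, Option.isNone_none, cond_true] at this
    exact ⟨_, this⟩
  | cons a x ih =>
    have := reaches_one (m := m) h v T
    simp only [TM2.stepAux, hx, List.head?_cons, List.tail_cons, Option.isNone_some, cond_false]
      at this
    obtain ⟨v', h'⟩ := ih (some a) (Function.update T (k, false) x) (by simp)
    rw [Function.update_idem] at h'
    refine ⟨v', (this.trans h').mono ?_⟩
    simp only [List.length_cons]
    omega

theorem reaches_restore {l e : Λ} {k : K}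
    (h : m l = .pop (k, true) (fun _ o => o)
      (.branch (fun v => v.isNone) (.goto fun _ => e)
        (.push (k, false) (fun v => v.getD .tick) (.goto fun _ => l))))
    (v : Option Sym) (T : K × Bool → List Sym) :
    ∃ v' T', Reaches m ((T (k, true)).length + 1) ⟨some l, v, T⟩ ⟨some e, v', T'⟩ ∧
      T' (k, true) = [] ∧ T' (k, false) = (T (k, true)).reverse ++ T (k, false) ∧
      ∀ j b, j ≠ k → T' (j, b) = T (j, b) := by
  generalize hx : T (k, true) = x
  have h1 := reaches_one (m := m) h v T
  induction x generalizing v T with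
  | nil =>
    simp only [TM2.stepAux, hx, List.head?_nil, List.tail_nil, Option.isNone_none, cond_true] at h1
    exact ⟨_, _, h1, by simp, by simp, fun j b hj => by simp [hj]⟩
  | cons a x ih =>
    simp only [TM2.stepAux, hx, List.head?_cons, List.tail_cons, Option.isNone_some, cond_false,
      Option.getD_some] at h1
    have h2 := reaches_one (m := m) h (some a)
      (Function.update (Function.update T (k, true) x) (k, false) (a :: Function.update T (k, true) x (k, false)))
    obtain ⟨v', T', hr, e1, e2, e3⟩ := ih _ _ (by simp) h2
    refine ⟨v', T', (h1.trans hr).mono (by simp only [List.length_cons]; omega), e1, ?_, ?_⟩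
    · simp [e2]
    · intro j b hj
      simp [e3 j b hj, hj]

/-- Correctness of the compilation, by induction on the program. The shadow stack `(k, true)` is
empty outside the loops over `k`; as loop bodies do not use the loop stack, one shadow stack per
stack is enough. -/
theorem reaches_code {B : ℕ} (p : Prog K) (emb : p.Lab → Λ) (e : Λ)
    (h : ∀ x, m (emb x) = p.code emb e x) (hwf : p.WF) {S S' : K → List Sym} (hr : p.Runs B S S')
    (T : K × Bool → List Sym) (hT : Holds p.Uses T S) (v : Option Sym) :
    ∃ v' T', Reaches m (p.bound.eval B) ⟨some (emb p.entry), v, T⟩ ⟨some e, v', T'⟩ ∧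
      Holds p.Uses T' S' ∧ ∀ k b, ¬ p.Uses k → T' (k, b) = T (k, b) := by
  induction p generalizing e S S' T v with
  | skip =>
    have h1 := reaches_one (m := m) (h ()) v T
    exact ⟨_, _, by rw [bound, Polynomial.eval_one]; exact h1, fun k hk => hk.elim, fun _ _ _ => rfl⟩
  | push k a =>
    have h1 := reaches_one (m := m) (h ()) v T
    simp only [code, TM2.stepAux] at h1
    refine ⟨_, _, by rw [bound, Polynomial.eval_one]; exact h1, ?_, ?_⟩
    · rintro j (rfl : j = k)
      rw [show S' = _ from hr]
      simp [(hT j rfl).1, (hT j rfl).2]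
    · intro j b (hj : j ≠ k)
      simp [hj]
  | drop k =>
    have h1 := reaches_one (m := m) (h ()) v T
    simp only [code, TM2.stepAux] at h1
    refine ⟨_, _, by rw [bound, Polynomial.eval_one]; exact h1, ?_, ?_⟩
    · rintro j (rfl : j = k)
      rw [show S' = _ from hr]
      simp [(hT j rfl).1, (hT j rfl).2]
    · intro j b (hj : j ≠ k)
      simp [hj]
  | clear k =>
    obtain ⟨v', h1⟩ := reaches_clear (m := m) (h ()) v T
    refine ⟨v', _, h1.mono ?_, ?_, ?_⟩
    · simp only [bound, Polynomial.eval_add, Polynomial.eval_X, Polynomial.eval_one]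
      rw [(hT k rfl).1]
      exact Nat.succ_le_succ hr.1
    · rintro j (rfl : j = k)
      rw [show S' = _ from hr.2]
      simp [(hT j rfl).2]
    · intro j b (hj : j ≠ k)
      simp [hj]
  | seq p q ihp ihq =>
    obtain ⟨S₁, hr1, hr2⟩ := hr
    obtain ⟨v₁, T₁, h1, g1, g1'⟩ := ihp (fun x => emb (.inl x)) (emb (.inr q.entry))
      (fun x => h (.inl x)) hwf.1 hr1 T (fun k hk => hT k (Or.inl hk)) v
    have hT1 : ∀ k, p.Uses k ∨ q.Uses k → T₁ (k, false) = S₁ k ∧ T₁ (k, true) = [] := by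
      intro k hk
      by_cases hp : p.Uses k
      · exact g1 k hp
      · rw [g1' k _ hp, g1' k _ hp, hr1.eq_of_not_uses hp]
        exact hT k hk
    obtain ⟨v₂, T₂, h2, g2, g2'⟩ := ihq (fun x => emb (.inr x)) e
      (fun x => h (.inr x)) hwf.2 hr2 T₁ (fun k hk => hT1 k (Or.inr hk)) v₁
    refine ⟨v₂, T₂, ?_, ?_, ?_⟩
    · rw [bound, Polynomial.eval_add]
      exact h1.trans h2
    · intro k hk
      by_cases hq : q.Uses k
      · exact g2 k hq
      · rw [g2' k _ hq, g2' k _ hq, hr2.eq_of_not_uses hq]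
        exact hT1 k hk
    · intro k b hk
      rw [g2' k b fun h => hk (Or.inr h), g1' k b fun h => hk (Or.inl h)]
  | case k f ih =>
    have h1 := reaches_one (m := m) (h none) v T
    simp only [code, TM2.stepAux] at h1
    rw [(hT k (Or.inl rfl)).1] at h1
    have hr' : (f (S k).head?).Runs B S S' := hr
    obtain ⟨v₁, T₁, h2, g, g'⟩ := ih (S k).head? (fun x => emb (some ⟨_, x⟩)) e
      (fun x => h (some ⟨_, x⟩)) (hwf _) hr' T (fun j hj => hT j (Or.inr ⟨_, hj⟩)) (S k).head?
    refine ⟨v₁, T₁, (h1.trans h2).mono ?_, ?_, ?_⟩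
    · simp only [bound, Polynomial.eval_add, Polynomial.eval_one, Polynomial.eval_finsetSum]
      exact Nat.add_le_add_left (Finset.single_le_sum (f := fun o => (f o).bound.eval B)
        (fun _ _ => Nat.zero_le _) (Finset.mem_univ _)) 1
    · intro j hj
      by_cases hu : (f (S k).head?).Uses j
      · exact g j hu
      · rw [g' j _ hu, g' j _ hu, hr'.eq_of_not_uses hu]
        exact hT j hj
    · intro j b hj
      exact g' j b fun h => hj (Or.inr ⟨_, h⟩)
  | each k f ih =>
    obtain ⟨hB, σ, h0, h1, h2⟩ := hr
    generalize hx : S k = x at *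
    -- Loop invariant: after `i` rounds the first `i` symbols lie reversed on the shadow stack and
    -- the rest is still on the main stack.
    have key : ∀ i ≤ x.length, ∃ v' T', Reaches m (i * (1 + ∑ a, (f a).bound.eval B))
        ⟨some (emb (.inl false)), v, T⟩ ⟨some (emb (.inl false)), v', T'⟩ ∧
        T' (k, false) = x.drop i ∧ T' (k, true) = (x.take i).reverse ∧
        Holds (fun j => ∃ a, (f a).Uses j) T' (σ i) ∧
        ∀ j b, j ≠ k → (¬ ∃ a, (f a).Uses j) → T' (j, b) = T (j, b) := by
      intro i hi
      induction i with
      | zero =>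
        refine ⟨v, T, by rw [zero_mul]; exact .refl, ?_, ?_, ?_, fun _ _ _ _ => rfl⟩
        · rw [(hT k (Or.inl rfl)).1, hx]; rfl
        · rw [(hT k (Or.inl rfl)).2]; rfl
        · rw [h0]; exact fun j hj => hT j (Or.inr hj)
      | succ i ihi =>
        obtain ⟨v₁, T₁, r1, e1, e2, e3, e4⟩ := ihi (by omega)
        have hi' : i < x.length := by omega
        have r2 := reaches_one (m := m) (h (.inl false)) v₁ T₁
        have hd : x.drop i = x[i] :: x.drop (i + 1) := List.drop_eq_getElem_cons hi'
        simp only [code, TM2.stepAux] at r2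
        rw [e1, hd] at r2
        simp only [List.head?_cons, List.tail_cons, Option.isNone_some, cond_false,
          Option.getD_some] at r2
        have hne : ∀ {j a}, (f a).Uses j → j ≠ k := fun {j a} hj hk => (hwf a).2 (hk ▸ hj)
        obtain ⟨v₂, T₂, r3, g, g'⟩ := ih x[i] (fun y => emb (.inr ⟨x[i], y⟩)) (emb (.inl false))
          (fun y => h (.inr ⟨x[i], y⟩)) (hwf _).1
          (h2 i x[i] (List.getElem?_eq_getElem hi')) 
          (Function.update (Function.update T₁ (k, false) (x.drop (i + 1))) (k, true)
            (x[i] :: Function.update T₁ (k, false) (x.drop (i + 1)) (k, true)))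
          (fun j hj => by simpa [hne hj] using e3 j ⟨_, hj⟩) (some x[i])
        have hk := (hwf x[i]).2
        refine ⟨v₂, T₂, ((r1.trans r2).trans r3).mono ?_, ?_, ?_, ?_, ?_⟩
        · have := Finset.single_le_sum (f := fun o => (f o).bound.eval B)
            (fun _ _ => Nat.zero_le _) (Finset.mem_univ x[i])
          rw [Nat.succ_mul]
          omega
        · simp [g' k _ hk]
        · rw [g' k _ hk]
          rw [Function.update_self, Function.update_of_ne (by simp), e2,
            List.take_succ_eq_append_getElem hi', List.reverse_append]
          rfl
        · intro j hj
          have hjk : j ≠ k := by obtain ⟨a, ha⟩ := hj; exact hne ha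
          by_cases hu : (f x[i]).Uses j
          · exact g j hu
          · rw [g' j _ hu, g' j _ hu,
              (h2 i x[i] (List.getElem?_eq_getElem hi')).eq_of_not_uses hu]
            simpa [hjk] using e3 j hj
        · intro j b hjk hj
          rw [g' j b fun hu => hj ⟨_, hu⟩]
          simpa [hjk] using e4 j b hjk hj
    obtain ⟨v₁, T₁, r1, e1, e2, e3, e4⟩ := key x.length le_rfl
    rw [List.drop_length] at e1
    rw [List.take_length] at e2
    have r2 := reaches_one (m := m) (h (.inl false)) v₁ T₁
    simp only [code, TM2.stepAux, e1, List.head?_nil, List.tail_nil, Option.isNone_none,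
      cond_true] at r2
    -- The traversed stack is poured back from the shadow stack, so a loop leaves its stack
    -- unchanged.
    obtain ⟨v₂, T₂, r3, g1, g2, g3⟩ := reaches_restore (m := m) (h (.inl true)) none
      (Function.update T₁ (k, false) [])
    have hne : ∀ {j}, (∃ a, (f a).Uses j) → j ≠ k :=
      fun {j} ⟨a, hj⟩ hk => (hwf a).2 (hk ▸ hj)
    have hS' : S' k = x := by
      rw [← hx]
      rw [← h1]
      have : ∀ i ≤ x.length, σ i k = S k := by
        intro i hi
        induction i with
        | zero => rw [h0]
        | succ i ihi =>
          rw [(h2 i _ (List.getElem?_eq_getElem (by omega))).eq_of_not_uses (hwf _).2]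
          exact ihi (by omega)
      exact this _ le_rfl
    refine ⟨v₂, T₂, ((r1.trans r2).trans r3).mono ?_, ?_, ?_⟩
    · simp only [bound, Polynomial.eval_add, Polynomial.eval_mul, Polynomial.eval_X,
        Polynomial.eval_ofNat, Polynomial.eval_finsetSum]
      simp only [Function.update_of_ne (show (k, true) ≠ (k, false) by simp), e2,
        List.length_reverse]
      have : x.length * (2 + ∑ a, (f a).bound.eval B) ≤ B * (2 + ∑ a, (f a).bound.eval B) :=
        Nat.mul_le_mul_right _ hB
      simp only [mul_add] at this ⊢
      omega
    · intro j hj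
      by_cases hjk : j = k
      · subst hjk
        refine ⟨?_, g1⟩
        rw [g2, hS']
        simp [e2]
      · have hj' : ∃ a, (f a).Uses j := hj.resolve_left hjk
        rw [g3 j _ hjk, g3 j _ hjk, ← h1]
        simpa [hjk] using e3 j hj'
    · intro j b hj
      have hjk : j ≠ k := fun h => hj (Or.inl h)
      rw [g3 j b hjk]
      simpa [hjk] using e4 j b hjk fun h => hj (Or.inr h)

end Prog

end

/-! ### Polynomial time from programs for stack machines -/

section

open Turing

namespace Prog

variable {K : Type} [DecidableEq K] [Fintype K]

/-- The stack machine that runs a program and then halts. -/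
def machine (p : Prog K) (i o : K) : FinTM2 :=
  letI := p.fintypeLab
  { K := K × Bool
    k₀ := (i, false)
    k₁ := (o, false)
    Γ := fun _ => Sym
    Λ := Option p.Lab
    main := some p.entry
    σ := Option Sym
    initialState := none
    Γk₀Fin := inferInstanceAs (Fintype Sym)
    m := fun l => match l with
      -- The halting configuration must have the initial internal state, so the register is reset by
      -- an extra final step.
      | none => .load (fun _ => none) .halt
      | some x => p.code some none x }

theorem initList_machine (p : Prog K) (i o : K) (s : List Sym) :
    initList (p.machine i o) s = (⟨some (some p.entry), none, fun q => if q = (i, false) then s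
      else []⟩ : TM2.Cfg (fun _ : K × Bool => Sym) (Option p.Lab) (Option Sym)) := by
  have : (initList (p.machine i o) s).stk =
      fun q : K × Bool => if q = (i, false) then s else [] := by
    funext q
    by_cases hq : q = (i, false)
    · subst hq
      exact (dif_pos rfl).trans (if_pos rfl).symm
    · exact (dif_neg hq).trans (if_neg hq).symm
  exact congrArg (fun S => (⟨some (some p.entry), none, S⟩ :
    TM2.Cfg (fun _ : K × Bool => Sym) (Option p.Lab) (Option Sym))) this

theorem haltList_machine (p : Prog K) (i o : K) (s : List Sym) :
    haltList (p.machine i o) s = (⟨none, none, fun q => if q = (o, false) then s else []⟩ :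
      TM2.Cfg (fun _ : K × Bool => Sym) (Option p.Lab) (Option Sym)) := by
  have : (haltList (p.machine i o) s).stk =
      fun q : K × Bool => if q = (o, false) then s else [] := by
    funext q
    by_cases hq : q = (o, false)
    · subst hq
      exact (dif_pos rfl).trans (if_pos rfl).symm
    · exact (dif_neg hq).trans (if_neg hq).symm
  exact congrArg (fun S => (⟨none, none, S⟩ :
    TM2.Cfg (fun _ : K × Bool => Sym) (Option p.Lab) (Option Sym))) this

theorem isPolyTime_of_runs (p : Prog K) (hp : p.WF) (i o : K) (P : Polynomial ℕ)
    {F : CircuitPair × ℕ → CircuitPair}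
    (h : ∀ I, p.Runs (P.eval (encodeInput I).length) (fun k => if k = i then encodeInput I else [])
      (fun k => if k = o then (F I).encode else [])) : IsPolyTime F := by
  suffices H : ∀ I, Nonempty (TM2OutputsInTime (p.machine i o) (encodeInput I)
      (some (F I).encode) ((p.bound.comp P + 1).eval (encodeInput I).length)) from
    ⟨⟨⟨p.machine i o, Equiv.refl Sym, Equiv.refl Sym⟩, p.bound.comp P + 1, fun I => by
      have := Classical.choice (H I)
      have e : ∀ s : List Sym, List.map (Equiv.refl Sym).invFun s = s := fun s => List.map_id s
      dsimp only
      erw [e, e]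
      exact this⟩⟩
  intro I
  obtain ⟨v', T', ⟨t, ht, hr⟩, h1, h2⟩ := reaches_code (m := (p.machine i o).m) p some none
    (fun x => rfl) hp (h I) (fun q => if q = (i, false) then encodeInput I else [])
    (fun k _ => ⟨by simp, by simp⟩) none
  -- The additional step is the one that resets the register and halts.
  refine ⟨⟨⟨1 + t, ?_⟩, ?_⟩⟩
  · refine Eq.trans ?_ (congrArg some (haltList_machine p i o _).symm)
    rw [initList_machine, Function.iterate_add_apply]
    refine (congrArg _ hr).trans ?_
    refine congrArg (fun S => some (⟨none, none, S⟩ :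
      TM2.Cfg (fun _ : K × Bool => Sym) (Option p.Lab) (Option Sym))) ?_
    funext ⟨k, b⟩
    by_cases hk : p.Uses k
    · cases b
      · rw [(h1 k hk).1]; simp
      · rw [(h1 k hk).2]; simp
    · rw [h2 k b hk]
      have := (h I).eq_of_not_uses hk
      cases b
      · simpa using this.symm
      · simp
  · rw [Polynomial.eval_add, Polynomial.eval_comp, Polynomial.eval_one]
    show 1 + t ≤ _
    omega

end Prog

end

section

/-! ### Writing descriptions of circuits -/

/-- The stacks of the polarization program. -/
inductive Stk : Type
  | inp | out | mode | q1 | q2 | ck | dk | cl | dl | i | o | s | a | b | par | len | r | kk | t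
  deriving DecidableEq

instance : Fintype Stk where
  elems := {.inp, .out, .mode, .q1, .q2, .ck, .dk, .cl, .dl, .i, .o, .s, .a, .b, .par, .len, .r,
    .kk, .t}
  complete k := by cases k <;> decide

/-- The number `n` in unary. -/
def ticks (n : ℕ) : List Sym := List.replicate n Sym.tick

theorem length_ticks (n : ℕ) : (ticks n).length = n := List.length_replicate

theorem ticks_add (m n : ℕ) : ticks (m + n) = ticks m ++ ticks n :=
  List.replicate_add _ _ _

theorem ticks_succ (n : ℕ) : ticks (n + 1) = .tick :: ticks n := rfl

theorem unary_add (m n : ℕ) : unary (m + n) = ticks m ++ unary n := by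
  rw [unary, unary, ticks, List.replicate_add, List.append_assoc]

/-- The stacks `S`, with other entries on the stacks `out`, `i` and `o`. -/
def emState (S : Stk → List Sym) (O I : ℕ) (x : List Sym) : Stk → List Sym
  | .out => x
  | .i => ticks I
  | .o => ticks O
  | k => S k

variable {S : Stk → List Sym} {O I B : ℕ}

theorem update_out (x y : List Sym) :
    Function.update (emState S O I x) .out y = emState S O I y := by
  funext k; cases k <;> rfl

theorem update_i (x : List Sym) (j : ℕ) :
    Function.update (emState S O I x) .i (ticks j) = emState S O j x := by
  funext k; cases k <;> rfl

theorem update_o (x : List Sym) (j : ℕ) :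
    Function.update (emState S O I x) .o (ticks j) = emState S j I x := by
  funext k; cases k <;> rfl

theorem emState_of_ne {k : Stk} (hk : k ≠ .out) (x y : List Sym) :
    emState S O I x k = emState S O I y k := by
  cases k <;> first | rfl | exact absurd rfl hk

/-- All stacks but the output have at most `B` entries. -/
def Small (B : ℕ) (S : Stk → List Sym) (O I : ℕ) : Prop :=
  ∀ k, k ≠ .out → (emState S O I [] k).length ≤ B

/-- The program writes the string `w` in front of the output. -/
def Emits (B : ℕ) (p : Prog Stk) (S : Stk → List Sym) (O I : ℕ) (w : List Sym) : Prop :=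
  ∀ x, p.Runs B (emState S O I x) (emState S O I (w ++ x))

theorem emits_skip : Emits B .skip S O I [] := fun _ => rfl

theorem emits_push (a : Sym) : Emits B (.push .out a) S O I [a] := fun x =>
  (update_out x (a :: x)).symm

/-- The output stack grows at its top, so what is written later comes first. All descriptions are
therefore produced from back to front. -/
theorem Emits.seq {p q : Prog Stk} {v w : List Sym} (hp : Emits B p S O I w)
    (hq : Emits B q S O I v) : Emits B (.seq p q) S O I (v ++ w) := fun x =>
  ⟨_, hp x, by rw [List.append_assoc]; exact hq _⟩

theorem emits_each {k : Stk} (hk : k ≠ .out) {f : Sym → Prog Stk} {g : Sym → List Sym}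
    (hB : (emState S O I [] k).length ≤ B) (hf : ∀ a, Emits B (f a) S O I (g a)) :
    Emits B (.each k f) S O I ((emState S O I [] k).reverse.flatMap g) := by
  intro x
  rw [emState_of_ne hk [] x] at *
  refine ⟨hB, fun j => emState S O I (((emState S O I x k).take j).reverse.flatMap g ++ x), rfl,
    by simp only [List.take_length], ?_⟩
  intro j a ha
  have := hf a (((emState S O I x k).take j).reverse.flatMap g ++ x)
  simp only [List.take_add_one, ha, Option.toList_some, List.reverse_append, List.reverse_singleton,
    List.flatMap_append, List.flatMap_singleton, List.append_assoc]
  exact this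

/-- Writing `n` ticks. -/
def emitConst : ℕ → Prog Stk
  | 0 => .skip
  | n + 1 => .seq (emitConst n) (.push .out .tick)

/-- Writing as many ticks as there are entries on the given stacks. -/
def emitSizes : List Stk → Prog Stk
  | [] => .skip
  | k :: ks => .seq (emitSizes ks) (.each k fun _ => .push .out .tick)

/-- A symbolic wire number: the sum of a constant and of the sizes of some stacks. -/
abbrev Idx : Type := ℕ × List Stk

/-- The value of a symbolic wire number. -/
def idxVal (S : Stk → List Sym) (O I : ℕ) (x : Idx) : ℕ :=
  x.1 + (x.2.map fun k => (emState S O I [] k).length).sum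

/-- Writing a number in unary. -/
def emitIdx (x : Idx) : Prog Stk := .seq (emitSizes x.2) (emitConst x.1)

theorem emits_emitConst (n : ℕ) : Emits B (emitConst n) S O I (ticks n) := by
  induction n with
  | zero => exact emits_skip
  | succ n ih => exact ih.seq (emits_push _)

theorem emits_emitSizes {ks : List Stk} (hk : .out ∉ ks) (hS : Small B S O I) :
    Emits B (emitSizes ks) S O I (ticks (ks.map fun k => (emState S O I [] k).length).sum) := by
  induction ks with
  | nil => exact emits_skip
  | cons k ks ih =>
    have hk' : k ≠ .out := fun h => hk (h ▸ List.mem_cons_self)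
    have := (ih fun h => hk (List.mem_cons_of_mem _ h)).seq
      (emits_each hk' (hS k hk') fun _ => emits_push .tick)
    have h : ∀ x : List Sym, (x.flatMap fun _ => [Sym.tick]) = ticks x.length := by
      intro x
      induction x with
      | nil => rfl
      | cons a x ih => rw [List.flatMap_cons, ih]; rfl
    rw [h, List.length_reverse] at this
    rw [List.map_cons, List.sum_cons, ticks_add]
    exact this

theorem emits_emitIdx {x : Idx} (hx : .out ∉ x.2) (hS : Small B S O I) :
    Emits B (emitIdx x) S O I (ticks (idxVal S O I x)) := by
  rw [idxVal, ticks_add]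
  exact (emits_emitSizes hx hS).seq (emits_emitConst _)

/-- A symbolic gate: the type of the gate and the wires it acts on. -/
abbrev SGate : Type := Sym × List Idx

/-- The description of a symbolic gate. -/
def SGate.encode (S : Stk → List Sym) (O I : ℕ) (g : SGate) : List Sym :=
  g.1 :: g.2.flatMap fun x => unary (idxVal S O I x)

def emitIdxs : List Idx → Prog Stk
  | [] => .skip
  | x :: xs => .seq (emitIdxs xs) (.seq (.push .out .sep) (emitIdx x))

/-- Writing a sequence of gates. -/
def emitGates : List SGate → Prog Stk
  | [] => .skip
  | g :: gs => .seq (emitGates gs) (.seq (emitIdxs g.2) (.push .out g.1))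

theorem emits_emitIdxs {xs : List Idx} (hx : ∀ x ∈ xs, .out ∉ x.2) (hS : Small B S O I) :
    Emits B (emitIdxs xs) S O I (xs.flatMap fun x => unary (idxVal S O I x)) := by
  induction xs with
  | nil => exact emits_skip
  | cons x xs ih =>
    exact (ih fun y hy => hx y (List.mem_cons_of_mem _ hy)).seq
      ((emits_push .sep).seq (emits_emitIdx (hx x List.mem_cons_self) hS))

theorem emits_emitGates {gs : List SGate} (hx : ∀ g ∈ gs, ∀ x ∈ g.2, .out ∉ x.2)
    (hS : Small B S O I) : Emits B (emitGates gs) S O I (gs.flatMap (SGate.encode S O I)) := by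
  induction gs with
  | nil => exact emits_skip
  | cons g gs ih =>
    exact (ih fun y hy => hx y (List.mem_cons_of_mem _ hy)).seq
      ((emits_emitIdxs (hx g List.mem_cons_self) hS).seq (emits_push g.1))

/-- The symbolic form of the controlled swap gate. -/
def cswapS (i j : Idx) : List SGate :=
  [(.cnot, [j, i]), (.hadamard, [j]), (.phaseT, [(0, [])]), (.phaseT, [i]), (.phaseT, [j]),
    (.cnot, [(0, []), i]), (.pauliX, [i]), (.phaseT, [i]), (.pauliX, [i]), (.cnot, [i, j]),
    (.phaseT, [j]), (.cnot, [(0, []), i]), (.cnot, [(0, []), j]), (.pauliX, [j]), (.phaseT, [j]),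
    (.pauliX, [j]), (.cnot, [i, j]), (.cnot, [(0, []), j]), (.pauliX, [j]), (.phaseT, [j]),
    (.pauliX, [j]), (.cnot, [(0, []), j]), (.hadamard, [j]), (.cnot, [j, i])]

theorem encode_cswapS (i j : Idx) : (cswapS i j).flatMap (SGate.encode S O I) =
    encodeList (cswapGates (idxVal S O I i) (idxVal S O I j)) := by
  have h0 : idxVal S O I (0, []) = 0 := rfl
  simp [cswapS, SGate.encode, encodeList, cswapGates, toffoliGates, cczGates, RGate.encode, h0]

/-- Running `f` for `j = n - 1, …, 0`, where the stack `i` has size `j`. -/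
theorem emits_countdown {k : Stk} (hk : k ≠ .out) (hki : k ≠ .i) {p : Prog Stk} {f : ℕ → List Sym}
    {n : ℕ} (hn : (emState S O 0 [] k).length = n) (hB : n ≤ B)
    (hp : ∀ j < n, Emits B p S O j (f j)) (x : List Sym) :
    Prog.Runs B (.each k fun _ => .seq (.drop .i) p) (emState S O n x)
      (emState S O 0 ((List.range n).flatMap f ++ x)) := by
  have hS : ∀ J x, emState S O J x k = emState S O 0 [] k := by
    intro J x
    cases k <;> first | rfl | exact absurd rfl hk | exact absurd rfl hki
  -- After `m` rounds the blocks `n - m, …, n - 1` have been written, in increasing order from the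
  -- top.
  refine ⟨by rw [hS, hn]; exact hB, fun m => emState S O (n - m)
    ((List.range' (n - m) m).flatMap f ++ x), rfl, ?_, ?_⟩
  · simp only [hS, hn, Nat.sub_self, List.range_eq_range']
  · intro m a ha
    rw [hS] at ha
    have hm : m < n := by
      rw [← hn]
      exact (List.getElem?_eq_some_iff.1 ha).1
    refine ⟨_, rfl, ?_⟩
    have e : (emState S O (n - m) ((List.range' (n - m) m).flatMap f ++ x) .i).tail =
        ticks (n - (m + 1)) := by
      rw [show n - m = n - (m + 1) + 1 by omega]
      rfl
    simp only [e, update_i]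
    have := hp (n - (m + 1)) (by omega) ((List.range' (n - m) m).flatMap f ++ x)
    rw [List.range'_succ, List.flatMap_cons, List.append_assoc,
      show n - (m + 1) + 1 = n - m by omega]
    exact this

theorem runs_fill_i {k : Stk} (hk : k ≠ .out) (hki : k ≠ .i) {n : ℕ}
    (hn : (emState S O 0 [] k).length = n) (hB : n ≤ B) (x : List Sym) :
    Prog.Runs B (.each k fun _ => .push .i .tick) (emState S O 0 x) (emState S O n x) := by
  have hS : ∀ J x, emState S O J x k = emState S O 0 [] k := by
    intro J x
    cases k <;> first | rfl | exact absurd rfl hk | exact absurd rfl hki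
  refine ⟨by rw [hS, hn]; exact hB, fun m => emState S O m x, rfl, by rw [hS, hn], ?_⟩
  intro m a ha
  exact (update_i x (m + 1)).symm

theorem runs_fill_o {k : Stk} (hk : k ≠ .out) (hko : k ≠ .o) {n : ℕ}
    (hn : (emState S 0 I [] k).length = n) (hB : n ≤ B) (x : List Sym) :
    Prog.Runs B (.each k fun _ => .push .o .tick) (emState S O I x) (emState S (O + n) I x) := by
  have hS : ∀ J x, emState S J I x k = emState S 0 I [] k := by
    intro J x
    cases k <;> first | rfl | exact absurd rfl hk | exact absurd rfl hko
  refine ⟨by rw [hS, hn]; exact hB, fun m => emState S (O + m) I x, rfl, by rw [hS, hn], ?_⟩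
  intro m a ha
  exact (update_o x (O + m + 1)).symm

/-- Writing a circuit, given in reverse on the stack `k`, on wires moved by `x`. -/
def emitShifted (k : Stk) (x : Idx) : Prog Stk :=
  .each k fun a => .seq (.push .out a) (if a = .sep then emitIdx x else .skip)

/-- Each wire number ends with a separator, so moving all wires by `o` inserts `o` ticks before
every separator. No parsing of gates is needed. -/
theorem encodeList_map_shift (w : List RGate) (o : ℕ) : encodeList (w.map (RGate.shift o)) =
    (encodeList w).flatMap fun a => if a = .sep then ticks o ++ [a] else [a] := by
  have hu : ∀ i, (unary i).flatMap (fun a => if a = .sep then ticks o ++ [a] else [a]) =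
      unary (o + i) := by
    intro i
    rw [add_comm, unary_add]
    induction i with
    | zero => simp [unary, ticks]
    | succ i ih =>
      rw [ticks_succ, List.cons_append, ← ih]
      rfl
  induction w with
  | nil => rfl
  | cons g w ih =>
    rw [encodeList, List.map_cons, List.flatMap_cons, encodeList, List.flatMap_cons,
      List.flatMap_append]
    refine congrArg₂ _ ?_ ih
    cases g <;> simp [RGate.encode, RGate.shift, hu]

theorem emits_emitShifted {k : Stk} (hk : k ≠ .out) {x : Idx} (hx : .out ∉ x.2)
    (hS : Small B S O I) {w : List RGate} (hw : emState S O I [] k = (encodeList w).reverse) :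
    Emits B (emitShifted k x) S O I (encodeList (w.map (RGate.shift (idxVal S O I x)))) := by
  rw [encodeList_map_shift]
  have := emits_each (g := fun a => if a = .sep then ticks (idxVal S O I x) ++ [a] else [a])
    (f := fun a => .seq (.push .out a) (if a = .sep then emitIdx x else .skip)) hk (hS k hk) ?_
  · rw [hw, List.reverse_reverse] at this
    exact this
  · intro a
    split_ifs with h
    · exact (emits_push a).seq (emits_emitIdx hx hS)
    · exact (emits_push a).seq emits_skip

end

section

/-! ### Writing the polarized circuits -/

variable {S : Stk → List Sym} {B N : ℕ}

/-- The program writes `f O` and adds `d` to the size `O` of the stack `o`, provided that this size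
remains below `N`. -/
def Adds (B N : ℕ) (p : Prog Stk) (S : Stk → List Sym) (d : ℕ) (f : ℕ → List Sym) : Prop :=
  ∀ O x, O + d ≤ N → p.Runs B (emState S O 0 x) (emState S (O + d) 0 (f O ++ x))

/-- The stacks that do not change during the writing are small. -/
def SmallBase (B : ℕ) (S : Stk → List Sym) : Prop :=
  ∀ k, k ≠ .out → k ≠ .i → k ≠ .o → (S k).length ≤ B

theorem SmallBase.small (h : SmallBase B S) {O I : ℕ} (hO : O ≤ B) (hI : I ≤ B) :
    Small B S O I := by
  intro k hk
  by_cases hi : k = .i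
  · subst hi; exact (length_ticks I).trans_le hI
  by_cases ho : k = .o
  · subst ho; exact (length_ticks O).trans_le hO
  · convert h k hk hi ho using 2
    cases k <;> first | rfl | exact absurd rfl hk | exact absurd rfl hi | exact absurd rfl ho

theorem emState_of_ne_of_ne {k : Stk} (hk : k ≠ .out) (hi : k ≠ .i) (ho : k ≠ .o) (O I : ℕ)
    (x : List Sym) : emState S O I x k = S k := by
  cases k <;> first | rfl | exact absurd rfl hk | exact absurd rfl hi | exact absurd rfl ho

/-- The recursive gate lists start with the last repetition, and writing is backwards, so the loop
runs through the repetitions in ascending order. The stack `o` holds the number of input wires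
already accounted for, which supplies the offset `d * j` of the next copy. -/
theorem adds_loop {c : Stk} (hc : c ≠ .out) (hi : c ≠ .i) (ho : c ≠ .o) {p W Z : Prog Stk}
    {d n : ℕ} {f z : ℕ → List Sym} {w : List Sym} {F : ℕ → ℕ → List Sym}
    (hn : (S c).length = n) (hB : n ≤ B) (hp : Adds B N p S d f)
    (hW : ∀ O ≤ N, Emits B W S O 0 w) (hZ : ∀ O ≤ N, Emits B Z S O 0 (z O))
    (h0 : ∀ O, F 0 O = z O) (h1 : ∀ j O, F (j + 1) O = w ++ (f (O + d * j) ++ F j O)) :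
    Adds B N (.seq Z (.each c fun _ => .seq p W)) S (d * n) (F n) := by
  intro O x hO
  refine ⟨_, hZ O (by omega) x, ?_⟩
  refine ⟨by rw [emState_of_ne_of_ne hc hi ho, hn]; exact hB,
    fun j => emState S (O + d * j) 0 (F j O ++ x), by simp only [h0]; rfl,
    by rw [emState_of_ne_of_ne hc hi ho, hn], fun j a ha => ?_⟩
  rw [emState_of_ne_of_ne hc hi ho] at ha
  have hj : j < n := hn ▸ (List.getElem?_eq_some_iff.1 ha).1
  have hd : d * (j + 1) ≤ d * n := Nat.mul_le_mul_left _ hj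
  have e : O + d * j + d = O + d * (j + 1) := by ring
  have h2 := hp (O + d * j) (F j O ++ x) (by omega)
  rw [e] at h2
  refine ⟨_, h2, ?_⟩
  simp only [h1, List.append_assoc]
  exact hW _ (by omega) _

/-- The wire `0`. -/
def idx0 : Idx := (0, [])

theorem encodeList_inGates (q E t : ℕ) : encodeList (inGates q E t) =
    (List.range t).flatMap fun j =>
      encodeList (.ancilla (E + j) :: cswapGates (q + j) (E + j)) := by
  induction t generalizing q E with
  | zero => rfl
  | succ t ih =>
    rw [inGates, ← List.cons_append, encodeList_append, ih, List.range_succ_eq_map,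
      List.flatMap_cons, List.flatMap_map]
    simp only [add_zero, Nat.succ_eq_add_one, Nat.add_right_comm _ 1, Nat.add_assoc]

theorem encodeList_outGates (q E t : ℕ) : encodeList (outGates q E t) =
    (List.range t).flatMap fun j =>
      encodeList (cswapGates (q + j) E ++ [.traceOut E]) := by
  induction t generalizing q with
  | zero => rfl
  | succ t ih =>
    rw [outGates, ← List.singleton_append, ← List.append_assoc, encodeList_append, ih,
      List.range_succ_eq_map, List.flatMap_cons, List.flatMap_map]
    simp only [add_zero, Nat.succ_eq_add_one, Nat.add_right_comm _ 1, Nat.add_assoc]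

/-- Writing `selectGates`. -/
def selectP : Prog Stk :=
  .seq (emitGates [(.traceOut, [idx0])]) <|
  .seq (.each .cl fun _ => .push .i .tick) <|
  .seq (.each .cl fun _ => .seq (.drop .i) (emitGates
    (cswapS (4, [.o, .i]) (4, [.o, .dl]) ++ [(.traceOut, [(4, [.o, .dl])])]))) <|
  .seq (emitShifted .q1 (4, [.o])) <|
  .seq (emitShifted .q2 (4, [.o, .dk])) <|
  .seq (.each .ck fun _ => .push .i .tick) <|
  .seq (.each .ck fun _ => .seq (.drop .i) (emitGates
    ((.ancilla, [(4, [.o, .dk, .i])]) :: cswapS (4, [.o, .i]) (4, [.o, .dk, .i])))) <|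
  .each .ck fun _ => .push .o .tick

theorem out_not_mem_cswapS {i j : Idx} (hi : .out ∉ i.2) (hj : .out ∉ j.2) :
    ∀ g ∈ cswapS i j, ∀ x ∈ g.2, Stk.out ∉ x.2 := by
  obtain ⟨i, is⟩ := i
  obtain ⟨j, js⟩ := j
  simp_all [cswapS, or_imp]

/-- The `3` counts the controls of the three enclosing levels (parity, repetition, parity), which
lie after the control of the selector itself; `O` counts the inputs of earlier copies. -/
theorem adds_selectP {k l : ℕ} {w₁ w₂ : List RGate} (hN : N ≤ B) (hS : SmallBase B S)
    (hck : S .ck = ticks k) (hdk : S .dk = ticks k) (hcl : S .cl = ticks l) (hdl : S .dl = ticks l)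
    (h1 : S .q1 = (encodeList w₁).reverse) (h2 : S .q2 = (encodeList w₂).reverse) :
    Adds B N selectP S k fun O => encodeList (selectGates k l w₁ w₂ (3 + O)) := by
  intro O x hO
  have hk : k ≤ B := by have := hS .ck (by decide) (by decide) (by decide); rwa [hck, length_ticks] at this
  have hl : l ≤ B := by have := hS .cl (by decide) (by decide) (by decide); rwa [hcl, length_ticks] at this
  have sm : ∀ {J}, J ≤ B → Small B S O J := fun hJ => hS.small (by omega) hJ
  have v1 : ∀ J, idxVal S O J (4, [.o]) = 1 + (3 + O) := by
    intro J; simp [idxVal, emState, length_ticks]; omega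
  have v2 : ∀ J, idxVal S O J (4, [.o, .i]) = 1 + (3 + O) + J := by
    intro J; simp [idxVal, emState, length_ticks]; omega
  have v3 : ∀ J, idxVal S O J (4, [.o, .dl]) = 1 + (3 + O) + l := by
    intro J; simp [idxVal, emState, length_ticks, hdl]; omega
  have v4 : ∀ J, idxVal S O J (4, [.o, .dk]) = 1 + (3 + O) + k := by
    intro J; simp [idxVal, emState, length_ticks, hdk]; omega
  have v5 : ∀ J, idxVal S O J (4, [.o, .dk, .i]) = 1 + (3 + O) + k + J := by
    intro J; simp [idxVal, emState, length_ticks, hdk]; omega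
  have v0 : ∀ J, idxVal S O J idx0 = 0 := fun J => rfl
  have e1 := emits_emitGates (B := B) (gs := [(.traceOut, [idx0])]) (by simp [idx0])
    (sm (Nat.zero_le B)) x
  refine ⟨_, e1, _, runs_fill_i (by decide) (by decide) (n := l)
    (by show (S .cl).length = l; rw [hcl, length_ticks]) hl _, ?_⟩
  have e2 := emits_countdown (k := .cl) (O := O) (n := l) (by decide) (by decide)
    (by show (S .cl).length = l; rw [hcl, length_ticks]) hl
    (fun j hj => emits_emitGates (gs := cswapS (4, [.o, .i]) (4, [.o, .dl]) ++
      [(.traceOut, [(4, [.o, .dl])])])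
      (by
        intro g hg
        rcases List.mem_append.1 hg with hg | hg
        · exact out_not_mem_cswapS (by simp) (by simp) g hg
        · rw [List.mem_singleton.1 hg]; simp) (sm (J := j) (by omega)))
  refine ⟨_, e2 _, _, emits_emitShifted (k := .q1) (by decide) (by simp) (sm (Nat.zero_le B)) h1 _, _,
    emits_emitShifted (k := .q2) (by decide) (by simp) (sm (Nat.zero_le B)) h2 _, _,
    runs_fill_i (by decide) (by decide) (n := k)
    (by show (S .ck).length = k; rw [hck, length_ticks]) hk _, ?_⟩
  have e3 := emits_countdown (k := .ck) (O := O) (n := k) (by decide) (by decide)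
    (by show (S .ck).length = k; rw [hck, length_ticks]) hk
    (fun j hj => emits_emitGates (gs := (.ancilla, [(4, [.o, .dk, .i])]) ::
      cswapS (4, [.o, .i]) (4, [.o, .dk, .i]))
      (by
        intro g hg
        rcases List.mem_cons.1 hg with rfl | hg
        · simp
        · exact out_not_mem_cswapS (by simp) (by simp) g hg) (sm (J := j) (by omega)))
  refine ⟨_, e3 _, ?_⟩
  have e4 := runs_fill_o (S := S) (O := O) (I := 0) (B := B) (k := .ck) (by decide) (by decide)
    (n := k) (by show (S .ck).length = k; rw [hck, length_ticks]) hk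
  convert e4 _ using 2
  simp only [selectGates, encodeList_append, encodeList_inGates, encodeList_outGates,
    List.flatMap_cons, List.flatMap_append, encode_cswapS, v1, v2, v3, v4, v5,
    List.append_assoc]
  simp [encodeList, SGate.encode, RGate.encode, v0, v3, v5]

/-- Writing `parityGates`, where `c` has the size of the number of repetitions. -/
def parityP (c : Stk) (h : ℕ) (p : Prog Stk) : Prog Stk :=
  .seq (emitGates [(.ancilla, [(1 + h, [.o])]), (.cnot, [idx0, (1 + h, [.o])]), (.traceOut, [idx0])])
    (.each c fun _ => .seq p
      (emitGates [(.ancilla, [idx0]), (.depolarize, [idx0]), (.cnot, [idx0, (1, [])])]))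

/-- Writing `powerGates`, where `c` has the size of the number of repetitions. -/
def powerP (c : Stk) (p : Prog Stk) : Prog Stk :=
  .seq (emitGates [(.traceOut, [idx0])])
    (.each c fun _ => .seq p (emitGates [(.ancilla, [idx0]), (.cnot, [(1, []), idx0])]))

theorem adds_parityP {c : Stk} (hc : c ≠ .out) (hi : c ≠ .i) (ho : c ≠ .o) {p : Prog Stk} {h k n : ℕ}
    {T : ℕ → List RGate} (hN : N ≤ B) (hS : SmallBase B S) (hn : S c = ticks n)
    (hp : Adds B N p S k fun O => encodeList (T (1 + h + O))) :
    Adds B N (parityP c h p) S (k * n) fun O => encodeList (parityGates k T n (h + O)) := by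
  have hB : n ≤ B := by have := hS c hc hi ho; rwa [hn, length_ticks] at this
  have sm : ∀ {O}, O ≤ N → Small B S O 0 := fun hO => hS.small (by omega) (by omega)
  refine adds_loop (F := fun n O => encodeList (parityGates k T n (h + O)))
    (w := encodeList [.ancilla 0, .depolarize 0, .cnot 0 1]) hc hi ho
    (by rw [hn, length_ticks]) hB hp
    (fun O hO => emits_emitGates (gs := [(.ancilla, [idx0]), (.depolarize, [idx0]),
      (.cnot, [idx0, (1, [])])]) (by simp only [List.forall_mem_cons, idx0]; simp) (sm hO))
    (fun O hO => emits_emitGates (gs := [(.ancilla, [(1 + h, [.o])]),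
      (.cnot, [idx0, (1 + h, [.o])]), (.traceOut, [idx0])]) (by simp only [List.forall_mem_cons, idx0]; simp) (sm hO)) ?_ ?_
  · intro O
    simp [parityGates, encodeList, SGate.encode, RGate.encode, idx0, idxVal, emState,
      length_ticks, add_assoc]
  · intro j O
    simp only [parityGates, encodeList_append]
    rw [show 1 + (h + O) + k * j = 1 + h + (O + k * j) by ring]

theorem adds_powerP {c : Stk} (hc : c ≠ .out) (hi : c ≠ .i) (ho : c ≠ .o) {p : Prog Stk} {h k n : ℕ}
    {T : ℕ → List RGate} (hN : N ≤ B) (hS : SmallBase B S) (hn : S c = ticks n)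
    (hp : Adds B N p S k fun O => encodeList (T (1 + h + O))) :
    Adds B N (powerP c p) S (k * n) fun O => encodeList (powerGates k T n (h + O)) := by
  have hB : n ≤ B := by have := hS c hc hi ho; rwa [hn, length_ticks] at this
  have sm : ∀ {O}, O ≤ N → Small B S O 0 := fun hO => hS.small (by omega) (by omega)
  refine adds_loop (F := fun n O => encodeList (powerGates k T n (h + O)))
    (w := encodeList [.ancilla 0, .cnot 1 0]) hc hi ho
    (by rw [hn, length_ticks]) hB hp
    (fun O hO => emits_emitGates (gs := [(.ancilla, [idx0]), (.cnot, [(1, []), idx0])])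
      (by simp only [List.forall_mem_cons, idx0]; simp) (sm hO))
    (fun O hO => emits_emitGates (gs := [(.traceOut, [idx0])]) (by simp [idx0]) (sm hO)) ?_ ?_
  · intro O
    rfl
  · intro j O
    simp only [powerGates, encodeList_append]
    rw [show 1 + (h + O) + k * j = 1 + h + (O + k * j) by ring]

/-- Writing a polarized circuit. -/
def circuitP (b : Fin 2) : Prog Stk :=
  .seq (.push .out .endMark) <|
  .seq (parityP .s 0 (powerP .kk (parityP .r 2 selectP))) <|
  .seq (emitGates ((.ancilla, [idx0]) :: if b = 0 then [] else [(.pauliX, [idx0])])) <|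
  .seq (.seq (.push .out .sep) (emitIdx (0, [.o]))) (.clear .o)

theorem runs_circuitP (b : Fin 2) {k l r K s : ℕ} {w₁ w₂ : List RGate} (hN : k * r * K * s ≤ B)
    (hS : SmallBase B S)
    (hck : S .ck = ticks k) (hdk : S .dk = ticks k) (hcl : S .cl = ticks l) (hdl : S .dl = ticks l)
    (h1 : S .q1 = (encodeList w₁).reverse) (h2 : S .q2 = (encodeList w₂).reverse)
    (hr : S .r = ticks r) (hK : S .kk = ticks K) (hs : S .s = ticks s) (x : List Sym) :
    (circuitP b).Runs B (emState S 0 0 x) (emState S 0 0 (unary (k * r * K * s) ++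
      (encodeList (bitGates b ++ polarGates k l w₁ w₂ r K s) ++ [.endMark]) ++ x)) := by
  have a1 := adds_selectP (N := B) le_rfl hS hck hdk hcl hdl h1 h2
  have a2 := adds_parityP (c := .r) (h := 2) (by decide) (by decide) (by decide) le_rfl hS hr a1
  have a3 := adds_powerP (c := .kk) (h := 1) (by decide) (by decide) (by decide) le_rfl hS hK a2
  have a4 := adds_parityP (c := .s) (h := 0) (T := powerGates (k * r) (parityGates k
    (selectGates k l w₁ w₂) r) K) (by decide) (by decide) (by decide) le_rfl hS hs a3
  have sm : ∀ {O}, O ≤ B → Small B S O 0 := fun hO => hS.small hO (by omega)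
  have a5 := a4 0 ([.endMark] ++ x) (by omega)
  rw [zero_add] at a5
  refine ⟨_, emits_push .endMark x, _, a5, ?_⟩
  have a6 := emits_emitGates (B := B) (S := S) (O := k * r * K * s) (I := 0)
    (gs := (.ancilla, [idx0]) :: if b = 0 then [] else [(.pauliX, [idx0])])
    (by fin_cases b <;> simp [idx0]) (sm hN)
  -- At the end `o` holds the total number of input wires, which is exactly the header of the
  -- description.
  refine ⟨_, a6 _, _, (emits_push .sep).seq (emits_emitIdx (by simp) (sm hN)) _, ?_⟩
  refine ⟨(length_ticks _).trans_le hN, ?_⟩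
  have hv : idxVal S (k * r * K * s) 0 (0, [.o]) = k * r * K * s := by
    simp [idxVal, emState, length_ticks]
  have hb : ((.ancilla, [idx0]) :: if b = 0 then [] else [(.pauliX, [idx0])] : List SGate).flatMap
      (SGate.encode S (k * r * K * s) 0) = encodeList (bitGates b) := by
    fin_cases b <;> rfl
  have := update_o (S := S) (O := k * r * K * s) (I := 0) (unary (k * r * K * s) ++
      (encodeList (bitGates b ++ polarGates k l w₁ w₂ r K s) ++ [.endMark]) ++ x) 0
  rw [← this]
  rw [hb, hv, unary, encodeList_append, polarGates]
  simp only [List.append_assoc, zero_add]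
  rfl

end

section

/-! ### Reading the input and computing the parameters -/

/-- The stacks of the polarization program before it starts to write its output. -/
structure PSt where
  inp : List Sym := []
  mode : List Sym := []
  q1 : List Sym := []
  q2 : List Sym := []
  ck : ℕ := 0
  dk : ℕ := 0
  cl : ℕ := 0
  dl : ℕ := 0
  s : ℕ := 0
  a : ℕ := 0
  b : ℕ := 0
  par : ℕ := 0
  len : ℕ := 0
  r : ℕ := 0
  kk : ℕ := 0
  t : ℕ := 0

def PSt.stk (st : PSt) : Stk → List Sym
  | .inp => st.inp
  | .mode => st.mode
  | .q1 => st.q1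
  | .q2 => st.q2
  | .ck => ticks st.ck
  | .dk => ticks st.dk
  | .cl => ticks st.cl
  | .dl => ticks st.dl
  | .s => ticks st.s
  | .a => ticks st.a
  | .b => ticks st.b
  | .par => ticks st.par
  | .len => ticks st.len
  | .r => ticks st.r
  | .kk => ticks st.kk
  | .t => ticks st.t
  | .i => []
  | .o => []
  | .out => []

variable {B : ℕ}

/-- Reading one symbol. The top of the stack `mode` tells which part of the input is being read. -/
def parseStep (st : PSt) (x : Sym) : PSt :=
  match st.mode.head? with
  | none => if x = .tick then { st with ck := st.ck + 1, cl := st.cl + 1 }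
      else { st with mode := .sep :: st.mode }
  | some .sep => if x = .endMark then { st with mode := .endMark :: st.mode }
      else { st with
        q1 := x :: st.q1
        cl := if x = .ancilla then st.cl + 1 else if x = .traceOut then st.cl - 1 else st.cl }
  | some .endMark => if x = .sep then { st with mode := .tick :: st.mode } else st
  | some .tick => if x = .endMark then { st with mode := .ancilla :: st.mode }
      else { st with q2 := x :: st.q2 }
  | some _ => { st with s := st.s + 1, a := st.a + 1 }

/-- The program for reading one symbol. -/
def parseBody (x : Sym) : Prog Stk :=
  .case .mode fun m => match m with
  | none => if x = .tick then .seq (.push .ck .tick) (.push .cl .tick) else .push .mode .sep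
  | some .sep => if x = .endMark then .push .mode .endMark
      else .seq (.push .q1 x) (if x = .ancilla then .push .cl .tick
        else if x = .traceOut then .drop .cl else .skip)
  | some .endMark => if x = .sep then .push .mode .tick else .skip
  | some .tick => if x = .endMark then .push .mode .ancilla else .push .q2 x
  | some _ => .seq (.push .s .tick) (.push .a .tick)

theorem runs_parseBody (st : PSt) (x : Sym) :
    (parseBody x).Runs B st.stk (parseStep st x).stk := by
  have hm : st.stk .mode = st.mode := rfl
  unfold parseBody parseStep
  unfold Prog.Runs
  rw [hm]
  rcases st.mode.head? with _ | m
  · dsimp only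
    split_ifs
    · exact ⟨_, rfl, by funext k; cases k <;> rfl⟩
    · show _ = _
      funext k; cases k <;> rfl
  cases m
  case sep =>
    dsimp only
    split_ifs
    · show _ = _
      funext k; cases k <;> rfl
    · exact ⟨_, rfl, by funext k; cases k <;> rfl⟩
    · refine ⟨_, rfl, ?_⟩
      show _ = _
      funext k
      -- Dropping from a unary stack agrees with truncated subtraction also when the stack is empty.
      cases k <;> first | rfl | exact List.tail_replicate.symm
    · exact ⟨_, rfl, by funext k; cases k <;> rfl⟩
  case endMark =>
    dsimp only
    split_ifs
    · show _ = _
      funext k; cases k <;> rfl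
    · rfl
  case tick =>
    dsimp only
    split_ifs
    · show _ = _
      funext k; cases k <;> rfl
    · show _ = _
      funext k; cases k <;> rfl
  all_goals exact ⟨_, rfl, by funext k; cases k <;> rfl⟩

theorem runs_parse (st : PSt) (h : st.inp.length ≤ B) :
    (Prog.each .inp parseBody).Runs B st.stk (st.inp.foldl parseStep st).stk := by
  refine ⟨h, fun j => ((st.inp.take j).foldl parseStep st).stk, rfl,
    by simp only [show (st.stk .inp) = st.inp from rfl, List.take_length], fun j a ha => ?_⟩
  have ha' : st.inp[j]? = some a := ha
  have := runs_parseBody (B := B) ((st.inp.take j).foldl parseStep st) a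
  simp only [List.take_add_one, ha', Option.toList_some, List.foldl_append, List.foldl_cons,
    List.foldl_nil]
  exact this

theorem foldl_parseStep_zero (st : PSt) (h : st.mode = []) (k : ℕ) :
    (unary k).foldl parseStep st =
      { st with mode := [.sep], ck := st.ck + k, cl := st.cl + k } := by
  induction k generalizing st with
  | zero => simp [unary, parseStep, h]
  | succ k ih =>
    rw [show unary (k + 1) = .tick :: unary k from rfl, List.foldl_cons, ih]
    · simp [parseStep, h]; omega
    · simp [parseStep, h]

theorem foldl_parseStep_unary_one (st : PSt) {m : List Sym} (h : st.mode = .sep :: m) (k : ℕ) :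
    (unary k).foldl parseStep st = { st with q1 := (unary k).reverse ++ st.q1 } := by
  induction k generalizing st with
  | zero => simp [unary, parseStep, h]
  | succ k ih =>
    rw [show unary (k + 1) = .tick :: unary k from rfl, List.foldl_cons, ih]
    · simp [parseStep, h]
    · simp [parseStep, h]

/-- The counter `cl` follows the current number of wires, so after the first circuit it is the
number of output qubits. The second circuit has the same type and is merely copied. -/
theorem foldl_parseStep_gate_one {n m : ℕ} (g : Gate n m) (st : PSt) {x : List Sym}
    (h : st.mode = .sep :: x) (hn : st.cl = n) : g.encode.foldl parseStep st =
      { st with q1 := g.encode.reverse ++ st.q1, cl := m } := by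
  have e (a : Sym) (h1 : a ≠ .endMark) (h2 : a ≠ .ancilla) (h3 : a ≠ .traceOut) :
      parseStep st a = { st with q1 := a :: st.q1 } := by
    simp [parseStep, h, h1, h2, h3]
  have u (i : ℕ) (y : List Sym) (c : ℕ) :=
    foldl_parseStep_unary_one { st with q1 := y, cl := c } h i
  cases g with
  | swap i j =>
    rw [Gate.encode, List.foldl_cons, e _ (by decide) (by decide) (by decide), List.foldl_append,
      u i, u j]
    simp [hn]
  | cnot i j =>
    rw [Gate.encode, List.foldl_cons, e _ (by decide) (by decide) (by decide), List.foldl_append,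
      u i, u j]
    simp [hn]
  | ancilla i =>
    have e' : parseStep st .ancilla = { st with q1 := .ancilla :: st.q1, cl := st.cl + 1 } := by
      simp [parseStep, h]
    rw [Gate.encode, List.foldl_cons, e', u i]
    simp [hn]
  | traceOut i =>
    have e' : parseStep st .traceOut = { st with q1 := .traceOut :: st.q1, cl := st.cl - 1 } := by
      simp [parseStep, h]
    rw [Gate.encode, List.foldl_cons, e', u i]
    simp [hn]
  | _ i =>
    rw [Gate.encode, List.foldl_cons, e _ (by decide) (by decide) (by decide), u i]
    simp [hn]

theorem foldl_parseStep_one {n m : ℕ} (C : Circuit n m) (st : PSt) {x : List Sym}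
    (h : st.mode = .sep :: x) (hn : st.cl = n) : C.encodeGates.foldl parseStep st =
      { st with
        mode := .endMark :: st.mode
        q1 := (encodeList C.raw).reverse ++ st.q1
        cl := m } := by
  induction C generalizing st with
  | nil => simp [Circuit.encodeGates, Circuit.raw, encodeList, parseStep, h, ← hn]
  | cons g C ih =>
    rw [Circuit.encodeGates, List.foldl_append, foldl_parseStep_gate_one g st h hn,
      ih { st with q1 := g.encode.reverse ++ st.q1, cl := _ } h rfl]
    simp [Circuit.raw, encodeList, Gate.encode_raw]

theorem foldl_parseStep_two (st : PSt) {x : List Sym} (h : st.mode = .endMark :: x) (k : ℕ) :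
    (unary k).foldl parseStep st = { st with mode := .tick :: st.mode } := by
  induction k generalizing st with
  | zero => simp [unary, parseStep, h]
  | succ k ih =>
    rw [show unary (k + 1) = .tick :: unary k from rfl, List.foldl_cons, ih]
    · simp [parseStep, h]
    · simp [parseStep, h]

theorem foldl_parseStep_list (w : List Sym) (st : PSt) {x : List Sym} (h : st.mode = .tick :: x)
    (hw : .endMark ∉ w) :
    w.foldl parseStep st = { st with q2 := w.reverse ++ st.q2 } := by
  induction w generalizing st with
  | nil => simp
  | cons a w ih =>
    have ha : a ≠ .endMark := fun e => hw (e ▸ List.mem_cons_self)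
    rw [List.foldl_cons, ih]
    · simp [parseStep, h, ha]
    · simp [parseStep, h, ha]
    · exact fun e => hw (List.mem_cons_of_mem _ e)

theorem endMark_not_mem (w : List RGate) : .endMark ∉ encodeList w := by
  have hu : ∀ i, Sym.endMark ∉ unary i := by simp [unary]
  simp only [encodeList, List.mem_flatMap, not_exists, not_and]
  intro g _
  cases g <;> simp [RGate.encode, hu]

theorem foldl_parseStep_four (st : PSt) {x : List Sym} (h : st.mode = .ancilla :: x) (n : ℕ) :
    (ticks n).foldl parseStep st = { st with s := st.s + n, a := st.a + n } := by
  induction n generalizing st with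
  | zero => rfl
  | succ n ih =>
    rw [ticks_succ, List.foldl_cons, ih]
    · simp [parseStep, h]; omega
    · simp [parseStep, h]

theorem foldl_parseStep_encodeInput (Q : CircuitPair) (n : ℕ) (x : List Sym) :
    (encodeInput (Q, n)).foldl parseStep { inp := x } =
      { inp := x
        mode := [.ancilla, .tick, .endMark, .sep]
        q1 := (encodeList Q.fst.raw).reverse
        q2 := (encodeList Q.snd.raw).reverse
        ck := Q.inputs
        cl := Q.outputs
        s := n
        a := n } := by
  have hn : List.replicate n Sym.tick = ticks n := rfl
  simp only [encodeInput, CircuitPair.encode, Circuit.encode, List.foldl_append, hn]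
  rw [foldl_parseStep_zero { inp := x } rfl,
    foldl_parseStep_one (x := []) _ { inp := x, mode := [.sep], ck := _, cl := _ } rfl
      (Nat.zero_add _),
    foldl_parseStep_two (x := [.sep]) { inp := x, mode := _, q1 := _, ck := _, cl := _ } rfl,
    Circuit.encode_raw, List.foldl_append,
    foldl_parseStep_list (x := [.endMark, .sep]) _
      { inp := x, mode := _, q1 := _, ck := _, cl := _ } rfl (endMark_not_mem _),
    List.foldl_cons, List.foldl_nil]
  rw [foldl_parseStep_four (x := [.tick, .endMark, .sep])]
  · simp [parseStep]
  · simp [parseStep]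

end

section

/-! ### Computing the parameters -/

variable {B : ℕ}

theorem runs_each_stk {k : Stk} {f : Sym → Prog Stk} {st : PSt} {n : ℕ} (σ : ℕ → PSt)
    (hn : (st.stk k).length = n) (hB : n ≤ B) (h0 : (σ 0).stk = st.stk)
    (h : ∀ i < n, ∀ a, (f a).Runs B (σ i).stk (σ (i + 1)).stk) :
    (Prog.each k f).Runs B st.stk (σ n).stk :=
  ⟨hn.trans_le hB, fun i => (σ i).stk, h0, by rw [hn], fun i a ha =>
    h i (hn ▸ (List.getElem?_eq_some_iff.1 ha).1) a⟩

/-- The program for `st.a ↦ st.a / 2`. -/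
def halveP : Prog Stk :=
  .seq (.each .a fun _ => .case .par fun x => match x with
    | none => .push .par .tick
    | some _ => .seq (.clear .par) (.push .b .tick)) <|
  .seq (.clear .par) <| .seq (.clear .a) <| .seq (.each .b fun _ => .push .a .tick) (.clear .b)

theorem runs_halveP (st : PSt) (hb : st.b = 0) (hp : st.par = 0) (ha : st.a ≤ B) :
    halveP.Runs B st.stk { st with a := st.a / 2 }.stk := by
  obtain ⟨inp, mode, q1, q2, ck, dk, cl, dl, s, a, b, par, len, r, kk, t⟩ := st
  obtain rfl : b = 0 := hb
  obtain rfl : par = 0 := hp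
  change a ≤ B at ha
  set st : PSt := ⟨inp, mode, q1, q2, ck, dk, cl, dl, s, a, 0, 0, len, r, kk, t⟩ with hst
  -- Each second tick of `a` is carried over to `b`, with `par` holding the parity of the ticks
  -- seen.
  refine ⟨_, runs_each_stk (n := a) (fun i => { st with b := i / 2, par := i % 2 })
    (length_ticks _) ha rfl ?_, ?_⟩
  · intro i hi _
    rcases Nat.mod_two_eq_zero_or_one i with h | h
    · rw [h, show (i + 1) / 2 = i / 2 by omega, show (i + 1) % 2 = 1 by omega]
      show _ = _
      funext k; cases k <;> rfl
    · rw [h, show (i + 1) / 2 = i / 2 + 1 by omega, show (i + 1) % 2 = 0 by omega]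
      refine ⟨_, ⟨(length_ticks 1).trans_le (by omega), rfl⟩, ?_⟩
      show _ = _
      funext k; cases k <;> rfl
  · refine ⟨{ st with b := a / 2 }.stk, ⟨(length_ticks _).trans_le (show a % 2 ≤ B by omega), ?_⟩,
      { st with b := a / 2, a := 0 }.stk, ⟨(length_ticks _).trans_le ha, ?_⟩, ?_⟩
    · funext k; cases k <;> rfl
    · funext k; cases k <;> rfl
    refine ⟨_, runs_each_stk (n := a / 2) (fun i => { st with b := a / 2, a := i })
      (length_ticks _) (by omega) rfl ?_,
      (length_ticks _).trans_le (show a / 2 ≤ B by omega), ?_⟩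
    · intro i hi _
      show _ = _
      funext k; cases k <;> rfl
    · funext k; cases k <;> rfl

/-- Computing the number of binary digits of `st.a`, when `st.s` is sufficiently large. -/
def sizeP : Prog Stk :=
  .each .s fun _ => .case .a fun x => match x with
    | none => .skip
    | some _ => .seq (.push .len .tick) halveP

theorem size_div_two {n : ℕ} (hn : n ≠ 0) : n.size = (n / 2).size + 1 := by
  conv_lhs => rw [← Nat.bit_bodd_div2 n]
  rw [Nat.size_bit (by rwa [Nat.bit_bodd_div2]), Nat.div2_val]

/-- The number of binary digits is the number of halvings before zero is reached. Looping over `s`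
itself gives enough rounds, and the surplus rounds do nothing. -/
theorem runs_sizeP (st : PSt) (hb : st.b = 0) (hp : st.par = 0) (hl : st.len = 0)
    (ha : st.a = st.s) (hs : st.s ≤ B) :
    sizeP.Runs B st.stk { st with a := 0, len := st.s.size }.stk := by
  have := runs_each_stk (B := B) (k := .s) (st := st) (n := st.s) (f := fun _ => .case .a fun x =>
    match x with
    | none => .skip
    | some _ => .seq (.push .len .tick) halveP)
    (fun i => { st with a := st.s / 2 ^ i, len := st.s.size - (st.s / 2 ^ i).size })
    (length_ticks _) hs ?_ ?_
  · have h : st.s / 2 ^ st.s = 0 := Nat.div_eq_of_lt st.s.lt_two_pow_self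
    rw [h] at this
    exact this
  · simp only [pow_zero, Nat.div_one, Nat.sub_self]
    funext k
    cases k <;> first | rfl | exact congrArg ticks ha.symm | exact congrArg ticks hl.symm
  · intro i hi _
    have e : st.s / 2 ^ (i + 1) = st.s / 2 ^ i / 2 := by rw [pow_succ, Nat.div_div_eq_div_mul]
    have hle : st.s / 2 ^ i ≤ st.s := Nat.div_le_self _ _
    rw [e]
    have hsz : (st.s / 2 ^ i).size ≤ st.s.size := Nat.size_le_size hle
    generalize st.s / 2 ^ i = x at *
    rcases x with _ | x
    · exact rfl
    · refine ⟨{ st with a := x + 1, len := st.s.size - (x + 1).size + 1 }.stk, ?_, ?_⟩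
      · show _ = _
        funext k; cases k <;> rfl
      · have h2 := size_div_two x.succ_ne_zero
        rw [show st.s.size - (x + 1).size + 1 = st.s.size - ((x + 1) / 2).size by
          simp only [Nat.succ_eq_add_one] at h2; omega]
        exact runs_halveP { st with a := x + 1, len := _ } hb hp (hle.trans hs)

/-- Pushing `n` ticks. -/
def pushTicks (k : Stk) : ℕ → Prog Stk
  | 0 => .skip
  | n + 1 => .seq (pushTicks k n) (.push k .tick)

theorem runs_pushTicks (k : Stk) (n : ℕ) (S : Stk → List Sym) :
    (pushTicks k n).Runs B S (Function.update S k (ticks n ++ S k)) := by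
  induction n with
  | zero => exact (Function.update_eq_self k S)
  | succ n ih =>
    refine ⟨_, ih, ?_⟩
    show _ = _
    rw [Function.update_self, Function.update_idem]
    rfl

/-- Computing `st.r = c * st.len`. -/
def mulP (c : ℕ) : Prog Stk := .each .len fun _ => pushTicks .r c

theorem runs_mulP (c : ℕ) (st : PSt) (hr : st.r = 0) (hl : st.len ≤ B) :
    (mulP c).Runs B st.stk { st with r := c * st.len }.stk := by
  refine runs_each_stk (n := st.len) (fun i => { st with r := c * i }) (length_ticks _) hl
    (by rw [mul_zero, ← hr]) ?_
  intro i hi _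
  convert runs_pushTicks .r c _
  funext k
  cases k <;> first | rfl | skip
  rw [Function.update_self]
  show ticks (c * (i + 1)) = ticks c ++ ticks (c * i)
  rw [← ticks_add]
  congr 1
  ring

/-- Computing `st.kk = M ^ st.len`. -/
def powP (M : ℕ) : Prog Stk :=
  .seq (.push .kk .tick) <| .each .len fun _ =>
    .seq (.each .kk fun _ => pushTicks .t M) <|
    .seq (.clear .kk) <|
    .seq (.each .t fun _ => .push .kk .tick) (.clear .t)

theorem runs_powP (M : ℕ) (st : PSt) (hk : st.kk = 0) (ht : st.t = 0) (hl : st.len ≤ B)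
    (hM : ∀ i ≤ st.len, M ^ i ≤ B) :
    (powP M).Runs B st.stk { st with kk := M ^ st.len }.stk := by
  obtain ⟨inp, mode, q1, q2, ck, dk, cl, dl, s, a, b, par, len, r, kk, t⟩ := st
  obtain rfl : kk = 0 := hk
  obtain rfl : t = 0 := ht
  set st : PSt := ⟨inp, mode, q1, q2, ck, dk, cl, dl, s, a, b, par, len, r, 0, 0⟩ with hst
  refine ⟨{ st with kk := 1 }.stk, ?_, runs_each_stk (k := .len) (st := { st with kk := 1 }) (n := len)
    (fun i => { st with kk := M ^ i }) (length_ticks _) hl rfl ?_⟩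
  · show _ = _
    funext k; cases k <;> rfl
  intro i hi _
  have h1 : M ^ i ≤ B := hM i hi.le
  have h2 : M ^ (i + 1) ≤ B := hM (i + 1) hi
  refine ⟨_, runs_each_stk (n := M ^ i) (fun j => { st with kk := M ^ i, t := M * j })
    (length_ticks _) h1 rfl ?_, { st with t := M ^ (i + 1) }.stk,
    ⟨(length_ticks _).trans_le h1, ?_⟩, _, runs_each_stk (k := .t) (st := { st with kk := 0, t := M ^ (i + 1) }) (n := M ^ (i + 1))
      (fun j => { st with kk := j, t := M ^ (i + 1) }) (length_ticks _) h2 rfl ?_,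
    (length_ticks _).trans_le h2, ?_⟩
  · intro j hj _
    convert runs_pushTicks .t M _
    funext k
    cases k <;> first | rfl | skip
    rw [Function.update_self]
    show ticks (M * (j + 1)) = ticks M ++ ticks (M * j)
    rw [← ticks_add]
    congr 1
    ring
  · funext k
    cases k <;> first | rfl | skip
    show ticks (M ^ (i + 1)) = ticks (M * M ^ i)
    rw [pow_succ']
  · intro j hj _
    show _ = _
    funext k; cases k <;> rfl
  · funext k; cases k <;> rfl

/-- Emptying stacks. -/
def clearP : List Stk → Prog Stk
  | [] => .skip
  | k :: ks => .seq (.clear k) (clearP ks)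

theorem runs_clearP {ks : List Stk} {S : Stk → List Sym} (h : ∀ k ∈ ks, (S k).length ≤ B) :
    (clearP ks).Runs B S fun k => if k ∈ ks then [] else S k := by
  induction ks generalizing S with
  | nil => exact rfl
  | cons k ks ih =>
    refine ⟨_, ⟨h k List.mem_cons_self, rfl⟩, ?_⟩
    convert ih (S := Function.update S k []) ?_ using 1
    · funext j
      by_cases hj : j = k
      · subst hj; simp
      · simp [hj]
    · intro j hj
      by_cases hjk : j = k
      · subst hjk; simp
      · rw [Function.update_of_ne hjk]
        exact h j (List.mem_cons_of_mem _ hj)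

end

section

/-! ### The polarization program is well-formed -/

/-- The program is well-formed and mentions only the stacks in `T`. -/
def WFOn (T : Finset Stk) (p : Prog Stk) : Prop := p.WF ∧ ∀ k, p.Uses k → k ∈ T

namespace WFOn

variable {T T' : Finset Stk} {p q : Prog Stk} {k : Stk}

theorem mono (h : WFOn T' p) (hT : T' ⊆ T) : WFOn T p := ⟨h.1, fun k hk => hT (h.2 k hk)⟩

theorem skip : WFOn T .skip := ⟨trivial, fun _ h => h.elim⟩

theorem push (hk : k ∈ T) (a : Sym) : WFOn T (.push k a) := ⟨trivial, fun _ h => h ▸ hk⟩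

theorem drop (hk : k ∈ T) : WFOn T (.drop k) := ⟨trivial, fun _ h => h ▸ hk⟩

theorem clear (hk : k ∈ T) : WFOn T (.clear k) := ⟨trivial, fun _ h => h ▸ hk⟩

theorem seq (hp : WFOn T p) (hq : WFOn T q) : WFOn T (.seq p q) :=
  ⟨⟨hp.1, hq.1⟩, fun k h => h.elim (hp.2 k) (hq.2 k)⟩

theorem case (hk : k ∈ T) {f : Option Sym → Prog Stk} (hf : ∀ x, WFOn T (f x)) :
    WFOn T (.case k f) :=
  ⟨fun x => (hf x).1, fun j h => h.elim (fun h => h ▸ hk) fun ⟨x, hx⟩ => (hf x).2 j hx⟩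

theorem each (T' : Finset Stk) (hT : insert k T' ⊆ T) (hk : k ∉ T') {f : Sym → Prog Stk}
    (hf : ∀ x, WFOn T' (f x)) : WFOn T (.each k f) :=
  ⟨fun x => ⟨(hf x).1, fun h => hk ((hf x).2 k h)⟩,
    fun j h => h.elim (fun h => h ▸ hT (Finset.mem_insert_self _ _)) fun ⟨x, hx⟩ =>
      hT (Finset.mem_insert_of_mem ((hf x).2 j hx))⟩

theorem emitConst (hT : .out ∈ T) (n : ℕ) : WFOn T (emitConst n) := by
  induction n with
  | zero => exact skip
  | succ n ih => exact ih.seq (push hT _)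

theorem emitSizes (hT : .out ∈ T) {ks : List Stk} (h : ∀ k ∈ ks, k ≠ .out ∧ k ∈ T) :
    WFOn T (emitSizes ks) := by
  induction ks with
  | nil => exact skip
  | cons k ks ih =>
    refine (ih fun j hj => h j (List.mem_cons_of_mem _ hj)).seq
      (each {.out} ?_ ?_ fun _ => push (Finset.mem_singleton_self _) _)
    · intro j hj
      rcases Finset.mem_insert.1 hj with rfl | hj
      · exact (h _ List.mem_cons_self).2
      · rwa [Finset.mem_singleton.1 hj]
    · rw [Finset.mem_singleton]
      exact (h k List.mem_cons_self).1

theorem emitIdx (hT : .out ∈ T) {x : Idx} (h : ∀ k ∈ x.2, k ≠ .out ∧ k ∈ T) :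
    WFOn T (emitIdx x) := (emitSizes hT h).seq (emitConst hT _)

theorem emitIdxs (hT : .out ∈ T) {xs : List Idx} (h : ∀ x ∈ xs, ∀ k ∈ x.2, k ≠ .out ∧ k ∈ T) :
    WFOn T (emitIdxs xs) := by
  induction xs with
  | nil => exact skip
  | cons x xs ih =>
    exact (ih fun y hy => h y (List.mem_cons_of_mem _ hy)).seq
      ((push hT _).seq (emitIdx hT (h x List.mem_cons_self)))

theorem emitGates (hT : .out ∈ T) {gs : List SGate}
    (h : ∀ g ∈ gs, ∀ x ∈ g.2, ∀ k ∈ x.2, k ≠ .out ∧ k ∈ T) : WFOn T (emitGates gs) := by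
  induction gs with
  | nil => exact skip
  | cons g gs ih =>
    exact (ih fun y hy => h y (List.mem_cons_of_mem _ hy)).seq
      ((emitIdxs hT (h g List.mem_cons_self)).seq (push hT _))

theorem forall_mem_cswapS {P : Idx → Prop} {i j : Idx} (h0 : P (0, [])) (hi : P i) (hj : P j) :
    ∀ g ∈ QCircuit.cswapS i j, ∀ x ∈ g.2, P x := by
  simp only [QCircuit.cswapS, List.forall_mem_cons]
  simp [hi, hj, h0]

theorem cswapS {i j : Idx} (hi : ∀ k ∈ i.2, k ≠ .out ∧ k ∈ T) (hj : ∀ k ∈ j.2, k ≠ .out ∧ k ∈ T) :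
    ∀ g ∈ cswapS i j, ∀ x ∈ g.2, ∀ k ∈ x.2, k ≠ .out ∧ k ∈ T :=
  forall_mem_cswapS (P := fun x => ∀ k ∈ x.2, k ≠ .out ∧ k ∈ T) (by simp) hi hj

theorem emitShifted (T' : Finset Stk) (hT : insert k T' ⊆ T) (hk : k ∉ T') (ho : .out ∈ T')
    {x : Idx} (h : ∀ j ∈ x.2, j ≠ .out ∧ j ∈ T') : WFOn T (emitShifted k x) :=
  each T' hT hk fun a => (push ho a).seq (by
    split_ifs
    · exact emitIdx ho h
    · exact skip)

theorem selectP : WFOn {.out, .i, .o, .q1, .q2, .ck, .dk, .cl, .dl} selectP := by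
  refine (emitGates (by decide) (by simp [idx0])).seq <|
    (each {.i} (by decide) (by decide) fun _ => push (by decide) _).seq <|
    (each {.out, .i, .o, .dl} (by decide) (by decide) fun _ =>
      (drop (by decide)).seq (emitGates (by decide) ?_)).seq <|
    (emitShifted {.out, .o} (by decide) (by decide) (by decide) (by decide)).seq <|
    (emitShifted {.out, .o, .dk} (by decide) (by decide) (by decide) (by decide)).seq <|
    (each {.i} (by decide) (by decide) fun _ => push (by decide) _).seq <|
    (each {.out, .i, .o, .dk} (by decide) (by decide) fun _ =>
      (drop (by decide)).seq (emitGates (by decide) ?_)).seq <|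
    each {.o} (by decide) (by decide) fun _ => push (by decide) _
  · intro g hg
    rcases List.mem_append.1 hg with hg | hg
    · exact cswapS (by decide) (by decide) g hg
    · rw [List.mem_singleton.1 hg]; decide
  · intro g hg
    rcases List.mem_cons.1 hg with rfl | hg
    · decide
    · exact cswapS (by decide) (by decide) g hg

theorem parityP {c : Stk} (h : ℕ) (hp : WFOn T' p) (hT : insert c T' ⊆ T) (hc : c ∉ T')
    (ho : .out ∈ T') (hi : .o ∈ T') : WFOn T (parityP c h p) := by
  have hT' : T' ⊆ T := (Finset.subset_insert _ _).trans hT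
  refine (emitGates (hT' ho) ?_).seq (each T' hT hc fun _ => hp.seq (emitGates ho ?_))
  · simp only [List.forall_mem_cons, idx0]
    simp [hT' hi]
  · simp only [List.forall_mem_cons, idx0]
    simp

theorem powerP {c : Stk} (hp : WFOn T' p) (hT : insert c T' ⊆ T) (hc : c ∉ T')
    (ho : .out ∈ T') : WFOn T (powerP c p) := by
  have hT' : T' ⊆ T := (Finset.subset_insert _ _).trans hT
  refine (emitGates (hT' ho) ?_).seq (each T' hT hc fun _ => hp.seq (emitGates ho ?_))
  · simp only [List.forall_mem_cons, idx0]
    simp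
  · simp only [List.forall_mem_cons, idx0]
    simp

theorem circuitP (b : Fin 2) : WFOn Finset.univ (circuitP b) := by
  have h1 : WFOn {.out, .i, .o, .q1, .q2, .ck, .dk, .cl, .dl, .r} (QCircuit.parityP .r 2 _) :=
    parityP 2 selectP (by decide) (by decide) (by decide) (by decide)
  have h2 : WFOn {.out, .i, .o, .q1, .q2, .ck, .dk, .cl, .dl, .r, .kk} (QCircuit.powerP .kk _) :=
    powerP h1 (by decide) (by decide) (by decide)
  have h3 : WFOn Finset.univ (QCircuit.parityP .s 0 _) :=
    parityP 0 h2 (Finset.subset_univ _) (by decide) (by decide) (by decide)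
  have ho : Stk.out ∈ Finset.univ := Finset.mem_univ _
  refine (push ho _).seq (h3.seq ((emitGates ho ?_).seq
    (((push ho _).seq (emitIdx ho ?_)).seq (clear (Finset.mem_univ _)))))
  · fin_cases b <;> simp [idx0]
  · simp

theorem parseBody (x : Sym) : WFOn {.mode, .q1, .q2, .ck, .cl, .s, .a} (parseBody x) := by
  refine case (by decide) ?_
  rintro (_ | m)
  · dsimp only
    split_ifs
    · exact (push (by decide) _).seq (push (by decide) _)
    · exact push (by decide) _
  cases m
  case sep =>
    dsimp only
    split_ifs
    · exact push (by decide) _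
    · exact (push (by decide) _).seq (push (by decide) _)
    · exact (push (by decide) _).seq (drop (by decide))
    · exact (push (by decide) _).seq skip
  case endMark =>
    dsimp only
    split_ifs
    · exact push (by decide) _
    · exact skip
  case tick =>
    dsimp only
    split_ifs
    · exact push (by decide) _
    · exact push (by decide) _
  all_goals exact (push (by decide) _).seq (push (by decide) _)

theorem halveP : WFOn {.a, .b, .par} halveP := by
  refine (each {.b, .par} (by decide) (by decide) fun _ => case (by decide) ?_).seq <|
    (clear (by decide)).seq <| (clear (by decide)).seq <|
    (each {.a} (by decide) (by decide) fun _ => push (by decide) _).seq (clear (by decide))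
  rintro (_ | _)
  · exact push (by decide) _
  · exact (clear (by decide)).seq (push (by decide) _)

theorem sizeP : WFOn Finset.univ sizeP := by
  refine each {.a, .b, .par, .len} (Finset.subset_univ _) (by decide) fun _ => case (by decide) ?_
  rintro (_ | _)
  · exact skip
  · exact (push (by decide) _).seq (halveP.mono (by decide))

theorem pushTicks (hk : k ∈ T) (n : ℕ) : WFOn T (pushTicks k n) := by
  induction n with
  | zero => exact skip
  | succ n ih => exact ih.seq (push hk _)

theorem mulP (c : ℕ) : WFOn Finset.univ (mulP c) :=
  each {.r} (Finset.subset_univ _) (by decide) fun _ => pushTicks (by decide) c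

theorem powP (M : ℕ) : WFOn Finset.univ (powP M) :=
  (push (Finset.mem_univ _) _).seq <| each {.kk, .t} (Finset.subset_univ _) (by decide) fun _ =>
    (each {.t} (by decide) (by decide) fun _ => pushTicks (by decide) M).seq <|
    (clear (by decide)).seq <|
    (each {.kk} (by decide) (by decide) fun _ => push (by decide) _).seq (clear (by decide))

theorem clearP (ks : List Stk) : WFOn Finset.univ (clearP ks) := by
  induction ks with
  | nil => exact skip
  | cons k ks ih => exact (clear (Finset.mem_univ _)).seq ih

end WFOn

end

section

/-! ### The polarization program -/

/-- Reading the input and computing the parameters of the polarization. -/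
def prepareP (c M : ℕ) : Prog Stk :=
  .seq (.each .inp parseBody) <|
  .seq (.clear .inp) <|
  .seq (.clear .mode) <|
  .seq (.push .s .tick) <|
  .seq (.push .a .tick) <|
  .seq (.each .ck fun _ => .push .dk .tick) <|
  .seq (.each .cl fun _ => .push .dl .tick) <|
  .seq sizeP <|
  .seq (mulP c) (powP M)

/-- Polarization of a pair of circuits. -/
def polarizeP (c M : ℕ) : Prog Stk :=
  .seq (prepareP c M) <|
  .seq (circuitP 1) <|
  .seq (circuitP 0) <|
  clearP [.q1, .q2, .ck, .dk, .cl, .dl, .s, .len, .r, .kk]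

theorem wf_polarizeP (c M : ℕ) : (polarizeP c M).WF := by
  have hp : ∀ k a, WFOn Finset.univ (.push k a) := fun k => WFOn.push (Finset.mem_univ k)
  have hc : ∀ k, WFOn Finset.univ (.clear k) := fun k => WFOn.clear (Finset.mem_univ k)
  have h1 : WFOn Finset.univ (.each .inp parseBody) :=
    WFOn.each _ (Finset.subset_univ _) (by decide) WFOn.parseBody
  have h2 : WFOn Finset.univ (.each .ck fun _ => .push .dk .tick) :=
    WFOn.each {.dk} (Finset.subset_univ _) (by decide) fun _ => WFOn.push (by decide) _
  have h3 : WFOn Finset.univ (.each .cl fun _ => .push .dl .tick) :=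
    WFOn.each {.dl} (Finset.subset_univ _) (by decide) fun _ => WFOn.push (by decide) _
  exact (((h1.seq <| (hc _).seq <| (hc _).seq <| (hp _ _).seq <| (hp _ _).seq <| h2.seq <| h3.seq <|
    WFOn.sizeP.seq <| (WFOn.mulP c).seq (WFOn.powP M)).seq <|
    (WFOn.circuitP 1).seq <| (WFOn.circuitP 0).seq <| WFOn.clearP _)).1

theorem Gate.outputs_le {n m : ℕ} (g : Gate n m) : m ≤ n + g.encode.length := by
  cases g <;> simp [Gate.encode]
  all_goals omega

/-- Each gate adds at most one wire, so the number of output qubits is bounded by the input length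
although it is not written there. -/
theorem Circuit.outputs_le {n m : ℕ} (C : Circuit n m) : m ≤ n + C.encodeGates.length := by
  induction C with
  | nil => exact Nat.le_add_right _ _
  | cons g C ih =>
    have := g.outputs_le
    rw [Circuit.encodeGates, List.length_append]
    omega

/-- The stacks of the polarization program when it begins to write. -/
def preparedState (c M : ℕ) (Q : CircuitPair) (n : ℕ) : PSt :=
  { q1 := (encodeList Q.fst.raw).reverse
    q2 := (encodeList Q.snd.raw).reverse
    ck := Q.inputs
    dk := Q.inputs
    cl := Q.outputs
    dl := Q.outputs
    s := n + 1
    len := (n + 1).size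
    r := c * (n + 1).size
    kk := M ^ (n + 1).size }

variable {B c M : ℕ} {Q : CircuitPair} {n : ℕ}

theorem inputs_le : Q.inputs ≤ (encodeInput (Q, n)).length := by
  simp [encodeInput, CircuitPair.encode, Circuit.encode, unary]

theorem outputs_le : Q.outputs ≤ (encodeInput (Q, n)).length := by
  have := Q.fst.outputs_le
  simp [encodeInput, CircuitPair.encode, Circuit.encode, unary]
  omega

theorem size_le_self (m : ℕ) : m.size ≤ m := Nat.size_le.2 m.lt_two_pow_self

/-- The bound `4 ≤ B` is for clearing the `mode` stack, which ends with four marks. The parsed `n`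
is raised by one, since the parameters are functions of `n + 1`. -/
theorem runs_prepareP (hI : (encodeInput (Q, n)).length ≤ B) (h4 : 4 ≤ B) (hn : n + 1 ≤ B)
    (hM : ∀ i ≤ (n + 1).size, M ^ i ≤ B) :
    (prepareP c M).Runs B (fun k => if k = .inp then encodeInput (Q, n) else [])
      (preparedState c M Q n).stk := by
  have hk : Q.inputs ≤ B := inputs_le.trans hI
  have hl : Q.outputs ≤ B := outputs_le.trans hI
  have hs := (size_le_self (n + 1)).trans hn
  have e0 : (fun k => if k = Stk.inp then encodeInput (Q, n) else []) =
      PSt.stk { inp := encodeInput (Q, n) } := by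
    funext k; cases k <;> rfl
  have h1 := runs_parse (B := B) { inp := encodeInput (Q, n) } hI
  rw [foldl_parseStep_encodeInput] at h1
  rw [e0]
  set st : PSt :=
    { q1 := (encodeList Q.fst.raw).reverse
      q2 := (encodeList Q.snd.raw).reverse
      ck := Q.inputs
      cl := Q.outputs
      s := n + 1
      a := n + 1 } with hst
  refine ⟨_, h1, PSt.stk { st with mode := [.ancilla, .tick, .endMark, .sep], s := n, a := n },
    ⟨hI, ?_⟩, PSt.stk { st with s := n, a := n }, ⟨h4, ?_⟩, PSt.stk { st with a := n }, ?_,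
    st.stk, ?_, _, runs_each_stk (n := Q.inputs) (fun i => { st with dk := i }) (length_ticks _) hk
      rfl ?_,
    _, runs_each_stk (k := .cl) (st := { st with dk := Q.inputs }) (n := Q.outputs)
      (fun i => { st with dk := Q.inputs, dl := i }) (length_ticks _) hl rfl ?_,
    _, runs_sizeP { st with dk := Q.inputs, dl := Q.outputs } rfl rfl rfl rfl hn,
    _, runs_mulP c { st with dk := Q.inputs, dl := Q.outputs, a := 0, len := (n + 1).size } rfl hs,
    runs_powP M { st with dk := Q.inputs, dl := Q.outputs, a := 0, len := (n + 1).size, r := _ }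
      rfl rfl hs hM⟩
  · funext k; cases k <;> rfl
  · funext k; cases k <;> rfl
  · show _ = _
    funext k; cases k <;> rfl
  · show _ = _
    funext k; cases k <;> rfl
  · intro i _ _
    show _ = _
    funext k; cases k <;> rfl
  · intro i _ _
    show _ = _
    funext k; cases k <;> rfl

theorem runs_polarizeP (hI : (encodeInput (Q, n)).length ≤ B) (h4 : 4 ≤ B) (hn : n + 1 ≤ B)
    (hM : ∀ i ≤ (n + 1).size, M ^ i ≤ B) (hc : c * (n + 1).size ≤ B)
    (hN : Q.inputs * (c * (n + 1).size) * M ^ (n + 1).size * (n + 1) ≤ B) {R : CircuitPair}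
    (hR : R.inputs = Q.inputs * (c * (n + 1).size) * M ^ (n + 1).size * (n + 1))
    (h0 : R.fst.raw = bitGates 0 ++ polarGates Q.inputs Q.outputs Q.fst.raw Q.snd.raw
      (c * (n + 1).size) (M ^ (n + 1).size) (n + 1))
    (h1 : R.snd.raw = bitGates 1 ++ polarGates Q.inputs Q.outputs Q.fst.raw Q.snd.raw
      (c * (n + 1).size) (M ^ (n + 1).size) (n + 1)) :
    (polarizeP c M).Runs B (fun k => if k = .inp then encodeInput (Q, n) else [])
      (fun k => if k = .out then R.encode else []) := by
  have hk : Q.inputs ≤ B := inputs_le.trans hI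
  have hl : Q.outputs ≤ B := outputs_le.trans hI
  have hs := (size_le_self (n + 1)).trans hn
  have hq : (encodeList Q.fst.raw).length ≤ B ∧ (encodeList Q.snd.raw).length ≤ B := by
    have := hI
    simp [encodeInput, CircuitPair.encode, Circuit.encode, unary, Circuit.encode_raw] at this
    omega
  set st := preparedState c M Q n with hst
  have hS : SmallBase B st.stk := by
    intro k _ _ _
    cases k <;>
    first
    | exact Nat.zero_le B
    | exact (List.length_reverse).trans_le hq.1
    | exact (List.length_reverse).trans_le hq.2
    | exact (length_ticks _).trans_le hk
    | exact (length_ticks _).trans_le hl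
    | exact (length_ticks _).trans_le hn
    | exact (length_ticks _).trans_le hs
    | exact (length_ticks _).trans_le hc
    | exact (length_ticks _).trans_le (hM _ le_rfl)
  have hst0 : st.stk = emState st.stk 0 0 [] := by
    funext k; cases k <;> rfl
  have hrun := fun b => runs_circuitP (S := st.stk) (B := B) b hN hS rfl rfl rfl rfl rfl rfl rfl rfl
    rfl
  refine ⟨_, runs_prepareP hI h4 hn hM, ?_⟩
  rw [← hst, hst0]
  -- The second circuit of the pair is written first, because later output lands in front.
  refine ⟨_, hrun 1 [], _, hrun 0 _, ?_⟩
  convert runs_clearP (B := B) (ks := [.q1, .q2, .ck, .dk, .cl, .dl, .s, .len, .r, .kk]) ?_ using 1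
  · funext k
    cases k <;> first | rfl | skip
    simp only [reduceIte, CircuitPair.encode, Circuit.encode, Circuit.encode_raw, hR, h0, h1]
    simp [emState]
    rfl
  · intro k hk
    rw [emState_of_ne_of_ne]
    · apply hS <;> (rintro rfl; revert hk; decide)
    all_goals (rintro rfl; revert hk; decide)

/-- A bound for the sizes of the stacks of the polarization program. -/
def polarizeBound (c M : ℕ) : Polynomial ℕ :=
  Polynomial.X * (Polynomial.C c * (Polynomial.X + 1)) * (2 * (Polynomial.X + 1)) ^ M *
    (Polynomial.X + 1) + Polynomial.C c * (Polynomial.X + 1) + (2 * (Polynomial.X + 1)) ^ M +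
    Polynomial.X + 5

/-- `M^i ≤ (2^M)^i = (2^i)^M` and `2^i ≤ 2 (m + 1)`. For the constant `M` this is polynomial in `m`,
and it is what keeps the number of repetitions polynomial. -/
theorem pow_size_le (M m : ℕ) {i : ℕ} (hi : i ≤ (m + 1).size) : M ^ i ≤ (2 * (m + 1)) ^ M := by
  have h1 : M ^ i ≤ (2 ^ M) ^ i := Nat.pow_le_pow_left M.lt_two_pow_self.le i
  have h2 : 2 ^ i ≤ 2 * (m + 1) := by
    rcases i with _ | i
    · omega
    · rw [pow_succ, mul_comm]
      exact Nat.mul_le_mul_left 2 (Nat.lt_size.1 hi)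
  rw [← pow_mul, mul_comm, pow_mul] at h1
  exact h1.trans (Nat.pow_le_pow_left h2 M)

theorem isPolyTime_of_raw (c M : ℕ) {F : CircuitPair × ℕ → CircuitPair}
    (hR : ∀ Q n, (F (Q, n)).inputs =
      Q.inputs * (c * (n + 1).size) * M ^ (n + 1).size * (n + 1))
    (h0 : ∀ Q n, (F (Q, n)).fst.raw = bitGates 0 ++ polarGates Q.inputs Q.outputs Q.fst.raw
      Q.snd.raw (c * (n + 1).size) (M ^ (n + 1).size) (n + 1))
    (h1 : ∀ Q n, (F (Q, n)).snd.raw = bitGates 1 ++ polarGates Q.inputs Q.outputs Q.fst.raw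
      Q.snd.raw (c * (n + 1).size) (M ^ (n + 1).size) (n + 1)) : IsPolyTime F := by
  refine Prog.isPolyTime_of_runs (polarizeP c M) (wf_polarizeP c M) .inp .out (polarizeBound c M) ?_
  rintro ⟨Q, n⟩
  have hk : Q.inputs ≤ (encodeInput (Q, n)).length := inputs_le
  have hn : n ≤ (encodeInput (Q, n)).length := by
    simp only [encodeInput, List.length_append, List.length_replicate]
    omega
  generalize hx : (encodeInput (Q, n)).length = x at *
  have hs : (n + 1).size ≤ x + 1 := (size_le_self _).trans (by omega)
  have hM : ∀ i ≤ (n + 1).size, M ^ i ≤ (2 * (x + 1)) ^ M := fun i hi =>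
    (pow_size_le M n hi).trans (Nat.pow_le_pow_left (by omega) M)
  have hc : c * (n + 1).size ≤ c * (x + 1) := Nat.mul_le_mul_left c hs
  have hN : Q.inputs * (c * (n + 1).size) * M ^ (n + 1).size * (n + 1) ≤
      x * (c * (x + 1)) * (2 * (x + 1)) ^ M * (x + 1) :=
    Nat.mul_le_mul (Nat.mul_le_mul (Nat.mul_le_mul hk hc) (hM _ le_rfl)) (by omega)
  have hP : (polarizeBound c M).eval x = x * (c * (x + 1)) * (2 * (x + 1)) ^ M * (x + 1) +
      c * (x + 1) + (2 * (x + 1)) ^ M + x + 5 := by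
    simp [polarizeBound]
  rw [hP]
  exact runs_polarizeP (by omega) (by omega) (by omega)
    (fun i hi => (hM i hi).trans (by omega)) (by omega) (by omega) (hR Q n) (h0 Q n) (h1 Q n)

end

end

end QCircuit

theorem mainTheorem4 (a b : ℝ) (ha : a ∈ Set.Ioo (0 : ℝ) 2) (hb : b ∈ Set.Ioo (0 : ℝ) 2)
    (hab : 2 * b < a ^ 2) :
    ∃ F : QCircuit.CircuitPair × ℕ → QCircuit.CircuitPair,
      QCircuit.IsPolyTime F ∧
      ∀ (Q : QCircuit.CircuitPair) (n : ℕ),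
        (Q.dist ≤ b → (F (Q, n)).dist < (1 / 2 : ℝ) ^ n) ∧
        (a ≤ Q.dist → 2 - (1 / 2 : ℝ) ^ n < (F (Q, n)).dist) := by
  obtain ⟨c, M, -, h⟩ := QCircuit.exists_polarization_parameters ha.1 ha.2 hb.1 hab
  -- The typed circuits are only chosen to exist; their gate lists `hraw` are explicit, and these
  -- are what the machine writes.
  choose P hraw hchan using fun (Q : QCircuit.CircuitPair) (n : ℕ) (b : Fin 2) =>
    QCircuit.exists_polarized_circuit Q.fst Q.snd (c * (n + 1).size) (M ^ (n + 1).size) (n + 1) b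
  refine ⟨fun I => ⟨_, _, P I.1 I.2 0, P I.1 I.2 1⟩,
    QCircuit.isPolyTime_of_raw c M (fun Q n => rfl) (fun Q n => hraw Q n 0) (fun Q n => hraw Q n 1),
    fun Q n => ?_⟩
  have hQ := h Q.inputs Q.outputs ![Q.fst.channel, Q.snd.channel] (by
    intro i
    fin_cases i
    · exact QCircuit.isChan_circuit Q.fst
    · exact QCircuit.isChan_circuit Q.snd) n
  rw [QCircuit.CircuitPair.dist, QCircuit.CircuitPair.dist, hchan, hchan]
  exact hQ
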